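/- Let $(M,g)$ be a compact Riemannian manifold with smooth boundary, of dimension $d\ge 2$. Let $\nu$ be the outer unit normal of $\partial M$, let $SM=\{(x,v)\in TM : |v|=1\}$, and let $X$ be the derivative along the geodesic flow on $SM$. Set $\partial_\pm(SM)=\{(x,v)\in SM : x\in\partial M,\ \pm\langle v,\nu\rangle\le 0\}$. Assume that $(M,g)$ is nontrapping, i.e. for every $(x,v)\in SM$ the geodesic issued from $(x,v)$ exists in $M$ only for a finite forward time $\tau(x,v)$, and that $\partial M$ is strictly convex, i.e. its second fundamental form $\Pi_x(w,w)=\langle\nabla_w\nu,w\rangle$ is positive definite on $T_x\partial M$ for all $x\in\partial M$. Let $\mathcal A\in C^\infty(SM,\mathbb C^{n\times n})$ and $f\in C^\infty(SM,\mathbb C^n)$. Then the transport equation $$Xu+\mathcal A u=-f\ \text{ in } SM,\qquad u|_{\partial_-(SM)}=0$$ (understood as an ordinary differential equation along each orbit of the geodesic flow, up to its end points) has a unique solution $u=u^f:SM\to\mathbb C^n$. Define the attenuated geodesic ray transform of $f$ by $I_{\mathcal A}f:=u^f|_{\partial_+(SM)}$. If $I_{\mathcal A}f=0$, then $u^f$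 is smooth on all of $SM$ (up to the boundary). -/

import Mathlib

open Set Bundle
open scoped Manifold ContDiff ENNReal

noncomputable section

namespace GeodesicTransport

section Coordinates

/- `M` is a manifold with boundary modelled on the half space `{y ∈ ℝ^d | 0 ≤ y 0}`, with a
Riemannian metric given by the inner products on its tangent spaces. By construction
`TangentSpace (𝓡∂ d) x` is `ℝ^d`, the components being taken in the preferred chart at `x`. -/
variable {d : ℕ} [NeZero d] {M : Type*} [TopologicalSpace M] [ChartedSpace (EuclideanHalfSpace d) M]
  [IsManifold (𝓡∂ d) ∞ M] [RiemannianBundle (fun x : M => TangentSpace (𝓡∂ d) x)]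

/-- The value at `x` of the `i`-th coordinate vector field `∂/∂yⁱ` of the preferred chart
at `x₀`. -/
def coordField (x₀ : M) (i : Fin d) (x : M) : TangentSpace (𝓡∂ d) x :=
  (trivializationAt (EuclideanSpace ℝ (Fin d)) (TangentSpace (𝓡∂ d)) x₀).symm x
    (EuclideanSpace.single i (1 : ℝ))

/-- The matrix `(g_{ij}(y))` of the metric in the preferred chart at `x₀`. -/
def metricMatrix (x₀ : M) (y : EuclideanSpace ℝ (Fin d)) : Matrix (Fin d) (Fin d) ℝ :=
  Matrix.of fun i j =>
    inner ℝ (coordField x₀ i ((extChartAt (𝓡∂ d) x₀).symm y))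
      (coordField x₀ j ((extChartAt (𝓡∂ d) x₀).symm y))

/-- The partial derivative `∂_i h (y)` of a function of the chart variables. The derivative is
taken within the closed half space, so that it is one-sided at boundary points. -/
def partialDeriv (i : Fin d) (h : EuclideanSpace ℝ (Fin d) → ℝ) (y : EuclideanSpace ℝ (Fin d)) :
    ℝ :=
  fderivWithin ℝ h (range (𝓡∂ d)) y (EuclideanSpace.single i (1 : ℝ))

/-- The Christoffel symbols
`Γ^k_{ij} = (1/2) ∑_l g^{kl} (∂_i g_{jl} + ∂_j g_{il} - ∂_l g_{ij})` of the Levi-Civita connection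
in the preferred chart at `x₀`. -/
def christoffel (x₀ : M) (y : EuclideanSpace ℝ (Fin d)) (k i j : Fin d) : ℝ :=
  (1 / 2) * ∑ l, (metricMatrix x₀ y)⁻¹ k l *
    (partialDeriv i (fun z => metricMatrix x₀ z j l) y
      + partialDeriv j (fun z => metricMatrix x₀ z i l) y
      - partialDeriv l (fun z => metricMatrix x₀ z i j) y)

/-- The components `ν^k = -g^{k0} / √g^{00}`, in the preferred chart at `x₀`, of the outer unit
normal of the level sets of the coordinate `y⁰`. The manifold is `{y⁰ ≥ 0}` in this chart; so on
`{y⁰ = 0}` this is the outer unit normal of the boundary. -/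
def normalComponent (x₀ : M) (k : Fin d) (y : EuclideanSpace ℝ (Fin d)) : ℝ :=
  -((metricMatrix x₀ y)⁻¹ k 0) / Real.sqrt ((metricMatrix x₀ y)⁻¹ 0 0)

/-- The outer unit normal `ν` at a boundary point `x`. -/
def outerNormal (x : M) : TangentSpace (𝓡∂ d) x :=
  ∑ k, normalComponent x k (extChartAt (𝓡∂ d) x x) • coordField x k x

/-- The covariant derivative `∇_w ν` of the normal at `x`, for the vector `w = ∑ i, w i • ∂_i`:
its `k`-th component is `w(ν^k) + ∑_{i,j} Γ^k_{ij} w^i ν^j`. -/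
def covDerivNormal (x : M) (w : Fin d → ℝ) : TangentSpace (𝓡∂ d) x :=
  ∑ k, (∑ i, w i * partialDeriv i (normalComponent x k) (extChartAt (𝓡∂ d) x x)
      + ∑ i, ∑ j, christoffel x (extChartAt (𝓡∂ d) x x) k i j * w i
          * normalComponent x j (extChartAt (𝓡∂ d) x x)) • coordField x k x

variable (d M) in
/-- The boundary is strictly convex: the second fundamental form `Π_x(w, w) = ⟨∇_w ν, w⟩` is
positive definite on `T_x ∂M = {w | w 0 = 0}`, for every boundary point `x`. -/
def StrictlyConvexBoundary : Prop :=
  ∀ x ∈ (𝓡∂ d).boundary M, ∀ w : Fin d → ℝ, w 0 = 0 → w ≠ 0 →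
    0 < inner ℝ (covDerivNormal x w) (∑ i, w i • coordField x i x)

/-- The components `v^i` of a tangent vector at `x` in the preferred chart at `x`. -/
def components {x : M} (v : TangentSpace (𝓡∂ d) x) : EuclideanSpace ℝ (Fin d) := v

/-- The geodesic vector field `X` on `TM`. In the coordinates `(y, v)` of `TM` it is
`(v, -Γ(y)(v, v))`; its value at `p` is written in the preferred chart of `TM` at `p`, which is the
one induced by the preferred chart of `M` at the base point. -/
def geodesicField (p : TangentBundle (𝓡∂ d) M) : TangentSpace (𝓡∂ d).tangent p :=
  show EuclideanSpace ℝ (Fin d) × EuclideanSpace ℝ (Fin d) from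
    (components p.2, WithLp.toLp 2 fun k =>
      -∑ i, ∑ j, christoffel p.1 (extChartAt (𝓡∂ d) p.1 p.1) k i j
        * components p.2 i * components p.2 j)

end Coordinates

section Transport

variable (d : ℕ) [NeZero d] (M : Type*) [TopologicalSpace M]
  [ChartedSpace (EuclideanHalfSpace d) M] [IsManifold (𝓡∂ d) ∞ M]
  [RiemannianBundle (fun x : M => TangentSpace (𝓡∂ d) x)]

/-- The unit sphere bundle `SM`. -/
def SphereBundle : Type _ := {p : TangentBundle (𝓡∂ d) M // ‖p.2‖ = 1}

variable {d M}

/-- Smoothness of a function on `SM`: near each point it has one-sided Taylor expansions of all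
orders in the charts of `TM`, along the set `SM`. As `SM` is an embedded submanifold with boundary
of `TM`, this is smoothness up to the boundary on the manifold `SM`. The value `0` that the
function gets outside `SM` plays no role. -/
def IsSmooth {F : Type*} [NormedAddCommGroup F] [NormedSpace ℝ F] (u : SphereBundle d M → F) :
    Prop :=
  ContMDiffOn (𝓡∂ d).tangent 𝓘(ℝ, F) ∞
    (Function.extend (fun p : SphereBundle d M => p.1) u (fun _ => 0))
    {p : TangentBundle (𝓡∂ d) M | ‖p.2‖ = 1}

/-- `c` restricted to `s` is an orbit of the geodesic flow on `SM`, that is,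
`c t = (γ t, γ' t)` for a unit speed geodesic `γ : s → M`. -/
def IsGeodesicOn (c : ℝ → SphereBundle d M) (s : Set ℝ) : Prop :=
  IsMIntegralCurveOn (fun t => (c t).1) (geodesicField (d := d) (M := M)) s

/-- The exit time `τ(x, v) ∈ [0, ∞]`: the supremum of the times `T` such that the geodesic issued
from `(x, v)` exists in `M` on `[0, T]`. -/
def exitTime (p : SphereBundle d M) : ℝ≥0∞ :=
  ⨆ T ∈ {T : ℝ | 0 ≤ T ∧ ∃ c : ℝ → SphereBundle d M, c 0 = p ∧ IsGeodesicOn c (Icc 0 T)},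
    ENNReal.ofReal T

variable (d M) in
/-- `M` is nontrapping: all exit times are finite. -/
def Nontrapping : Prop := ∀ p : SphereBundle d M, exitTime p < ⊤

variable (d M) in
/-- `∂₊(SM)`: the unit vectors at boundary points with `⟨v, ν⟩ ≤ 0`. -/
def inwardBoundary : Set (SphereBundle d M) :=
  {p | p.1.1 ∈ (𝓡∂ d).boundary M ∧ inner ℝ p.1.2 (outerNormal p.1.1) ≤ 0}

variable (d M) in
/-- `∂₋(SM)`: the unit vectors at boundary points with `⟨v, ν⟩ ≥ 0`. -/
def outwardBoundary : Set (SphereBundle d M) :=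
  {p | p.1.1 ∈ (𝓡∂ d).boundary M ∧ 0 ≤ inner ℝ p.1.2 (outerNormal p.1.1)}

variable {n : ℕ}

/-- `u` solves `X u + 𝒜 u = -f` in `SM` with `u = 0` on `∂₋(SM)`. Here `X u` is the derivative of
`u` along the geodesic flow, and it is not assumed that `u` is differentiable (or continuous) in
other directions. -/
structure IsTransportSolution (A : SphereBundle d M → Matrix (Fin n) (Fin n) ℂ)
    (f u : SphereBundle d M → Fin n → ℂ) : Prop where
  hasDerivWithinAt : ∀ (a b : ℝ) (c : ℝ → SphereBundle d M), IsGeodesicOn c (Icc a b) →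
    ∀ t ∈ Icc a b, HasDerivWithinAt (fun s => u (c s))
      (-(A (c t)).mulVec (u (c t)) - f (c t)) (Icc a b) t
  eq_zero : ∀ p ∈ outwardBoundary d M, u p = 0

/-- The solution `u^f` of the transport equation. -/
def transportSolution (A : SphereBundle d M → Matrix (Fin n) (Fin n) ℂ)
    (f : SphereBundle d M → Fin n → ℂ) : SphereBundle d M → Fin n → ℂ :=
  Classical.epsilon (IsTransportSolution A f)

/-- The attenuated geodesic ray transform `I_𝒜 f = u^f|_{∂₊(SM)}`. -/
def rayTransform (A : SphereBundle d M → Matrix (Fin n) (Fin n) ℂ)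
    (f : SphereBundle d M → Fin n → ℂ) : inwardBoundary d M → Fin n → ℂ :=
  fun p => transportSolution A f p.1

end Transport

end GeodesicTransport

end

/-!
Near a unit vector at an interior point, or one pointing strictly inwards at a boundary point, all
geodesics exist for a uniform time, and the solution `u` at the initial vector is a smooth function
of its value a short time later. Hence regularity of `u` propagates backwards along geodesics
(`contMDiffWithinAt_of_forall_later`), and as every geodesic ends on `∂₋(SM)`, it is enough to
prove that `u` is smooth near the vectors of `∂₋(SM)`. There `u` is obtained by solving the
transport equation backwards from the exit point of the geodesic, where `u = 0`; the difficulty is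
that the exit time is not smooth at the vectors tangent to the boundary.

To make sense of solutions that leave the manifold, the coefficients of the equations are extended
across the boundary in a chart, in class `C^N` for arbitrary finite `N`
(`exists_contDiff_eventuallyEq_halfSpace`); the flow of the extended geodesic equation
(`nonempty_geodesicFlow`) is the geodesic flow as long as it stays in the half space. The solution
at a vector is a smooth function of the data at another point of the same short geodesic
(`exists_transportFlow`). At a vector pointing strictly outwards the exit time is smooth by the
implicit function theorem, and so is `u` (`contDiffWithinAt_of_transversal`). At a tangent vector,
strict convexity says that the height above the boundary has negative second derivative along the
geodesic (`christoffelMap_zero_pos`), so that along nearby geodesics it has two zeros, the entrance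
and the exit times. If `I_𝒜 f = 0`, then `u` vanishes at both, and `u` is the same function `G₀` of
either zero. In the coordinate `σ` given by the Morse lemma the zeros are `±√m`, with `m` the
maximal height, which is smooth; thus `u` is an even smooth function of `σ` evaluated at `σ = √m`,
and it is smooth by Whitney's theorem (`contDiffWithinAt_of_fold`, `contDiffWithinAt_of_glancing`).

Existence and uniqueness of `u` come from the linear equation along each geodesic
(`existsUnique_isTransportSolution`). Here the nontrapping condition and the compactness of `SM`
show that each geodesic reaches `∂₋(SM)` (`exists_isGeodesicOn_outwardBoundary`), and strict
convexity that no geodesic can be continued beyond a point of `∂₋(SM)`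
(`IsGeodesicOn.not_mem_outwardBoundary`). That these statements, made in charts, do not depend on
the chart follows from the transformation law of the Christoffel symbols (`spray_transformation`),
which is derived from the defining property of the Levi-Civita connection.
-/

namespace GeodesicTransport

/-! ### Extension of smooth functions from a half space -/

section Extension

open Filter Topology

variable {E F : Type*} [NormedAddCommGroup E] [NormedSpace ℝ E] [NormedAddCommGroup F]
  [NormedSpace ℝ F]

theorem uniqueDiffOn_halfSpace (ℓ : E →L[ℝ] ℝ) {e : E} (he : ℓ e = 1) :
    UniqueDiffOn ℝ {x | 0 ≤ ℓ x} := by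
  have hconv : Convex ℝ {x | 0 ≤ ℓ x} := by
    simpa using convex_halfSpace_ge ℓ.isLinear 0
  have ho : IsOpen {x | 0 < ℓ x} := isOpen_lt continuous_const ℓ.continuous
  have hsub : {x | 0 < ℓ x} ⊆ {x | 0 ≤ ℓ x} := fun x (hx : 0 < ℓ x) => hx.le
  exact uniqueDiffOn_convex hconv ⟨e, interior_maximal hsub ho (by simp [he])⟩

/-- Two functions of class `C^k` on complementary closed half spaces, whose derivatives of order
up to `k` agree on the common hyperplane, glue to a function of class `C^k`. -/
theorem contDiff_ite_halfSpace {k : ℕ} (ℓ : E →L[ℝ] ℝ) {f g : E → F}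
    {p q : E → FormalMultilinearSeries ℝ E F}
    (hf : HasFTaylorSeriesUpToOn k f p {x | 0 ≤ ℓ x})
    (hg : HasFTaylorSeriesUpToOn k g q {x | ℓ x ≤ 0})
    (h : ∀ i ≤ k, ∀ x, ℓ x = 0 → p x i = q x i) :
    ContDiff ℝ k (fun x => if 0 ≤ ℓ x then f x else g x) := by
  classical
  have hcl : IsClosed {x | 0 ≤ ℓ x} := isClosed_le continuous_const ℓ.continuous
  have hcl' : IsClosed {x | ℓ x ≤ 0} := isClosed_le ℓ.continuous continuous_const
  have hun : {x | 0 ≤ ℓ x} ∪ {x | ℓ x ≤ 0} = univ := by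
    ext x; simpa using le_total 0 (ℓ x)
  have hfg : ∀ x, ℓ x = 0 → f x = g x := fun x hx => by
    rw [← hf.zero_eq x hx.ge, ← hg.zero_eq x hx.le, h 0 (Nat.zero_le k) x hx]
  let r : E → FormalMultilinearSeries ℝ E F := fun x i => if 0 ≤ ℓ x then p x i else q x i
  have hr1 : ∀ i, EqOn (fun x => r x i) (fun x => p x i) {x | 0 ≤ ℓ x} := fun i x hx => if_pos hx
  have hr2 : ∀ i ≤ k, EqOn (fun x => r x i) (fun x => q x i) {x | ℓ x ≤ 0} := by
    intro i hi x hx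
    by_cases h0 : 0 ≤ ℓ x
    · simpa [r, h0] using h i hi x (le_antisymm hx h0)
    · simp [r, h0]
  have key : HasFTaylorSeriesUpTo k (fun x => if 0 ≤ ℓ x then f x else g x) r := by
    refine ⟨fun x => ?_, fun m hm x => ?_, fun m hm => ?_⟩
    · by_cases h0 : 0 ≤ ℓ x
      · simpa [r, h0] using hf.zero_eq x h0
      · simpa [r, h0] using hg.zero_eq x (le_of_not_ge h0)
    · have hm' : m + 1 ≤ k := by exact_mod_cast hm
      rw [← hasFDerivWithinAt_univ, ← hun]
      refine HasFDerivWithinAt.union ?_ ?_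
      · by_cases hx : x ∈ {x | 0 ≤ ℓ x}
        · have := (hf.fderivWithin m hm x hx).congr (hr1 m) (hr1 m hx)
          rwa [← show r x (m + 1) = p x (m + 1) from hr1 (m + 1) hx] at this
        · exact HasFDerivWithinAt.of_notMem_closure (by rwa [hcl.closure_eq])
      · by_cases hx : x ∈ {x | ℓ x ≤ 0}
        · have := (hg.fderivWithin m hm x hx).congr (hr2 m (by omega)) (hr2 m (by omega) hx)
          rwa [← show r x (m + 1) = q x (m + 1) from hr2 (m + 1) hm' hx] at this
        · exact HasFDerivWithinAt.of_notMem_closure (by rwa [hcl'.closure_eq])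
    · have hm' : m ≤ k := by exact_mod_cast hm
      rw [← continuousOn_univ, ← hun]
      exact ((hf.cont m hm).congr (hr1 m)).union_of_isClosed
        ((hg.cont m hm).congr (hr2 m hm')) hcl hcl'
  exact key.contDiff

/-- Weights `a` and nodes `b` with `∑ j, a j * P (b j) = P 0` for every polynomial `P` of degree at
most `k`; the nodes lie in `(-∞, -1)`. -/
theorem exists_extrapolation_weights (k : ℕ) :
    ∃ a b : Fin (k + 1) → ℝ, (∀ j, b j < -1) ∧
      ∀ m ≤ k, ∑ j, a j * b j ^ m = if m = 0 then 1 else 0 := by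
  let b : Fin (k + 1) → ℝ := fun j => -((j : ℝ) + 2)
  have hb : Function.Injective b := fun i j hij => by
    have : (i : ℝ) = j := by simpa [b] using hij
    exact Fin.ext (by exact_mod_cast this)
  refine ⟨fun j => (Lagrange.basis Finset.univ b j).eval 0, b, fun j => ?_, fun m hm => ?_⟩
  · have : (0 : ℝ) ≤ j := Nat.cast_nonneg _
    simp only [b]; linarith
  · have h := Lagrange.eq_interpolate (f := (Polynomial.X : Polynomial ℝ) ^ m)
      (hb.injOn (s := (Finset.univ : Finset (Fin (k + 1))))) (by
        rw [Polynomial.degree_X_pow]; simp; exact_mod_cast Nat.lt_succ_of_le hm)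
    have h0 := congrArg (Polynomial.eval 0) h
    rw [Lagrange.interpolate_apply, Polynomial.eval_finsetSum] at h0
    simp only [Polynomial.eval_mul, Polynomial.eval_C, Polynomial.eval_pow,
      Polynomial.eval_X] at h0
    rw [Finset.sum_congr rfl fun j _ => mul_comm _ _, ← h0]
    split_ifs with hm0
    · simp [hm0]
    · simp [hm0]

/-- **Reflection.** A function of class `C^k` on a closed half space extends to a function of class
`C^k` on the whole space. On the other half space the extension is a linear combination of the
values at the points obtained by reflecting and stretching in a transversal direction, with weights
such that the derivatives of order up to `k` match. -/
theorem exists_contDiff_eqOn_halfSpace {k : ℕ} (ℓ : E →L[ℝ] ℝ) {e : E} (he : ℓ e = 1) {f : E → F}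
    (hf : ContDiffOn ℝ k f {x | 0 ≤ ℓ x}) :
    ∃ g : E → F, ContDiff ℝ k g ∧ EqOn g f {x | 0 ≤ ℓ x} := by
  classical
  obtain ⟨a, b, hb, hab⟩ := exists_extrapolation_weights k
  set H : Set E := {x | 0 ≤ ℓ x}
  set H' : Set E := {x | ℓ x ≤ 0}
  have hH : UniqueDiffOn ℝ H := uniqueDiffOn_halfSpace ℓ he
  have hH' : UniqueDiffOn ℝ H' := by
    simpa [H'] using uniqueDiffOn_halfSpace (-ℓ) (e := -e) (by simp [he])
  let L : E →L[ℝ] E := ℓ.smulRight e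
  let R : ℝ → E →L[ℝ] E := fun c => ContinuousLinearMap.id ℝ E + c • L
  have hR : ∀ c x, R c x = x + (c * ℓ x) • e := fun c x => by simp [R, L, smul_smul]
  have hℓR : ∀ c x, ℓ (R c x) = (1 + c) * ℓ x := fun c x => by
    rw [hR]; simp [he]; ring
  have hmaps : ∀ j, MapsTo (R (b j)) H' H := fun j x (hx : ℓ x ≤ 0) => by
    change 0 ≤ ℓ (R (b j) x)
    rw [hℓR]
    exact mul_nonneg_of_nonpos_of_nonpos (by linarith [hb j]) hx
  have hfix : ∀ c x, ℓ x = 0 → R c x = x := fun c x hx => by rw [hR]; simp [hx]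
  let f' : E → F := fun x => ∑ j, a j • f (R (b j) x)
  have hcomp : ∀ j, ContDiffOn ℝ k (fun x => f (R (b j) x)) H' := fun j =>
    hf.comp (R (b j)).contDiff.contDiffOn (hmaps j)
  have hf' : ContDiffOn ℝ k f' H' := ContDiffOn.sum fun j _ => (hcomp j).const_smul (a j)
  refine ⟨fun x => if 0 ≤ ℓ x then f x else f' x, ?_, fun x hx => if_pos hx⟩
  refine contDiff_ite_halfSpace ℓ (hf.ftaylorSeriesWithin hH) (hf'.ftaylorSeriesWithin hH') ?_
  intro i hi x hx
  have hi' : (i : WithTop ℕ∞) ≤ k := by exact_mod_cast hi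
  have hxH : x ∈ H := hx.ge
  have hxH' : x ∈ H' := hx.le
  change iteratedFDerivWithin ℝ i f H x = iteratedFDerivWithin ℝ i f' H' x
  have h1 : iteratedFDerivWithin ℝ i f' H' x =
      ∑ j, a j • iteratedFDerivWithin ℝ i (fun x => f (R (b j) x)) H' x := by
    rw [iteratedFDerivWithin_fun_sum_apply hH' hxH'
      (fun j _ => ((hcomp j x hxH').of_le hi').const_smul (a j))]
    refine Finset.sum_congr rfl fun j _ => ?_
    exact iteratedFDerivWithin_const_smul_apply ((hcomp j x hxH').of_le hi') hH' hxH'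
  have h2 : ∀ j, iteratedFDerivWithin ℝ i (fun x => f (R (b j) x)) H' x =
      (iteratedFDerivWithin ℝ i f H x).compContinuousLinearMap fun _ => R (b j) := by
    intro j
    have hT := (((hf.of_le hi').ftaylorSeriesWithin hH).compContinuousLinearMap (R (b j))).mono
      (hmaps j)
    have := hT.eq_iteratedFDerivWithin_of_uniqueDiffOn le_rfl hH' hxH'
    refine this.symm.trans ?_
    simp [ftaylorSeriesWithin, hfix _ x hx]
  rw [h1]
  ext w
  set q := iteratedFDerivWithin ℝ i f H x
  -- Expanding by multilinearity, the right-hand side is `∑ j, a j * P (b j)` for a polynomial `P`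
  -- of degree at most `i` with `P 0 = q w`.
  have h3 : ∀ j, q (fun l => R (b j) (w l)) =
      ∑ s : Finset (Fin i), b j ^ s.card • q (s.piecewise (fun l => L (w l)) w) := by
    intro j
    have : (fun l => R (b j) (w l)) = (fun l => b j • L (w l)) + w := by
      ext l; simp [R, add_comm]
    rw [this, ContinuousMultilinearMap.map_add_univ]
    refine Finset.sum_congr rfl fun s _ => ?_
    have hs : s.piecewise (fun l => b j • L (w l)) w =
        s.piecewise (fun l => b j • s.piecewise (fun l => L (w l)) w l)
          (s.piecewise (fun l => L (w l)) w) := by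
      ext l
      by_cases hl : l ∈ s <;> simp [hl]
    rw [hs]
    have := q.toMultilinearMap.map_piecewise_smul (fun _ => b j)
      (s.piecewise (fun l => L (w l)) w) s
    simpa using this
  simp only [sum_apply, smul_apply, h2,
    ContinuousMultilinearMap.compContinuousLinearMap_apply]
  simp only [h3, Finset.smul_sum, smul_smul]
  rw [Finset.sum_comm]
  simp only [← Finset.sum_smul]
  rw [Finset.sum_eq_single ∅]
  · rw [Finset.card_empty, hab 0 (Nat.zero_le k)]; simp
  · intro s _ hs
    rw [hab s.card ((Finset.card_le_univ s).trans (by simpa using hi)),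
      if_neg (by simpa using hs), zero_smul]
  · simp

/-- The germ of a function of class `C^k` within a set is the germ of a function of class `C^k` on
the whole of that set. -/
theorem exists_contDiffOn_eventuallyEq [FiniteDimensional ℝ E] {k : ℕ} {f : E → F} {s : Set E}
    {x₀ : E} (hf : ContDiffWithinAt ℝ k f s x₀) (hx₀ : x₀ ∈ s) :
    ∃ g : E → F, ContDiffOn ℝ k g s ∧ g =ᶠ[𝓝[s] x₀] f := by
  obtain ⟨u, hu, hfu⟩ := hf.contDiffOn le_rfl (by simp)
  rw [insert_eq_of_mem hx₀] at hu
  obtain ⟨δ, hδ, hball⟩ := Metric.mem_nhdsWithin_iff.mp hu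
  let χ : ContDiffBump x₀ := ⟨δ / 4, δ / 2, by linarith, by linarith⟩
  refine ⟨fun x => χ x • f x, fun x hx => ?_, ?_⟩
  · by_cases hxb : x ∈ Metric.ball x₀ δ
    · have h1 : ContDiffWithinAt ℝ k f s x := by
        refine ((hfu.2 x (hball ⟨hxb, hx⟩)).mono hball).mono_of_mem_nhdsWithin ?_
        rw [inter_comm]
        exact inter_mem_nhdsWithin _ (Metric.isOpen_ball.mem_nhds hxb)
      exact χ.contDiff.contDiffAt.contDiffWithinAt.smul h1
    · have hz : (fun x => χ x • f x) =ᶠ[𝓝 x] fun _ => 0 := by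
        have hd : δ / 2 < dist x x₀ := by
          have : δ ≤ dist x x₀ := by simpa using hxb
          linarith
        filter_upwards [(isOpen_lt continuous_const
          (continuous_id.dist continuous_const)).mem_nhds hd] with y (hy : δ / 2 < dist y x₀)
        rw [χ.zero_of_le_dist (le_of_lt hy), zero_smul]
      exact (contDiffAt_const.congr_of_eventuallyEq hz).contDiffWithinAt
  · filter_upwards [mem_nhdsWithin_of_mem_nhds χ.eventuallyEq_one] with x h1
    simp [h1]

/-- The germ of a function of class `C^k` is the germ of a global function of class `C^k`. -/
theorem exists_contDiff_eventuallyEq [FiniteDimensional ℝ E] {k : ℕ} {f : E → F} {x₀ : E}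
    (hf : ContDiffAt ℝ k f x₀) : ∃ g : E → F, ContDiff ℝ k g ∧ g =ᶠ[𝓝 x₀] f := by
  simpa [contDiffOn_univ] using
    exists_contDiffOn_eventuallyEq (contDiffWithinAt_univ.2 hf) (mem_univ x₀)

/-- Local form of the extension from a half space: the germ of a `C^k` function on a half space is
the germ of a globally defined `C^k` function. -/
theorem exists_contDiff_eventuallyEq_halfSpace [FiniteDimensional ℝ E] {k : ℕ} (ℓ : E →L[ℝ] ℝ)
    {e : E} (he : ℓ e = 1) {f : E → F} {x₀ : E}
    (hf : ContDiffWithinAt ℝ k f {x | 0 ≤ ℓ x} x₀) (hx₀ : 0 ≤ ℓ x₀) :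
    ∃ g : E → F, ContDiff ℝ k g ∧ g =ᶠ[𝓝[{x | 0 ≤ ℓ x}] x₀] f := by
  obtain ⟨f', hf', hff'⟩ := exists_contDiffOn_eventuallyEq hf hx₀
  obtain ⟨g, hg, hgf⟩ := exists_contDiff_eqOn_halfSpace ℓ he hf'
  exact ⟨g, hg, (hgf.eventuallyEq_of_mem self_mem_nhdsWithin).trans hff'⟩

end Extension


/-! ### Superposition operators and parametric integrals -/

section Superposition

universe u

open Filter Topology

variable {K : Type*} [TopologicalSpace K] [CompactSpace K]

/-- The bilinear map `(Λ, η) ↦ (t ↦ B (Λ t) (η t))` on continuous curves induced by a continuous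
bilinear map `B`. -/
noncomputable def pointwiseBilinear (K : Type*) [TopologicalSpace K] [CompactSpace K]
    {E F G : Type*} [NormedAddCommGroup E] [NormedSpace ℝ E] [NormedAddCommGroup F]
    [NormedSpace ℝ F] [NormedAddCommGroup G] [NormedSpace ℝ G] (B : G →L[ℝ] E →L[ℝ] F) :
    C(K, G) →L[ℝ] C(K, E) →L[ℝ] C(K, F) :=
  LinearMap.mkContinuous₂
    (LinearMap.mk₂ ℝ (fun (Λ : C(K, G)) (η : C(K, E)) =>
        (⟨fun t => B (Λ t) (η t), by fun_prop⟩ : C(K, F)))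
      (fun _ _ _ => by ext; simp) (fun _ _ _ => by ext; simp) (fun _ _ _ => by ext; simp)
      (fun _ _ _ => by ext; simp)) ‖B‖ (fun Λ η => by
    rw [ContinuousMap.norm_le _ (by positivity)]
    intro t
    exact (B.le_opNorm₂ _ _).trans (by
      gcongr
      · exact Λ.norm_coe_le_norm t
      · exact η.norm_coe_le_norm t))

set_option synthInstance.maxHeartbeats 200000 in
/-- The superposition operator `γ ↦ V ∘ γ` on continuous curves is differentiable if `V` is
continuously differentiable. -/
theorem hasFDerivAt_superposition {E F : Type*} [NormedAddCommGroup E] [NormedSpace ℝ E]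
    [NormedAddCommGroup F] [NormedSpace ℝ F] {V : E → F} (hV : Continuous V) {V' : E → E →L[ℝ] F}
    (hV' : Continuous V') (h : ∀ x, HasFDerivAt V (V' x) x) (γ : C(K, E)) :
    HasFDerivAt (fun γ : C(K, E) => (⟨V, hV⟩ : C(E, F)).comp γ)
      (pointwiseBilinear K (.id ℝ (E →L[ℝ] F)) ((⟨V', hV'⟩ : C(E, E →L[ℝ] F)).comp γ)) γ := by
  rw [hasFDerivAt_iff_isLittleO, Asymptotics.isLittleO_iff]
  intro c hc
  have hcont := (ContinuousMap.continuous_postcomp (X := K) (⟨V', hV'⟩ : C(E, E →L[ℝ] F))).tendsto γ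
  obtain ⟨δ, hδ, hball⟩ := Metric.eventually_nhds_iff.mp
    (Metric.tendstoUniformly_iff.mp (ContinuousMap.tendsto_iff_tendstoUniformly.mp hcont) c hc)
  filter_upwards [Metric.ball_mem_nhds γ hδ] with η hη
  rw [ContinuousMap.norm_le _ (by positivity)]
  intro t
  have hη' : ‖η - γ‖ < δ := by rwa [← dist_eq_norm]
  -- On the ball around `γ t` the derivative is `c`-close to `V' (γ t)`: shift `γ` by a constant.
  have hbd : ∀ x ∈ Metric.ball (γ t) δ, ‖V' x - V' (γ t)‖ ≤ c := by
    intro x hx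
    have hs : dist (γ + ContinuousMap.const K (x - γ t)) γ < δ := by
      rw [dist_eq_norm, add_sub_cancel_left, ContinuousMap.norm_lt_iff _ hδ]
      intro s
      simpa [dist_eq_norm] using hx
    have := hball hs t
    rw [dist_comm] at this
    simpa [dist_eq_norm] using this.le
  have hmem : η t ∈ Metric.ball (γ t) δ := by
    rw [Metric.mem_ball, dist_eq_norm]
    exact lt_of_le_of_lt ((η - γ).norm_coe_le_norm t) hη'
  have := (convex_ball (γ t) δ).norm_image_sub_le_of_norm_hasFDerivWithin_le'
    (fun x _ => (h x).hasFDerivWithinAt) hbd (Metric.mem_ball_self hδ) hmem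
  refine this.trans ?_
  exact mul_le_mul_of_nonneg_left ((η - γ).norm_coe_le_norm t) hc.le

set_option synthInstance.maxHeartbeats 200000 in
/-- The superposition operator `γ ↦ V ∘ γ` on continuous curves is as smooth as `V`. -/
theorem contDiff_superposition {n : ℕ} {E : Type u} {F : Type u} [NormedAddCommGroup E]
    [NormedSpace ℝ E] [NormedAddCommGroup F] [NormedSpace ℝ F] {V : E → F} (hV : ContDiff ℝ n V) :
    ContDiff ℝ n (fun γ : C(K, E) => (⟨V, hV.continuous⟩ : C(E, F)).comp γ) := by
  induction n generalizing F with
  | zero => exact contDiff_zero.2 (ContinuousMap.continuous_postcomp _)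
  | succ n ih =>
    have hV1 : ContDiff ℝ ((n : WithTop ℕ∞) + 1) V := by exact_mod_cast hV
    have hV' : ContDiff ℝ n (fderiv ℝ V) := (contDiff_succ_iff_fderiv.1 hV1).2.2
    have hd : ∀ x, HasFDerivAt V (fderiv ℝ V x) x := fun x =>
      ((contDiff_succ_iff_fderiv.1 hV1).1 x).hasFDerivAt
    have hD := fun γ : C(K, E) => hasFDerivAt_superposition hV.continuous hV'.continuous hd γ
    push_cast
    rw [contDiff_succ_iff_hasFDerivAt]
    exact ⟨_, (pointwiseBilinear K (.id ℝ (E →L[ℝ] F))).contDiff.comp (ih hV'), hD⟩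

/-- Integration of curves over `[0, 1]` against a continuous weight. -/
noncomputable def weightedIntegral (w : C(unitInterval, ℝ)) (F : Type*) [NormedAddCommGroup F]
    [NormedSpace ℝ F] : C(unitInterval, F) →L[ℝ] F :=
  LinearMap.mkContinuous
    { toFun := fun η => ∫ r in (0 : ℝ)..1, IccExtend zero_le_one (fun r => w r • η r) r
      map_add' := fun η ζ => by
        rw [← intervalIntegral.integral_add]
        · simp [IccExtend]
        all_goals exact (Continuous.Icc_extend' (by fun_prop)).intervalIntegrable _ _
      map_smul' := fun c η => by
        rw [RingHom.id_apply, ← intervalIntegral.integral_smul]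
        simp only [IccExtend, Function.comp_def, ContinuousMap.smul_apply, smul_comm c] } ‖w‖
    (fun η => by
      refine (intervalIntegral.norm_integral_le_of_norm_le_const (C := ‖w‖ * ‖η‖) ?_).trans
        (by simp)
      intro r _
      simp only [IccExtend, Function.comp_apply, norm_smul]
      exact mul_le_mul (w.norm_coe_le_norm _) (η.norm_coe_le_norm _) (norm_nonneg _)
        (norm_nonneg _))

theorem weightedIntegral_apply (w : C(unitInterval, ℝ)) {F : Type*} [NormedAddCommGroup F]
    [NormedSpace ℝ F] (η : C(unitInterval, F)) :
    weightedIntegral w F η = ∫ r in (0 : ℝ)..1, IccExtend zero_le_one (fun r => w r • η r) r := rfl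

/-- A parametric integral `∫₀¹ w(r) g(r σ, p) dr` is as smooth as `g`: it is the composite of a
linear map into curves, a superposition operator and a continuous linear functional. -/
theorem contDiff_integral_segment {n : ℕ} {Q F : Type} [NormedAddCommGroup Q] [NormedSpace ℝ Q]
    [NormedAddCommGroup F] [NormedSpace ℝ F] {g : ℝ × Q → F} (hg : ContDiff ℝ n g) {w : ℝ → ℝ}
    (hw : Continuous w) :
    ContDiff ℝ n (fun x : ℝ × Q => ∫ r in (0 : ℝ)..1, w r • g (r * x.1, x.2)) := by
  let c : ℝ × Q →L[ℝ] C(unitInterval, ℝ × Q) :=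
    LinearMap.mkContinuous
      { toFun := fun x => ⟨fun r => ((r : ℝ) * x.1, x.2), by fun_prop⟩
        map_add' := fun x y => by ext <;> simp [mul_add]
        map_smul' := fun a x => by ext <;> simp [mul_left_comm] } 1
      (fun x => by
        rw [one_mul, ContinuousMap.norm_le _ (norm_nonneg x)]
        intro r
        simp only [LinearMap.coe_mk, AddHom.coe_mk, ContinuousMap.coe_mk, Prod.norm_mk, norm_mul]
        refine max_le ?_ (norm_snd_le x)
        have : ‖(r : ℝ)‖ ≤ 1 := by
          rw [Real.norm_eq_abs, abs_of_nonneg r.2.1]; exact r.2.2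
        exact (mul_le_of_le_one_left (norm_nonneg _) this).trans (norm_fst_le x))
  have h := ((weightedIntegral ⟨fun r => w r, by fun_prop⟩ F).contDiff (n := (n : WithTop ℕ∞))).comp
    ((contDiff_superposition (K := unitInterval) hg).comp c.contDiff)
  convert h using 1
  funext x
  simp only [Function.comp_apply]
  rw [weightedIntegral_apply]
  refine intervalIntegral.integral_congr fun r hr => ?_
  rw [uIcc_of_le zero_le_one] at hr
  simp [IccExtend_of_mem _ _ hr, c]

end Superposition


/-! ### Ordinary differential equations and smooth dependence on initial values -/

section ODE

open Filter Topology

open scoped NNReal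

variable {P : Type*} [NormedAddCommGroup P] [NormedSpace ℝ P]

/-- Two solutions on a compact interval of an ODE which is Lipschitz on a set containing both
agree if they agree at one time. -/
theorem eqOn_Icc_of_lipschitzOnWith {v : ℝ → P → P} {s : Set P} {K : ℝ≥0} {a b t₀ : ℝ}
    (hv : ∀ t ∈ Icc a b, LipschitzOnWith K (v t) s) (ht₀ : t₀ ∈ Icc a b) {f g : ℝ → P}
    (hf : ∀ t ∈ Icc a b, HasDerivWithinAt f (v t (f t)) (Icc a b) t)
    (hg : ∀ t ∈ Icc a b, HasDerivWithinAt g (v t (g t)) (Icc a b) t)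
    (hfs : ∀ t ∈ Icc a b, f t ∈ s) (hgs : ∀ t ∈ Icc a b, g t ∈ s) (h : f t₀ = g t₀) :
    EqOn f g (Icc a b) := by
  have hfc : ContinuousOn f (Icc a b) := fun t ht => (hf t ht).continuousWithinAt
  have hgc : ContinuousOn g (Icc a b) := fun t ht => (hg t ht).continuousWithinAt
  have hL : Icc a t₀ ⊆ Icc a b := Icc_subset_Icc_right ht₀.2
  have hR : Icc t₀ b ⊆ Icc a b := Icc_subset_Icc_left ht₀.1
  have hIic : ∀ t ∈ Ioc a t₀, Icc a b ∈ 𝓝[Iic t] t := fun t ht =>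
    mem_of_superset (Icc_mem_nhdsLE ht.1) (Icc_subset_Icc_right (ht.2.trans ht₀.2))
  have hIci : ∀ t ∈ Ico t₀ b, Icc a b ∈ 𝓝[Ici t] t := fun t ht =>
    mem_of_superset (Icc_mem_nhdsGE ht.2) (Icc_subset_Icc_left (ht₀.1.trans ht.1))
  rw [← Icc_union_Icc_eq_Icc ht₀.1 ht₀.2]
  refine EqOn.union ?_ ?_
  · exact ODE_solution_unique_of_mem_Icc_left (s := fun _ => s)
      (fun t ht => hv t (hL (Ioc_subset_Icc_self ht))) (hfc.mono hL)
      (fun t ht => (hf t (hL (Ioc_subset_Icc_self ht))).mono_of_mem_nhdsWithin (hIic t ht))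
      (fun t ht => hfs t (hL (Ioc_subset_Icc_self ht))) (hgc.mono hL)
      (fun t ht => (hg t (hL (Ioc_subset_Icc_self ht))).mono_of_mem_nhdsWithin (hIic t ht))
      (fun t ht => hgs t (hL (Ioc_subset_Icc_self ht))) h
  · exact ODE_solution_unique_of_mem_Icc_right (s := fun _ => s)
      (fun t ht => hv t (hR (Ico_subset_Icc_self ht))) (hfc.mono hR)
      (fun t ht => (hf t (hR (Ico_subset_Icc_self ht))).mono_of_mem_nhdsWithin (hIci t ht))
      (fun t ht => hfs t (hR (Ico_subset_Icc_self ht))) (hgc.mono hR)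
      (fun t ht => (hg t (hR (Ico_subset_Icc_self ht))).mono_of_mem_nhdsWithin (hIci t ht))
      (fun t ht => hgs t (hR (Ico_subset_Icc_self ht))) h

/-- Integral curves on a compact interval of a vector field of class `C^1` on a finite-dimensional
space agree if they agree at one time. -/
theorem eqOn_Icc_of_contDiff [FiniteDimensional ℝ P] {V : P → P} (hV : ContDiff ℝ 1 V)
    {a b t₀ : ℝ} (ht₀ : t₀ ∈ Icc a b) {f g : ℝ → P}
    (hf : ∀ t ∈ Icc a b, HasDerivWithinAt f (V (f t)) (Icc a b) t)
    (hg : ∀ t ∈ Icc a b, HasDerivWithinAt g (V (g t)) (Icc a b) t) (h : f t₀ = g t₀) :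
    EqOn f g (Icc a b) := by
  have hfc : ContinuousOn f (Icc a b) := fun t ht => (hf t ht).continuousWithinAt
  have hgc : ContinuousOn g (Icc a b) := fun t ht => (hg t ht).continuousWithinAt
  obtain ⟨R, hR⟩ := ((isCompact_Icc.image_of_continuousOn hfc).union
    (isCompact_Icc.image_of_continuousOn hgc)).isBounded.subset_closedBall 0
  obtain ⟨K, hK⟩ := hV.contDiffOn.exists_lipschitzOnWith (s := Metric.closedBall (0 : P) R)
    one_ne_zero (convex_closedBall 0 R) (isCompact_closedBall 0 R)
  exact eqOn_Icc_of_lipschitzOnWith (v := fun _ => V) (fun _ _ => hK) ht₀ hf hg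
    (fun t ht => hR (Or.inl (mem_image_of_mem f ht)))
    (fun t ht => hR (Or.inr (mem_image_of_mem g ht))) h

/-- Gluing of solutions of an ODE on adjacent intervals. -/
theorem hasDerivWithinAt_Icc_glue {a b c : ℝ} (hab : a ≤ b) (hbc : b ≤ c) {f g : ℝ → P}
    {v : ℝ → P → P} (hf : ∀ t ∈ Icc a b, HasDerivWithinAt f (v t (f t)) (Icc a b) t)
    (hg : ∀ t ∈ Icc b c, HasDerivWithinAt g (v t (g t)) (Icc b c) t) (h : f b = g b) :
    ∀ t ∈ Icc a c, HasDerivWithinAt (fun t => if t ≤ b then f t else g t)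
      (v t (if t ≤ b then f t else g t)) (Icc a c) t := by
  intro t _
  have e1 : EqOn (fun t => if t ≤ b then f t else g t) f (Icc a b) := fun s hs => if_pos hs.2
  have e2 : EqOn (fun t => if t ≤ b then f t else g t) g (Icc b c) := fun s hs => by
    rcases hs.1.eq_or_lt with rfl | h'
    · simp [h]
    · simp [not_le.2 h']
  rw [← Icc_union_Icc_eq_Icc hab hbc]
  refine HasDerivWithinAt.union ?_ ?_
  · by_cases ht : t ∈ Icc a b
    · have := (hf t ht).congr e1 (e1 ht)
      rwa [← show (if t ≤ b then f t else g t) = f t from e1 ht] at this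
    · exact HasFDerivWithinAt.of_notMem_closure (by rwa [isClosed_Icc.closure_eq])
  · by_cases ht : t ∈ Icc b c
    · have := (hg t ht).congr e2 (e2 ht)
      rwa [← show (if t ≤ b then f t else g t) = g t from e2 ht] at this
    · exact HasFDerivWithinAt.of_notMem_closure (by rwa [isClosed_Icc.closure_eq])

/-- A globally Lipschitz ODE has a solution on the whole of a compact interval, with prescribed
value at the right end point. -/
theorem exists_solution_of_lipschitzWith [CompleteSpace P] {v : ℝ → P → P} {K : ℝ≥0} {a b : ℝ}
    (hab : a ≤ b) (hv : ∀ t ∈ Icc a b, LipschitzWith K (v t))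
    (hc : ∀ z, ContinuousOn (fun t => v t z) (Icc a b)) (z₁ : P) :
    ∃ z : ℝ → P, z b = z₁ ∧ ∀ t ∈ Icc a b, HasDerivWithinAt z (v t (z t)) (Icc a b) t := by
  obtain ⟨B, hB⟩ := isCompact_Icc.exists_bound_of_continuousOn (hc 0)
  have hB0 : 0 ≤ B := (norm_nonneg _).trans (hB a ⟨le_rfl, hab⟩)
  set δ : ℝ := 1 / (2 * (K + 1)) with hδ
  have hδ0 : 0 < δ := by positivity
  have hδK : (K + 1) * δ = 1 / 2 := by rw [hδ]; field_simp
  -- One step of length at most `δ`, from any terminal value.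
  have step : ∀ s t, a ≤ s → s ≤ t → t ≤ b → t - s ≤ δ → ∀ w : P, ∃ z : ℝ → P, z t = w ∧
      ∀ r ∈ Icc s t, HasDerivWithinAt z (v r (z r)) (Icc s t) r := by
    intro s t hs hst ht hts w
    have hsub : Icc s t ⊆ Icc a b := Icc_subset_Icc hs ht
    let R : ℝ≥0 := ⟨‖w‖ + B, by positivity⟩
    let L : ℝ≥0 := ⟨K * (‖w‖ + (‖w‖ + B)) + B, by positivity⟩
    have hpl : IsPicardLindelof v (⟨t, ⟨hst, le_rfl⟩⟩ : Icc s t) w R 0 L K := by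
      refine ⟨fun r hr => (hv r (hsub hr)).lipschitzOnWith, fun x _ => (hc x).mono hsub,
        fun r hr x hx => ?_, ?_⟩
      · have h1 : ‖v r x - v r 0‖ ≤ K * ‖x - 0‖ := (hv r (hsub hr)).norm_sub_le x 0
        have h2 : ‖x‖ ≤ ‖w‖ + (‖w‖ + B) := by
          have h3 : ‖x - w‖ ≤ ‖w‖ + B := by rw [← dist_eq_norm]; exact hx
          have : x = w + (x - w) := by abel
          calc ‖x‖ = ‖w + (x - w)‖ := by rw [← this]
            _ ≤ ‖w‖ + ‖x - w‖ := norm_add_le _ _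
            _ ≤ _ := by gcongr
        calc ‖v r x‖ = ‖(v r x - v r 0) + v r 0‖ := by rw [sub_add_cancel]
          _ ≤ ‖v r x - v r 0‖ + ‖v r 0‖ := norm_add_le _ _
          _ ≤ K * ‖x - 0‖ + B := add_le_add h1 (hB r (hsub hr))
          _ ≤ K * (‖w‖ + (‖w‖ + B)) + B := by rw [sub_zero]; gcongr
      · have : max (t - t) (t - s) = t - s := max_eq_right (by linarith)
        simp only [NNReal.coe_zero, sub_zero, this]
        change (K * (‖w‖ + (‖w‖ + B)) + B) * (t - s) ≤ ‖w‖ + B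
        have hw := norm_nonneg w
        have hK := K.coe_nonneg
        calc (K * (‖w‖ + (‖w‖ + B)) + B) * (t - s)
            ≤ ((K + 1) * (2 * (‖w‖ + B))) * δ := by
              refine mul_le_mul ?_ hts (by linarith) (by positivity)
              nlinarith
          _ = ((K + 1) * δ) * (2 * (‖w‖ + B)) := by ring
          _ = ‖w‖ + B := by rw [hδK]; ring
    exact hpl.exists_eq_forall_mem_Icc_hasDerivWithinAt₀
  -- Solutions on `[s, b]`, by induction on the number of steps.
  have main : ∀ n : ℕ, ∀ s, a ≤ s → s ≤ b → b - s ≤ n * δ → ∃ z : ℝ → P, z b = z₁ ∧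
      ∀ r ∈ Icc s b, HasDerivWithinAt z (v r (z r)) (Icc s b) r := by
    intro n
    induction n with
    | zero =>
      intro s hs hsb hn
      exact step s b hs hsb le_rfl (hn.trans (by simpa using hδ0.le)) z₁
    | succ n ih =>
      intro s hs hsb hn
      push_cast at hn
      rcases le_total (s + δ) b with h | h
      · obtain ⟨z, hz, hz'⟩ := ih (s + δ) (by linarith) h (by linarith)
        obtain ⟨y, hy, hy'⟩ := step s (s + δ) hs (by linarith) h (by linarith) (z (s + δ))
        refine ⟨fun t => if t ≤ s + δ then y t else z t, ?_,
          hasDerivWithinAt_Icc_glue (by linarith) h hy' hz' hy⟩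
        rcases h.eq_or_lt with h' | h'
        · simp [← h', hy, ← hz]
        · simp [not_le.2 h', hz]
      · exact step s b hs hsb le_rfl (by linarith) z₁
  obtain ⟨n, hn⟩ := exists_nat_ge ((b - a) / δ)
  exact main n a le_rfl hab (by rwa [div_le_iff₀ hδ0] at hn)

end ODE

section Flow

open Filter Topology

/-- The primitive `t ↦ ∫₀ᵗ η` of a continuous curve on `[0, 1]`. -/
noncomputable def primitiveCLM (P : Type*) [NormedAddCommGroup P] [NormedSpace ℝ P] :
    C(unitInterval, P) →L[ℝ] C(unitInterval, P) :=
  LinearMap.mkContinuous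
    { toFun := fun η => ⟨fun t => ∫ s in (0 : ℝ)..t, IccExtend zero_le_one η s,
        (intervalIntegral.continuous_primitive
          (fun _ _ => (η.continuous.Icc_extend').intervalIntegrable _ _) 0).comp
          continuous_subtype_val⟩
      map_add' := fun η ζ => by
        ext t
        simp only [ContinuousMap.coe_mk, ContinuousMap.add_apply]
        rw [← intervalIntegral.integral_add]
        · simp [IccExtend]
        all_goals exact (ContinuousMap.continuous _).Icc_extend'.intervalIntegrable _ _
      map_smul' := fun c η => by
        ext t
        simp only [ContinuousMap.coe_mk, ContinuousMap.smul_apply, RingHom.id_apply]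
        rw [← intervalIntegral.integral_smul]
        simp [IccExtend] } 1
    (fun η => by
      rw [one_mul, ContinuousMap.norm_le _ (norm_nonneg η)]
      intro t
      refine (intervalIntegral.norm_integral_le_of_norm_le_const (C := ‖η‖)
        fun s _ => η.norm_coe_le_norm _).trans ?_
      rw [sub_zero, abs_of_nonneg t.2.1]
      exact mul_le_of_le_one_right (norm_nonneg η) t.2.2)

/-- The constant curves, as a continuous linear map. -/
noncomputable def constCLM (P : Type*) [NormedAddCommGroup P] [NormedSpace ℝ P] :
    P →L[ℝ] C(unitInterval, P) :=
  LinearMap.mkContinuous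
    { toFun := fun x => ContinuousMap.const _ x
      map_add' := fun _ _ => by ext; simp
      map_smul' := fun _ _ => by ext; simp } 1
    (fun x => by
      rw [one_mul, ContinuousMap.norm_le _ (norm_nonneg x)]
      intro t
      simp)

/-- **Smooth dependence on initial values.** The local flow of a vector field of class `C^n`,
`n ≥ 1`, is of class `C^n` jointly in time and initial value. The rescaled trajectories
`γ(s) = Φ(x, τ s)`, `s ∈ [0, 1]`, solve `γ = x + τ ∫ V(γ)` in the space of continuous curves. For
`τ = 0` the linearization of this equation in `γ` is the identity, so that the implicit function
theorem applies. -/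
theorem exists_contDiffAt_flow {P : Type*} [NormedAddCommGroup P] [NormedSpace ℝ P]
    [CompleteSpace P] {n : ℕ} (hn : n ≠ 0) {V : P → P} (hV : ContDiff ℝ n V) (x₀ : P) :
    ∃ Φ : P × ℝ → P, ContDiffAt ℝ n Φ (x₀, 0) ∧ ∃ r > 0, ∀ x ∈ Metric.ball x₀ r, Φ (x, 0) = x ∧
      ∀ t ∈ Ioo (-r) r, HasDerivAt (fun t => Φ (x, t)) (V (Φ (x, t))) t := by
  have hn' : (n : WithTop ℕ∞) ≠ 0 := by exact_mod_cast hn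
  have hV1 : ContDiffAt ℝ 1 V x₀ :=
    (hV.of_le (by exact_mod_cast Nat.one_le_iff_ne_zero.2 hn)).contDiffAt
  obtain ⟨ε, hε, a, r, L, K, hr, hpl⟩ := IsPicardLindelof.of_contDiffAt_one hV1
  obtain ⟨α, hα, hcont⟩ := (hpl 0).exists_forall_mem_closedBall_eq_hasDerivWithinAt_continuousOn
  simp only [zero_sub, zero_add] at hα hcont
  have hr' : (0 : ℝ) < r := by exact_mod_cast hr
  have hderiv : ∀ x ∈ Metric.closedBall x₀ r, ∀ t ∈ Ioo (-ε) ε,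
      HasDerivAt (fun t => α (x, t)) (V (α (x, t))) t := fun x hx t ht =>
    ((hα x hx).2 t (Ioo_subset_Icc_self ht)).hasDerivAt (Icc_mem_nhds ht.1 ht.2)
  refine ⟨α, ?_, min r ε, lt_min hr' hε, fun x hx => ?_⟩
  swap
  · have hx' : x ∈ Metric.closedBall x₀ r :=
      Metric.ball_subset_closedBall (Metric.ball_subset_ball (min_le_left _ _) hx)
    exact ⟨(hα x hx').1, fun t ht => hderiv x hx' t
      ⟨(neg_le_neg (min_le_right _ _)).trans_lt ht.1, ht.2.trans_le (min_le_right _ _)⟩⟩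
  -- The smoothness of the flow `α` given by the Picard-Lindelöf theorem is checked on the equation
  -- `G = 0` satisfied by its rescaled trajectories.
  let N : C(unitInterval, P) → C(unitInterval, P) :=
    fun γ => (⟨V, hV.continuous⟩ : C(P, P)).comp γ
  have hN : ContDiff ℝ n N := contDiff_superposition hV
  let G : (P × ℝ) × C(unitInterval, P) → C(unitInterval, P) :=
    fun z => z.2 - constCLM P z.1.1 - z.1.2 • primitiveCLM P (N z.2)
  have hG : ContDiff ℝ n G := by
    refine (contDiff_snd.sub ((constCLM P).contDiff.comp (contDiff_fst.comp contDiff_fst))).sub ?_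
    exact (contDiff_snd.comp contDiff_fst).smul
      ((primitiveCLM P).contDiff.comp (hN.comp contDiff_snd))
  let u : (P × ℝ) × C(unitInterval, P) := ((x₀, 0), constCLM P x₀)
  have hGu : G u = 0 := by simp [G, u]
  have hpart : fderiv ℝ G u ∘L .inr ℝ (P × ℝ) C(unitInterval, P) = .id ℝ _ := by
    have h1 : HasFDerivAt (fun γ => G ((x₀, 0), γ))
        (fderiv ℝ G u ∘L .inr ℝ (P × ℝ) C(unitInterval, P)) (constCLM P x₀) :=
      ((hG.differentiable hn') u).hasFDerivAt.comp _ (hasFDerivAt_prodMk_right (x₀, (0 : ℝ)) _)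
    have h2 : HasFDerivAt (fun γ => G ((x₀, 0), γ)) (.id ℝ _) (constCLM P x₀) := by
      have : (fun γ => G ((x₀, 0), γ)) = fun γ => γ - constCLM P x₀ := by
        funext γ; simp [G]
      rw [this]
      exact (hasFDerivAt_id _).sub_const _
    exact h1.unique h2
  have hinv : (fderiv ℝ G u ∘L .inr ℝ (P × ℝ) C(unitInterval, P)).IsInvertible := by
    rw [hpart]
    exact ⟨ContinuousLinearEquiv.refl ℝ _, rfl⟩
  set ψ := hG.contDiffAt.implicitFunction hn' hinv
  have hψ : ContDiffAt ℝ n ψ (x₀, 0) := hG.contDiffAt.contDiffAt_implicitFunction hn' hinv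
  obtain ⟨δ, hδ, hiff⟩ := Metric.eventually_nhds_iff.mp
    (hG.contDiffAt.eventually_apply_eq_iff_implicitFunction hn' hinv)
  let ev : C(unitInterval, P) →L[ℝ] P := ContinuousMap.evalCLM ℝ 1
  refine (ev.contDiff.contDiffAt.comp (x₀, (0 : ℝ)) hψ).congr_of_eventuallyEq ?_
  have hx₀ : x₀ ∈ Metric.closedBall x₀ (r : ℝ) := Metric.mem_closedBall_self hr'.le
  have hmem : Metric.closedBall x₀ (r : ℝ) ×ˢ Icc (-ε) ε ∈ 𝓝 (x₀, (0 : ℝ)) :=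
    prod_mem_nhds (Metric.closedBall_mem_nhds _ hr') (Icc_mem_nhds (by linarith) hε)
  obtain ⟨ρ, hρ, hclose⟩ := Metric.continuousAt_iff.mp (hcont.continuousAt hmem) (δ / 2)
    (half_pos hδ)
  rw [(hα x₀ hx₀).1] at hclose
  filter_upwards [Metric.ball_mem_nhds (x₀, (0 : ℝ)) (lt_min (lt_min hr' hε) (lt_min hρ hδ))]
    with ⟨x, τ⟩ hxτ
  have hd : dist (x, τ) (x₀, (0 : ℝ)) < min (min (r : ℝ) ε) (min ρ δ) := hxτ
  have hdx : dist x x₀ < min (min (r : ℝ) ε) (min ρ δ) := (le_max_left _ _).trans_lt hd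
  have hdτ : |τ| < min (min (r : ℝ) ε) (min ρ δ) := by
    have := (le_max_right (dist x x₀) (dist τ 0)).trans_lt hd
    rwa [Real.dist_0_eq_abs] at this
  simp only [lt_min_iff] at hd hdx hdτ
  have hx : x ∈ Metric.closedBall x₀ (r : ℝ) := hdx.1.1.le
  have hτs : ∀ s ∈ Icc (0 : ℝ) 1, |τ * s| ≤ |τ| := fun s hs => by
    rw [abs_mul, abs_of_nonneg hs.1]
    exact mul_le_of_le_one_right (abs_nonneg _) hs.2
  have hτε : ∀ s ∈ Icc (0 : ℝ) 1, τ * s ∈ Ioo (-ε) ε := fun s hs =>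
    abs_lt.1 ((hτs s hs).trans_lt hdτ.1.2)
  have hcurve : ∀ s ∈ Icc (0 : ℝ) 1,
      HasDerivAt (fun s => α (x, τ * s)) (τ • V (α (x, τ * s))) s := fun s hs => by
    have h1 : HasDerivAt (fun s : ℝ => τ * s) τ s := by
      simpa using (hasDerivAt_id s).const_mul τ
    exact (hderiv x hx _ (hτε s hs)).scomp s h1
  have hcurvec : ContinuousOn (fun s => α (x, τ * s)) (Icc (0 : ℝ) 1) := fun s hs =>
    (hcurve s hs).continuousAt.continuousWithinAt
  let γ : C(unitInterval, P) := ⟨fun s => α (x, τ * s), hcurvec.domRestrict⟩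
  have hγG : G ((x, τ), γ) = 0 := by
    ext t
    have hI : ∀ s ∈ uIcc (0 : ℝ) t, s ∈ Icc (0 : ℝ) 1 := fun s hs => by
      rw [uIcc_of_le t.2.1] at hs
      exact ⟨hs.1, hs.2.trans t.2.2⟩
    have h1 : ∫ s in (0 : ℝ)..t, τ • V (α (x, τ * s)) = α (x, τ * t) - α (x, τ * 0) := by
      refine intervalIntegral.integral_eq_sub_of_hasDerivAt (fun s hs => hcurve s (hI s hs)) ?_
      refine ContinuousOn.intervalIntegrable ?_
      exact ((hV.continuous.comp_continuousOn hcurvec).const_smul τ).mono hI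
    have h2 : ∫ s in (0 : ℝ)..t, IccExtend zero_le_one (N γ) s =
        ∫ s in (0 : ℝ)..t, V (α (x, τ * s)) :=
      intervalIntegral.integral_congr fun s hs => by
        rw [IccExtend_of_mem _ _ (hI s hs)]; rfl
    have h3 : G ((x, τ), γ) t = α (x, τ * t) - x - τ • ∫ s in (0 : ℝ)..t, V (α (x, τ * s)) := by
      rw [← h2]; rfl
    rw [h3, ← intervalIntegral.integral_smul, h1, mul_zero, (hα x hx).1]
    simp
  -- The trajectory is close to the constant curve, so that it is the solution singled out by the
  -- implicit function theorem.
  have hγd : dist (((x, τ), γ) : (P × ℝ) × C(unitInterval, P)) u < δ := by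
    refine max_lt (hxτ.trans_le ((min_le_right _ _).trans (min_le_right _ _))) ?_
    refine lt_of_le_of_lt ((ContinuousMap.dist_le (half_pos hδ).le).2 fun s => ?_) (half_lt_self hδ)
    refine (hclose ?_).le
    refine max_lt hdx.2.1 ?_
    change dist (τ * s) 0 < ρ
    rw [Real.dist_0_eq_abs]
    exact (hτs s s.2).trans_lt hdτ.2.1
  have hfin := (hiff hγd).1 (hγG.trans hGu.symm)
  change α (x, τ) = ev (ψ (x, τ))
  change ψ (x, τ) = γ at hfin
  rw [hfin]
  change α (x, τ) = α (x, τ * ((1 : unitInterval) : ℝ))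
  simp

end Flow


/-! ### Even functions and folds -/

section Fold

open Filter Topology

variable {Q : Type} [NormedAddCommGroup Q] [NormedSpace ℝ Q]

/-- The partial derivative in the first, real variable. -/
noncomputable def timeDeriv {F : Type*} [NormedAddCommGroup F] [NormedSpace ℝ F] (h : ℝ × Q → F)
    (x : ℝ × Q) : F :=
  fderiv ℝ h x (1, 0)

theorem hasDerivAt_timeDeriv {F : Type*} [NormedAddCommGroup F] [NormedSpace ℝ F]
    {h : ℝ × Q → F} {t : ℝ} {p : Q} (hh : DifferentiableAt ℝ h (t, p)) :
    HasDerivAt (fun t => h (t, p)) (timeDeriv h (t, p)) t := by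
  have h1 : HasDerivAt (fun t : ℝ => (t, p)) ((1 : ℝ), (0 : Q)) t :=
    (hasDerivAt_id t).prodMk (hasDerivAt_const t p)
  exact hh.hasFDerivAt.comp_hasDerivAt t h1

theorem contDiff_timeDeriv {F : Type*} [NormedAddCommGroup F] [NormedSpace ℝ F] {n : ℕ}
    {h : ℝ × Q → F} (hh : ContDiff ℝ (n + 1 : ℕ) h) : ContDiff ℝ n (timeDeriv h) :=
  (hh.fderiv_right (by norm_cast)).clm_apply contDiff_const

/-- Hadamard's lemma with the remainder of first order. -/
theorem eq_add_smul_integral {F : Type} [NormedAddCommGroup F] [NormedSpace ℝ F] [CompleteSpace F]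
    {φ φ' : ℝ → F} (h : ∀ s, HasDerivAt φ (φ' s) s) (hc : Continuous φ') (s : ℝ) :
    φ s = φ 0 + s • ∫ r in (0 : ℝ)..1, (1 : ℝ) • φ' (r * s) := by
  have h1 : ∀ r, HasDerivAt (fun r : ℝ => φ (r * s)) (s • φ' (r * s)) r := fun r => by
    have : HasDerivAt (fun r : ℝ => r * s) s r := by simpa using (hasDerivAt_id r).mul_const s
    exact (h (r * s)).scomp r this
  have h2 := intervalIntegral.integral_eq_sub_of_hasDerivAt (a := 0) (b := 1) (fun r _ => h1 r)
    (Continuous.intervalIntegrable (by fun_prop) _ _)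
  rw [intervalIntegral.integral_smul, one_mul, zero_mul] at h2
  simp only [one_smul]
  rw [h2]
  abel

/-- Taylor's formula with integral remainder of second order. -/
theorem eq_add_add_integral {φ φ' φ'' : ℝ → ℝ} (h : ∀ s, HasDerivAt φ (φ' s) s)
    (h' : ∀ s, HasDerivAt φ' (φ'' s) s) (hc : Continuous φ'') (s : ℝ) :
    φ s = φ 0 + s * φ' 0 + s ^ 2 * ∫ r in (0 : ℝ)..1, (1 - r) • φ'' (r * s) := by
  have h0 : ∀ r, HasDerivAt (fun r : ℝ => r * s) s r := fun r => by
    simpa using (hasDerivAt_id r).mul_const s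
  have h1 : ∀ r, HasDerivAt (fun r : ℝ => (1 - r) * (s * φ' (r * s)) + φ (r * s))
      (s ^ 2 * ((1 - r) * φ'' (r * s))) r := fun r => by
    have e1 : HasDerivAt (fun r : ℝ => φ (r * s)) (φ' (r * s) * s) r := (h (r * s)).comp r (h0 r)
    have e2 : HasDerivAt (fun r : ℝ => φ' (r * s)) (φ'' (r * s) * s) r := (h' (r * s)).comp r (h0 r)
    have e3 : HasDerivAt (fun r : ℝ => 1 - r) (-1) r := by simpa using (hasDerivAt_id r).const_sub 1
    convert! (e3.mul (e2.const_mul s)).add e1 using 1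
    ring
  have h2 := intervalIntegral.integral_eq_sub_of_hasDerivAt (a := 0) (b := 1) (fun r _ => h1 r)
    (Continuous.intervalIntegrable (by fun_prop) _ _)
  rw [intervalIntegral.integral_const_mul] at h2
  simp only [smul_eq_mul]
  rw [h2]
  simp only [one_mul, zero_mul]
  ring

/-- **Whitney's theorem on even functions**, with parameters: if `G(σ, p)` is even in `σ` and of
class `C^(2k)`, then `G(√s, p)` is of class `C^k` up to `s = 0`. -/
theorem contDiffOn_comp_sqrt_of_even {k : ℕ} {F : Type} [NormedAddCommGroup F] [NormedSpace ℝ F]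
    [CompleteSpace F] {G : ℝ × Q → F} (hG : ContDiff ℝ (2 * k : ℕ) G)
    (heven : ∀ s p, G (-s, p) = G (s, p)) :
    ContDiffOn ℝ k (fun x : ℝ × Q => G (Real.sqrt x.1, x.2)) (Ici 0 ×ˢ univ) := by
  induction k generalizing F with
  | zero =>
    have := hG.continuous
    exact contDiffOn_zero.2 (by fun_prop)
  | succ k ih =>
    have hG2 : ContDiff ℝ (2 * k + 1 + 1 : ℕ) G := hG
    have hG' : ContDiff ℝ (2 * k + 1 : ℕ) (timeDeriv G) := contDiff_timeDeriv hG2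
    have hG'' : ContDiff ℝ (2 * k : ℕ) (timeDeriv (timeDeriv G)) := contDiff_timeDeriv hG'
    have hd : Differentiable ℝ G := hG2.differentiable (by norm_cast)
    have hd' : Differentiable ℝ (timeDeriv G) := hG'.differentiable (by norm_cast)
    have hDG : ContDiff ℝ (2 * k : ℕ) (fderiv ℝ G) := hG2.fderiv_right (by norm_cast; omega)
    -- The reflection `σ ↦ -σ` and its effect on derivatives.
    let ι : ℝ × Q →L[ℝ] ℝ × Q :=
      (-ContinuousLinearMap.fst ℝ ℝ Q).prod (ContinuousLinearMap.snd ℝ ℝ Q)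
    have hι : ∀ s p, ι (s, p) = (-s, p) := fun s p => rfl
    have hfd : ∀ s p, fderiv ℝ G (s, p) = fderiv ℝ G (-s, p) ∘L ι := fun s p => by
      have h1 : G = G ∘ ι := by
        funext ⟨s, p⟩; exact (heven s p).symm
      conv_lhs => rw [h1]
      have h2 : HasFDerivAt (G ∘ ι) (fderiv ℝ G (ι (s, p)) ∘L ι) (s, p) :=
        (hd _).hasFDerivAt.comp _ ι.hasFDerivAt
      exact h2.fderiv
    have hodd : ∀ s p, timeDeriv G (-s, p) = -timeDeriv G (s, p) := fun s p => by
      have h1 : ι ((1 : ℝ), (0 : Q)) = -((1 : ℝ), (0 : Q)) := by simp [ι]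
      simp only [timeDeriv]
      rw [hfd s p, ContinuousLinearMap.comp_apply, h1, map_neg, neg_neg]
    have hzero : ∀ p, timeDeriv G (0, p) = 0 := fun p => by
      have := hodd 0 p
      rw [neg_zero] at this
      have h2 : (2 : ℝ) • timeDeriv G (0, p) = 0 := by
        rw [two_smul]; nth_rw 1 [this]; exact neg_add_cancel _
      exact (smul_eq_zero.1 h2).resolve_left two_ne_zero
    have heven'' : ∀ s p, timeDeriv (timeDeriv G) (-s, p) = timeDeriv (timeDeriv G) (s, p) := by
      intro s p
      have h1 : HasDerivAt (fun s => timeDeriv G (-s, p)) (-timeDeriv (timeDeriv G) (-s, p)) s := by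
        have := (hasDerivAt_timeDeriv (hd' (-s, p))).scomp s (hasDerivAt_neg s)
        simpa [Function.comp_def] using this
      have h2 : HasDerivAt (fun s => timeDeriv G (-s, p)) (-timeDeriv (timeDeriv G) (s, p)) s := by
        simp only [hodd]
        exact (hasDerivAt_timeDeriv (hd' (s, p))).neg
      exact neg_injective (h1.unique h2)
    -- `∂_σ G (σ, p) = 2 σ K (σ, p)` with `K` even and smooth.
    let K : ℝ × Q → F := fun x =>
      (1 / 2 : ℝ) • ∫ r in (0 : ℝ)..1, (1 : ℝ) • timeDeriv (timeDeriv G) (r * x.1, x.2)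
    have hK : ContDiff ℝ (2 * k : ℕ) K :=
      (contDiff_integral_segment hG'' continuous_const).const_smul _
    have hKeven : ∀ s p, K (-s, p) = K (s, p) := fun s p => by
      simp only [K, mul_neg, heven'']
    have hGK : ∀ s p, timeDeriv G (s, p) = (2 * s) • K (s, p) := fun s p => by
      have := eq_add_smul_integral (fun s => hasDerivAt_timeDeriv (hd' (s, p)))
        (hG''.continuous.comp (by fun_prop)) s
      rw [this, hzero, zero_add]
      simp only [K, smul_smul]
      congr 1
      ring
    -- The derivative of `G(√s, p)` is `A(√s, p)`, again with `A` even and smooth.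
    let A : ℝ × Q → (ℝ × Q →L[ℝ] F) := fun x =>
      (ContinuousLinearMap.fst ℝ ℝ Q).smulRight (K x) +
        fderiv ℝ G x ∘L ((ContinuousLinearMap.inr ℝ ℝ Q) ∘L ContinuousLinearMap.snd ℝ ℝ Q)
    have hA : ContDiff ℝ (2 * k : ℕ) A := by
      refine ContDiff.add ?_ (hDG.clm_comp contDiff_const)
      exact contDiff_const.smulRight hK
    have hAeven : ∀ s p, A (-s, p) = A (s, p) := fun s p => by
      have h1 : fderiv ℝ G (s, p) ∘L ((ContinuousLinearMap.inr ℝ ℝ Q) ∘L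
          ContinuousLinearMap.snd ℝ ℝ Q) = fderiv ℝ G (-s, p) ∘L ((ContinuousLinearMap.inr ℝ ℝ Q) ∘L
          ContinuousLinearMap.snd ℝ ℝ Q) := by
        rw [hfd s p]
        ext x <;> simp [ι]
      simp only [A, hKeven, h1]
    have hcont : Continuous fun x : ℝ × Q => G (Real.sqrt x.1, x.2) := by
      have := hG.continuous
      fun_prop
    have hint : ∀ x ∈ (Ioi (0 : ℝ) ×ˢ (univ : Set Q)),
        HasFDerivAt (fun x : ℝ × Q => G (Real.sqrt x.1, x.2)) (A (Real.sqrt x.1, x.2)) x := by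
      rintro ⟨s, p⟩ ⟨hs, -⟩
      have hs0 : 0 < s := hs
      have hsq : 0 < Real.sqrt s := Real.sqrt_pos.2 hs0
      have h1 : HasFDerivAt (fun x : ℝ × Q => (Real.sqrt x.1, x.2))
          (((1 / (2 * Real.sqrt s)) • ContinuousLinearMap.fst ℝ ℝ Q).prod
            (ContinuousLinearMap.snd ℝ ℝ Q)) (s, p) := by
        refine HasFDerivAt.prodMk ?_ hasFDerivAt_snd
        exact (Real.hasDerivAt_sqrt hs0.ne').comp_hasFDerivAt (s, p) hasFDerivAt_fst
      have h2 := (hd (Real.sqrt s, p)).hasFDerivAt.comp (s, p) h1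
      refine h2.congr_fderiv ?_
      ext x
      · have h3 : timeDeriv G (Real.sqrt s, p) = (2 * Real.sqrt s) • K (Real.sqrt s, p) := hGK _ _
        have h4 : fderiv ℝ G (Real.sqrt s, p) ((2 * Real.sqrt s)⁻¹, 0) =
            (2 * Real.sqrt s)⁻¹ • timeDeriv G (Real.sqrt s, p) := by
          rw [timeDeriv, ← map_smul]; simp
        have h5 : (2 * Real.sqrt s)⁻¹ * (2 * Real.sqrt s) = 1 := inv_mul_cancel₀ (by positivity)
        have h6 : fderiv ℝ G (Real.sqrt s, p) ((2 * Real.sqrt s)⁻¹, 0) = K (Real.sqrt s, p) := by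
          rw [h4, h3, smul_smul, h5, one_smul]
        have h7 : fderiv ℝ G (Real.sqrt s, p) ((0 : ℝ), (0 : Q)) = 0 := map_zero _
        simpa [A, h7] using h6
      · simp [A]
    have hclos : closure (Ioi (0 : ℝ) ×ˢ (univ : Set Q)) = Ici 0 ×ˢ univ := by
      rw [closure_prod_eq, closure_Ioi, closure_univ]
    have hopen : IsOpen (Ioi (0 : ℝ) ×ˢ (univ : Set Q)) := isOpen_Ioi.prod isOpen_univ
    have hAc : Continuous fun x : ℝ × Q => A (Real.sqrt x.1, x.2) := by
      have := hA.continuous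
      fun_prop
    have huniq : UniqueDiffOn ℝ (Ici (0 : ℝ) ×ˢ (univ : Set Q)) :=
      (uniqueDiffOn_Ici 0).prod uniqueDiffOn_univ
    push_cast
    rw [contDiffOn_succ_iff_hasFDerivWithinAt_of_uniqueDiffOn huniq]
    refine ⟨by simp, fun x => A (Real.sqrt x.1, x.2), ih hA hAeven, fun x _ => ?_⟩
    rw [← hclos]
    refine hasFDerivWithinAt_closure_of_tendsto_fderiv
      (fun y hy => (hint y hy).differentiableAt.differentiableWithinAt)
      ((convex_Ioi 0).prod convex_univ) hopen (fun y _ => hcont.continuousWithinAt) ?_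
    refine (hAc.tendsto x |>.mono_left nhdsWithin_le_nhds).congr' ?_
    filter_upwards [self_mem_nhdsWithin] with y hy
    exact (hint y hy).fderiv.symm

/-- The implicit function theorem for one scalar equation in one real unknown. -/
theorem exists_implicit_real [CompleteSpace Q] {n : ℕ} (hn : n ≠ 0) {g : Q × ℝ → ℝ} {p₀ : Q}
    {t₀ : ℝ} (hg : ContDiffAt ℝ n g (p₀, t₀)) (h0 : g (p₀, t₀) = 0) {c : ℝ}
    (hd : HasDerivAt (fun t => g (p₀, t)) c t₀) (hc : c ≠ 0) :
    ∃ T : Q → ℝ, ContDiffAt ℝ n T p₀ ∧ T p₀ = t₀ ∧ ∀ᶠ p in 𝓝 p₀, g (p, T p) = 0 := by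
  have hn' : (n : WithTop ℕ∞) ≠ 0 := by exact_mod_cast hn
  have h1 : HasFDerivAt (fun t => g (p₀, t)) (fderiv ℝ g (p₀, t₀) ∘L .inr ℝ Q ℝ) t₀ :=
    (hg.differentiableAt hn').hasFDerivAt.comp t₀ (hasFDerivAt_prodMk_right p₀ t₀)
  have h2 : fderiv ℝ g (p₀, t₀) ∘L .inr ℝ Q ℝ =
      ((ContinuousLinearEquiv.unitsEquivAut ℝ (Units.mk0 c hc) : ℝ ≃L[ℝ] ℝ) : ℝ →L[ℝ] ℝ) := by
    rw [h1.unique hd.hasFDerivAt]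
    ext
    simp
  have hinv : (fderiv ℝ g (p₀, t₀) ∘L .inr ℝ Q ℝ).IsInvertible := ⟨_, h2.symm⟩
  refine ⟨hg.implicitFunction hn' hinv, hg.contDiffAt_implicitFunction hn' hinv,
    hg.implicitFunction_apply_self hn' hinv, ?_⟩
  simpa only [h0] using hg.eventually_apply_implicitFunction hn' hinv

/-- **Smoothness at a fold.** Suppose that `h(·, p₀)` has a nondegenerate maximum at `0` with value
`0`, and that `u(p) = G₀(t, p)` for *every* small root `t` of `h(·, p)`. Then `u` is smooth at `p₀`
within any set on which `h(0, p) ≥ 0`.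

By the Morse lemma `h(t, p) = m(p) - σ²` for a smooth coordinate `σ` on the `t`-axis. The two roots
correspond to `σ = ±√m(p)`, so that `u(p)` is the value at `σ = √m(p)` of an even smooth function of
`σ`, to which Whitney's theorem applies. -/
theorem contDiffWithinAt_of_fold [FiniteDimensional ℝ Q] {k : ℕ} (hk : k ≠ 0) {F : Type}
    [NormedAddCommGroup F] [NormedSpace ℝ F] [CompleteSpace F] {h : ℝ × Q → ℝ} {G₀ : ℝ × Q → F}
    {p₀ : Q} (hh : ContDiffAt ℝ (2 * k + 1 + 1 : ℕ) h (0, p₀))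
    (hG₀ : ContDiffAt ℝ (2 * k : ℕ) G₀ (0, p₀)) (h0 : h (0, p₀) = 0)
    (h1 : deriv (fun t => h (t, p₀)) 0 = 0) (h2 : deriv (deriv fun t => h (t, p₀)) 0 < 0)
    {S : Set Q} {u : Q → F} (hp₀ : p₀ ∈ S) (hS : ∀ᶠ p in 𝓝[S] p₀, 0 ≤ h (0, p))
    (hu : ∀ᶠ x : ℝ × Q in 𝓝 (0, p₀), x.2 ∈ S → h x = 0 → u x.2 = G₀ x) :
    ContDiffWithinAt ℝ k u S p₀ := by
  have : CompleteSpace Q := FiniteDimensional.complete ℝ Q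
  -- It is no loss of generality to assume that `h` is globally smooth.
  wlog hglob : ContDiff ℝ (2 * k + 1 + 1 : ℕ) h generalizing h
  · obtain ⟨h', hh', hhh'⟩ := exists_contDiff_eventuallyEq hh
    have ht : (fun t => h' (t, p₀)) =ᶠ[𝓝 0] fun t => h (t, p₀) :=
      (Continuous.prodMk_left p₀).continuousAt.eventually hhh'
    refine this hh'.contDiffAt (hhh'.self_of_nhds.trans h0) (by rwa [ht.deriv_eq])
      (by rwa [ht.deriv.deriv_eq]) ?_ ?_ hh'
    · have : ∀ᶠ p in 𝓝[S] p₀, h' (0, p) = h (0, p) :=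
        ((Continuous.prodMk_right (0 : ℝ)).continuousAt.eventually hhh').filter_mono
          nhdsWithin_le_nhds
      filter_upwards [hS, this] with p hp hp'
      rwa [hp']
    · filter_upwards [hu, hhh'] with x hx hx' hxS hx0
      exact hx hxS (hx' ▸ hx0)
  have hd : Differentiable ℝ h := hglob.differentiable (by norm_cast)
  have hh' : ContDiff ℝ (2 * k + 1 : ℕ) (timeDeriv h) := contDiff_timeDeriv hglob
  have hd' : Differentiable ℝ (timeDeriv h) := hh'.differentiable (by norm_cast)
  have hh'' : ContDiff ℝ (2 * k : ℕ) (timeDeriv (timeDeriv h)) := contDiff_timeDeriv hh'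
  have hder : ∀ t p, HasDerivAt (fun t => h (t, p)) (timeDeriv h (t, p)) t := fun t p =>
    hasDerivAt_timeDeriv (hd _)
  have hder' : ∀ t p, HasDerivAt (fun t => timeDeriv h (t, p)) (timeDeriv (timeDeriv h) (t, p)) t :=
    fun t p => hasDerivAt_timeDeriv (hd' _)
  have h1' : timeDeriv h (0, p₀) = 0 := by rw [← (hder 0 p₀).deriv, h1]
  have h2' : timeDeriv (timeDeriv h) (0, p₀) < 0 := by
    have : deriv (fun t => h (t, p₀)) = fun t => timeDeriv h (t, p₀) :=
      funext fun t => (hder t p₀).deriv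
    rw [this, (hder' 0 p₀).deriv] at h2
    exact h2
  -- The time `tm p` at which `h(·, p)` is maximal.
  obtain ⟨tm₀, htm₀, htm₀0, htm₀e⟩ := exists_implicit_real (n := 2 * k + 1) (by omega)
    (g := fun x : Q × ℝ => timeDeriv h (x.2, x.1)) (p₀ := p₀) (t₀ := 0)
    (hh'.comp (contDiff_snd.prodMk contDiff_fst)).contDiffAt h1' (hder' 0 p₀) h2'.ne
  obtain ⟨tm, htm, htme⟩ := exists_contDiff_eventuallyEq htm₀
  have htm0 : tm p₀ = 0 := htme.self_of_nhds.trans htm₀0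
  have htmd : ∀ᶠ p in 𝓝 p₀, timeDeriv h (tm p, p) = 0 := by
    filter_upwards [htm₀e, htme] with p hp hp'
    rwa [hp']
  -- `h(tm p + s, p) = m p - s ^ 2 * q(s, p)`.
  let m : Q → ℝ := fun p => h (tm p, p)
  have hm : ContDiff ℝ (2 * k + 1 : ℕ) m :=
    (hglob.of_le (by norm_cast; omega)).comp (htm.prodMk contDiff_id)
  let g : ℝ × Q → ℝ := fun x => -timeDeriv (timeDeriv h) (tm x.2 + x.1, x.2)
  have hg : ContDiff ℝ (2 * k : ℕ) g :=
    (hh''.comp ((((htm.of_le (by norm_cast; omega)).comp contDiff_snd).add contDiff_fst).prodMk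
      contDiff_snd)).neg
  let q : ℝ × Q → ℝ := fun x => ∫ r in (0 : ℝ)..1, (1 - r) • g (r * x.1, x.2)
  have hq : ContDiff ℝ (2 * k : ℕ) q := contDiff_integral_segment hg (by fun_prop)
  have hq0 : 0 < q (0, p₀) := by
    have : q (0, p₀) = (∫ r in (0 : ℝ)..1, (1 - r)) * g (0, p₀) := by
      simp only [q, mul_zero, smul_eq_mul, intervalIntegral.integral_mul_const]
    rw [this]
    have h3 : (∫ r in (0 : ℝ)..1, (1 - r)) = 1 / 2 := by
      rw [intervalIntegral.integral_sub (by simp) (by simp)]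
      simp
      norm_num
    have h4 : 0 < g (0, p₀) := by simpa [g, htm0] using h2'
    rw [h3]; positivity
  have hTaylor : ∀ s p, h (tm p + s, p) = m p + s * timeDeriv h (tm p, p) - s ^ 2 * q (s, p) := by
    intro s p
    have e1 : ∀ s, HasDerivAt (fun s => h (tm p + s, p)) (timeDeriv h (tm p + s, p)) s :=
        fun s => by
      simpa using (hder (tm p + s) p).comp_const_add (tm p) s
    have e2 : ∀ s, HasDerivAt (fun s => timeDeriv h (tm p + s, p))
        (timeDeriv (timeDeriv h) (tm p + s, p)) s := fun s => by
      simpa using (hder' (tm p + s) p).comp_const_add (tm p) s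
    have := eq_add_add_integral e1 e2 (hh''.continuous.comp (by fun_prop)) s
    rw [this]
    simp only [q, g, add_zero, smul_neg, intervalIntegral.integral_neg, m]
    ring
  -- The coordinate `σ = s √q(s, p)` and its local inverse `s = S(σ, p)`.
  have hqpos : ∀ᶠ x in 𝓝 ((0 : ℝ), p₀), 0 < q x := (continuousAt_const (y := 0)).eventually_lt
    hq.continuous.continuousAt hq0
  obtain ⟨T, hT, hT0, hTe⟩ := exists_implicit_real (Q := ℝ × Q) (n := 2 * k) (by omega)
    (g := fun x : (ℝ × Q) × ℝ => x.2 * Real.sqrt (q (x.2, x.1.2)) - x.1.1)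
    (p₀ := ((0 : ℝ), p₀)) (t₀ := 0) (by
      have e1 : ContDiffAt ℝ (2 * k : ℕ) (fun x : (ℝ × Q) × ℝ => q (x.2, x.1.2))
          (((0 : ℝ), p₀), 0) :=
        (hq.comp (contDiff_snd.prodMk (contDiff_snd.comp contDiff_fst))).contDiffAt
      exact (contDiffAt_snd.mul (e1.sqrt hq0.ne')).sub contDiffAt_fst.fst)
    (by simp) (c := Real.sqrt (q (0, p₀))) (by
      have e1 : DifferentiableAt ℝ (fun t : ℝ => Real.sqrt (q (t, p₀))) 0 := by
        have : DifferentiableAt ℝ (fun t : ℝ => q (t, p₀)) 0 :=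
          ((hq.comp (contDiff_id.prodMk contDiff_const)).differentiable
            (by norm_cast; omega)) 0
        exact this.sqrt hq0.ne'
      have := ((hasDerivAt_id (0 : ℝ)).mul e1.hasDerivAt).sub_const 0
      simpa using this) (Real.sqrt_pos.2 hq0).ne'
  -- For every small `σ` with `σ ^ 2 = m p`, the time `tm p + S(σ, p)` is a root.
  let τ : ℝ × Q → ℝ := fun x => tm x.2 + T x
  have hτ : ContDiffAt ℝ (2 * k : ℕ) τ (0, p₀) :=
    ((htm.of_le (by norm_cast; omega)).contDiffAt.comp _ contDiffAt_snd).add hT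
  have hτ0 : τ (0, p₀) = 0 := by simp [τ, htm0, hT0]
  have hroot : ∀ᶠ x in 𝓝 ((0 : ℝ), p₀), x.1 ^ 2 = m x.2 → h (τ x, x.2) = 0 := by
    have e1 : ∀ᶠ x in 𝓝 ((0 : ℝ), p₀), timeDeriv h (tm x.2, x.2) = 0 :=
      (continuous_snd (X := ℝ) (Y := Q)).continuousAt.eventually
        (p := fun p => timeDeriv h (tm p, p) = 0) htmd
    have e2 : ∀ᶠ x in 𝓝 ((0 : ℝ), p₀), 0 < q (T x, x.2) := by
      have : ContinuousAt (fun x : ℝ × Q => q (T x, x.2)) (0, p₀) :=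
        hq.continuous.continuousAt.comp (hT.continuousAt.prodMk continuous_snd.continuousAt)
      exact (continuousAt_const (y := 0)).eventually_lt this (by simpa [hT0] using hq0)
    filter_upwards [e1, e2, hTe] with x hx1 hx2 hx3 hx4
    have hx5 : T x * Real.sqrt (q (T x, x.2)) = x.1 := sub_eq_zero.1 hx3
    have hx6 : T x ^ 2 * q (T x, x.2) = x.1 ^ 2 := by
      rw [← hx5, mul_pow, Real.sq_sqrt hx2.le]
    simp only [τ]
    rw [hTaylor, hx1, hx6, hx4]
    ring
  obtain ⟨G, hG, hGe⟩ := exists_contDiff_eventuallyEq (f := fun x : ℝ × Q => G₀ (τ x, x.2))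
    (x₀ := ((0 : ℝ), p₀)) (k := 2 * k) (by
      refine ContDiffAt.comp (g := G₀) _ ?_ (hτ.prodMk contDiffAt_snd)
      rwa [hτ0])
  -- At `σ = ±√m(p)` the function `G` takes the value `u(p)`, hence so does its even part `Ge`.
  let Ge : ℝ × Q → F := fun x => (1 / 2 : ℝ) • (G x + G (-x.1, x.2))
  have hGe' : ContDiff ℝ (2 * k : ℕ) Ge :=
    (hG.add (hG.comp (contDiff_fst.neg.prodMk contDiff_snd))).const_smul _
  have hW := contDiffOn_comp_sqrt_of_even hGe' (fun s p => by simp [Ge, add_comm])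
  have hmS : ∀ᶠ p in 𝓝[S] p₀, 0 ≤ m p := by
    have e1 : ∀ᶠ p in 𝓝 p₀, 0 < q (-tm p, p) := by
      have : ContinuousAt (fun p : Q => q (-tm p, p)) p₀ :=
        (hq.continuous.comp (htm.continuous.neg.prodMk continuous_id)).continuousAt
      exact (continuousAt_const (y := 0)).eventually_lt this (by simpa [htm0] using hq0)
    filter_upwards [hS, nhdsWithin_le_nhds e1, nhdsWithin_le_nhds htmd] with p hp hp1 hp2
    have := hTaylor (-tm p) p
    rw [add_neg_cancel, hp2] at this
    nlinarith [mul_nonneg (sq_nonneg (-tm p)) hp1.le]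
  have hm0 : m p₀ = 0 := by simp [m, htm0, h0]
  have hval : ∀ᶠ p in 𝓝[S] p₀, u p = Ge (Real.sqrt (m p), p) := by
    have hc1 : Tendsto (fun p => (Real.sqrt (m p), p)) (𝓝 p₀) (𝓝 ((0 : ℝ), p₀)) := by
      have : Continuous fun p => (Real.sqrt (m p), p) := by
        have := hm.continuous
        fun_prop
      simpa [hm0] using this.tendsto p₀
    have hc2 : Tendsto (fun p => (-Real.sqrt (m p), p)) (𝓝 p₀) (𝓝 ((0 : ℝ), p₀)) := by
      have : Continuous fun p => (-Real.sqrt (m p), p) := by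
        have := hm.continuous
        fun_prop
      simpa [hm0] using this.tendsto p₀
    have hP : ∀ᶠ x in 𝓝 ((0 : ℝ), p₀), x.2 ∈ S → x.1 ^ 2 = m x.2 → u x.2 = G x := by
      have hτc : Tendsto (fun x : ℝ × Q => (τ x, x.2)) (𝓝 ((0 : ℝ), p₀)) (𝓝 ((0 : ℝ), p₀)) := by
        have := hτ.continuousAt.prodMk (continuous_snd (X := ℝ) (Y := Q)).continuousAt
        simpa [ContinuousAt, hτ0] using this
      filter_upwards [hroot, hτc.eventually hu, hGe] with x hx1 hx2 hx3 hxS hxm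
      rw [hx3]
      exact hx2 hxS (hx1 hxm)
    filter_upwards [hmS, self_mem_nhdsWithin, nhdsWithin_le_nhds (hc1.eventually hP),
      nhdsWithin_le_nhds (hc2.eventually hP)] with p hp hpS hp1 hp2
    have e1 := hp1 hpS (Real.sq_sqrt hp)
    have e2 := hp2 hpS (by simpa using Real.sq_sqrt hp)
    simp only [Ge]
    rw [← e1, ← e2, ← two_smul ℝ, smul_smul]
    norm_num
  have hmaps : ∀ᶠ p in 𝓝[S] p₀, (m p, p) ∈ Ici (0 : ℝ) ×ˢ (univ : Set Q) := by
    filter_upwards [hmS] with p hp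
    exact ⟨hp, mem_univ _⟩
  have hmk : ContDiffWithinAt ℝ k (fun p => (m p, p)) S p₀ :=
    (((hm.of_le (by norm_cast; omega)).prodMk contDiff_id).contDiffAt).contDiffWithinAt
  have hfin : ContDiffWithinAt ℝ k (fun p => Ge (Real.sqrt (m p), p)) S p₀ := by
    have hW' := hW (m p₀, p₀) ⟨hm0.ge, mem_univ _⟩
    exact ContDiffWithinAt.comp_of_preimage_mem_nhdsWithin (f := fun p => (m p, p)) p₀ hW' hmk hmaps
  exact hfin.congr_of_eventuallyEq hval (hval.self_of_nhdsWithin hp₀)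

end Fold


/-! ### Tangent vectors and the metric in a chart -/

/-- The model space `ℝ^d`. -/
abbrev Euc (d : ℕ) := EuclideanSpace ℝ (Fin d)

theorem euc_sum_single {d : ℕ} (v : Euc d) : v = ∑ i, v i • EuclideanSpace.single i (1 : ℝ) := by
  ext j
  simp [Finset.sum_apply, Pi.single_apply]

theorem contDiffWithinAt_smul_right {E G : Type*} [NormedAddCommGroup E] [NormedSpace ℝ E]
    [NormedAddCommGroup G] [NormedSpace ℝ G] {c : E → ℝ} {n : WithTop ℕ∞} {s : Set E} {x : E}
    (hc : ContDiffWithinAt ℝ n c s x) (B : G) : ContDiffWithinAt ℝ n (fun y => c y • B) s x :=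
  hc.smul contDiffWithinAt_const

section Tangent

variable {d : ℕ} [NeZero d] {M : Type*} [TopologicalSpace M] [ChartedSpace (EuclideanHalfSpace d) M]
  [IsManifold (𝓡∂ d) ∞ M]

/-- The tangent vector at `z` with given components in the preferred chart at `x₀`. -/
noncomputable def tangentOf (x₀ z : M) : Euc d →ₗ[ℝ] TangentSpace (𝓡∂ d) z :=
  (tangentCoordChange (𝓡∂ d) x₀ z z).toLinearMap

theorem coordField_eq_tangentOf {x₀ z : M} (hz : z ∈ (extChartAt (𝓡∂ d) x₀).source)
    (i : Fin d) : coordField x₀ i z = tangentOf x₀ z (EuclideanSpace.single i (1 : ℝ)) := by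
  have hz' : z ∈ (trivializationAt (Euc d) (TangentSpace (𝓡∂ d)) x₀).baseSet := by
    simpa [extChartAt_source] using hz
  have h := TangentBundle.symmL_trivializationAt_eq_core (𝕜 := ℝ) (I := 𝓡∂ d) (b₀ := x₀) (b := z)
    (by simpa [extChartAt_source] using hz)
  have h1 := (trivializationAt (Euc d) (TangentSpace (𝓡∂ d)) x₀).symmL_apply (R := ℝ) hz'
    (EuclideanSpace.single i (1 : ℝ))
  exact h1.symm.trans
    (congrArg (fun L : Euc d →L[ℝ] Euc d => L (EuclideanSpace.single i (1 : ℝ))) h)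

theorem tangentOf_eq_sum {x₀ z : M} (hz : z ∈ (extChartAt (𝓡∂ d) x₀).source) (v : Euc d) :
    tangentOf x₀ z v = ∑ i, v i • coordField x₀ i z := by
  conv_lhs => rw [euc_sum_single v]
  rw [map_sum]
  refine Finset.sum_congr rfl fun i _ => ?_
  rw [map_smul, coordField_eq_tangentOf hz]

/-- The components in the preferred chart at `x₀` of a tangent vector at `z`. -/
noncomputable def componentsAt (x₀ : M) {z : M} (v : TangentSpace (𝓡∂ d) z) : Euc d :=
  tangentCoordChange (𝓡∂ d) z x₀ z v

theorem tangentOf_componentsAt {x₀ z : M} (hz : z ∈ (extChartAt (𝓡∂ d) x₀).source)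
    (v : TangentSpace (𝓡∂ d) z) : tangentOf x₀ z (componentsAt x₀ v) = v := by
  have hzz : z ∈ (extChartAt (𝓡∂ d) z).source := mem_extChartAt_source z
  have := (tangentCoordChange_comp (I := 𝓡∂ d) (w := z) (x := x₀) (y := z) (v := v)
    ⟨⟨hzz, hz⟩, hzz⟩).trans (tangentCoordChange_self hzz)
  exact this

theorem componentsAt_tangentOf {x₀ z : M} (hz : z ∈ (extChartAt (𝓡∂ d) x₀).source) (v : Euc d) :
    componentsAt x₀ (tangentOf x₀ z v) = v := by
  have hzz : z ∈ (extChartAt (𝓡∂ d) z).source := mem_extChartAt_source z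
  have := (tangentCoordChange_comp (I := 𝓡∂ d) (w := x₀) (x := z) (y := x₀) (v := v)
    ⟨⟨hz, hzz⟩, hz⟩).trans (tangentCoordChange_self hz)
  exact this

end Tangent

section Metric

open Filter Topology

variable {d : ℕ} [NeZero d] {M : Type*} [TopologicalSpace M] [ChartedSpace (EuclideanHalfSpace d) M]
  [IsManifold (𝓡∂ d) ∞ M] [RiemannianBundle (fun x : M => TangentSpace (𝓡∂ d) x)]

/-- The inner product at the point with coordinates `y`, as a bilinear form in the components of
tangent vectors in the preferred chart at `x₀`. -/
noncomputable def metricForm (x₀ : M) (y : Euc d) : Euc d →L[ℝ] Euc d →L[ℝ] ℝ :=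
  ∑ i, ∑ j, metricMatrix x₀ y i j •
    (EuclideanSpace.proj i : Euc d →L[ℝ] ℝ).smulRight (EuclideanSpace.proj j : Euc d →L[ℝ] ℝ)

theorem metricForm_apply (x₀ : M) (y v w : Euc d) :
    metricForm x₀ y v w = ∑ i, ∑ j, metricMatrix x₀ y i j * v i * w j := by
  simp [metricForm, mul_assoc]

/-- The metric form is the inner product of the tangent vectors with the given components. -/
theorem metricForm_eq_inner (x₀ : M) {z : M} (hz : z ∈ (extChartAt (𝓡∂ d) x₀).source)
    (v w : Euc d) : metricForm x₀ (extChartAt (𝓡∂ d) x₀ z) v w =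
      inner ℝ (tangentOf x₀ z v) (tangentOf x₀ z w) := by
  rw [tangentOf_eq_sum hz, tangentOf_eq_sum hz, sum_inner, metricForm_apply]
  refine Finset.sum_congr rfl fun i _ => ?_
  rw [inner_sum]
  refine Finset.sum_congr rfl fun j _ => ?_
  rw [real_inner_smul_left, real_inner_smul_right]
  simp only [metricMatrix, Matrix.of_apply]
  rw [(extChartAt (𝓡∂ d) x₀).left_inv hz]
  ring

theorem metricForm_comm (x₀ : M) (y v w : Euc d) :
    metricForm x₀ y v w = metricForm x₀ y w v := by
  rw [metricForm_apply, metricForm_apply, Finset.sum_comm]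
  refine Finset.sum_congr rfl fun i _ => Finset.sum_congr rfl fun j _ => ?_
  have : metricMatrix x₀ y j i = metricMatrix x₀ y i j := by
    simp only [metricMatrix, Matrix.of_apply]
    exact real_inner_comm _ _
  rw [this]; ring

/-- The inner product of two tangent vectors in terms of their components in a chart. -/
theorem inner_eq_metricForm (x₀ : M) {z : M} (hz : z ∈ (extChartAt (𝓡∂ d) x₀).source)
    (v w : TangentSpace (𝓡∂ d) z) : inner ℝ v w =
      metricForm x₀ (extChartAt (𝓡∂ d) x₀ z) (componentsAt x₀ v) (componentsAt x₀ w) := by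
  rw [metricForm_eq_inner x₀ hz, tangentOf_componentsAt hz, tangentOf_componentsAt hz]

theorem metricForm_pos (x₀ : M) {y : Euc d} (hy : y ∈ (extChartAt (𝓡∂ d) x₀).target) {v : Euc d}
    (hv : v ≠ 0) : 0 < metricForm x₀ y v v := by
  have hz := (extChartAt (𝓡∂ d) x₀).map_target hy
  rw [← (extChartAt (𝓡∂ d) x₀).right_inv hy, metricForm_eq_inner x₀ hz]
  refine real_inner_self_pos.2 fun h => hv ?_
  rw [← componentsAt_tangentOf hz v, h]
  exact map_zero (tangentCoordChange (𝓡∂ d) _ x₀ _)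

variable [IsContMDiffRiemannianBundle (𝓡∂ d) ∞ (EuclideanSpace ℝ (Fin d))
      (fun x : M => TangentSpace (𝓡∂ d) x)]

theorem contDiffOn_metricMatrix (x₀ : M) (i j : Fin d) :
    ContDiffOn ℝ ∞ (fun y => metricMatrix x₀ y i j) (extChartAt (𝓡∂ d) x₀).target := by
  have hf : ∀ i, ContMDiffOn (𝓡∂ d) (𝓡∂ d).tangent ∞
      (fun z => (⟨z, coordField x₀ i z⟩ : TangentBundle (𝓡∂ d) M))
      (extChartAt (𝓡∂ d) x₀).source := by
    intro i
    have h1 := (trivializationAt (Euc d) (TangentSpace (𝓡∂ d)) x₀).contMDiffOn_symm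
      (n := ∞) (IB := 𝓡∂ d)
    have h2 : ContMDiffOn (𝓡∂ d) ((𝓡∂ d).prod 𝓘(ℝ, Euc d)) ∞
        (fun z : M => (z, (EuclideanSpace.single i (1 : ℝ) : Euc d)))
        (extChartAt (𝓡∂ d) x₀).source := contMDiffOn_id.prodMk contMDiffOn_const
    refine (h1.comp h2 ?_).congr ?_
    · intro z hz
      simpa [extChartAt_source] using hz
    · intro z hz
      have hz' : z ∈ (trivializationAt (Euc d) (TangentSpace (𝓡∂ d)) x₀).baseSet := by
        simpa [extChartAt_source] using hz
      exact (trivializationAt (Euc d) (TangentSpace (𝓡∂ d)) x₀).mk_symm hz' _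
  have h3 := (hf i).inner_bundle (hf j)
  rw [← contMDiffOn_iff_contDiffOn]
  exact h3.comp (contMDiffOn_extChartAt_symm x₀) (extChartAt (𝓡∂ d) x₀).mapsTo_symm

theorem contDiffWithinAt_metricForm (x₀ : M) {y : Euc d} (hy : y ∈ (extChartAt (𝓡∂ d) x₀).target) :
    ContDiffWithinAt ℝ ∞ (metricForm x₀) (range (𝓡∂ d)) y := by
  have h : ∀ i j, ContDiffWithinAt ℝ ∞ (fun y => metricMatrix x₀ y i j) (range (𝓡∂ d)) y :=
    fun i j => (contDiffOn_metricMatrix x₀ i j y hy).mono_of_mem_nhdsWithin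
      (extChartAt_target_mem_nhdsWithin_of_mem hy)
  exact ContDiffWithinAt.sum fun i _ => ContDiffWithinAt.sum fun j _ =>
    contDiffWithinAt_smul_right (h i j) _

end Metric


/-! ### Transformation of the geodesic spray -/

section Bilinear

variable {E F : Type*} [NormedAddCommGroup E] [NormedSpace ℝ E]
  [NormedAddCommGroup F] [NormedSpace ℝ F]

/-! The instances below only shorten the search for the instances on spaces of bilinear forms. -/

set_option synthInstance.maxHeartbeats 400000 in
noncomputable instance : AddCommGroup (E →L[ℝ] F →L[ℝ] ℝ) := ContinuousLinearMap.addCommGroup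

set_option synthInstance.maxHeartbeats 400000 in
noncomputable instance : AddCommMonoid (E →L[ℝ] F →L[ℝ] ℝ) := ContinuousLinearMap.addCommMonoid

set_option synthInstance.maxHeartbeats 400000 in
noncomputable instance : Module ℝ (E →L[ℝ] F →L[ℝ] ℝ) := ContinuousLinearMap.module

set_option synthInstance.maxHeartbeats 400000 in
noncomputable instance : NormedAddCommGroup (E →L[ℝ] F →L[ℝ] ℝ) :=
  ContinuousLinearMap.toNormedAddCommGroup

set_option synthInstance.maxHeartbeats 400000 in
noncomputable instance : NormedSpace ℝ (E →L[ℝ] F →L[ℝ] ℝ) := ContinuousLinearMap.toNormedSpace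

/-- The product rule for a variable bilinear form applied to variable vectors. -/
theorem exists_hasFDerivWithinAt_bilin {B : E → F →L[ℝ] F →L[ℝ] ℝ} {D : E →L[ℝ] F →L[ℝ] F →L[ℝ] ℝ}
    {v w : E → F} {v' w' : E →L[ℝ] F} {s : Set E} {x : E} (hB : HasFDerivWithinAt B D s x)
    (hv : HasFDerivWithinAt v v' s x) (hw : HasFDerivWithinAt w w' s x) :
    ∃ L : E →L[ℝ] ℝ, HasFDerivWithinAt (fun z => B z (v z) (w z)) L s x ∧
      ∀ a, L a = D a (v x) (w x) + B x (v' a) (w x) + B x (v x) (w' a) := by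
  refine ⟨_, (hB.clm_apply hv).clm_apply hw, fun a => ?_⟩
  simp only [add_apply, ContinuousLinearMap.comp_apply,
    ContinuousLinearMap.flip_apply]
  ring

/-- How the geodesic spray changes under a change of coordinates `κ`. The Christoffel symbols
`Γ` of a metric `g` enter through their defining property
`g(Γ(v, v), w) = D_v g (v, w) - D_w g (v, v) / 2`. -/
theorem spray_transformation {s : Set E} {y : E} (hs : UniqueDiffWithinAt ℝ s y) (hy : y ∈ s)
    {κ : E → F} {t : Set F} (hst : MapsTo κ s t) {κ' : E → E →L[ℝ] F} {κ'' : E →L[ℝ] E →L[ℝ] F}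
    (hκ : HasFDerivWithinAt κ (κ' y) s y) (hκ' : HasFDerivWithinAt κ' κ'' s y)
    (hsymm : ∀ a b, κ'' a b = κ'' b a) (hsurj : Function.Surjective (κ' y))
    {g₀ : E → E →L[ℝ] E →L[ℝ] ℝ} {D₀ : E →L[ℝ] E →L[ℝ] E →L[ℝ] ℝ}
    {g₁ : F → F →L[ℝ] F →L[ℝ] ℝ} {D₁ : F →L[ℝ] F →L[ℝ] F →L[ℝ] ℝ}
    (hg₀ : HasFDerivWithinAt g₀ D₀ s y) (hg₁ : HasFDerivWithinAt g₁ D₁ t (κ y))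
    (hg : ∀ᶠ z in nhdsWithin y s, ∀ v w, g₀ z v w = g₁ (κ z) (κ' z v) (κ' z w))
    (hcomm : ∀ a b, g₁ (κ y) a b = g₁ (κ y) b a) (hpos : ∀ a, a ≠ 0 → 0 < g₁ (κ y) a a)
    {v Γ₀ : E} {Γ₁ : F} (hΓ₀ : ∀ w, g₀ y Γ₀ w = D₀ v v w - D₀ w v v / 2)
    (hΓ₁ : ∀ w, g₁ (κ y) Γ₁ w = D₁ (κ' y v) (κ' y v) w - D₁ w (κ' y v) (κ' y v) / 2) :
    κ' y Γ₀ = κ'' v v + Γ₁ := by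
  have hgκ : HasFDerivWithinAt (fun z => g₁ (κ z)) (D₁.comp (κ' y)) s y := hg₁.comp y hκ hst
  have hD : ∀ a v w, D₀ a v w = D₁ (κ' y a) (κ' y v) (κ' y w)
      + g₁ (κ y) (κ'' a v) (κ' y w) + g₁ (κ y) (κ' y v) (κ'' a w) := by
    intro a v w
    obtain ⟨L₀, hL₀, hL₀'⟩ := exists_hasFDerivWithinAt_bilin hg₀
      (hasFDerivWithinAt_const v y s) (hasFDerivWithinAt_const w y s)
    obtain ⟨L₁, hL₁, hL₁'⟩ := exists_hasFDerivWithinAt_bilin hgκ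
      (hκ'.clm_apply (hasFDerivWithinAt_const v y s))
      (hκ'.clm_apply (hasFDerivWithinAt_const w y s))
    have h := hs.eq hL₀ (hL₁.congr_of_eventuallyEq (hg.mono fun z hz => hz v w)
      (hg.self_of_nhdsWithin hy v w))
    have h2 := congrArg (fun L : E →L[ℝ] ℝ => L a) h
    simp only [hL₀', hL₁'] at h2
    simpa using h2
  have hz : ∀ w, g₁ (κ y) (κ' y Γ₀ - (κ'' v v + Γ₁)) w = 0 := by
    intro b
    obtain ⟨w, rfl⟩ := hsurj b
    have h1 := hg.self_of_nhdsWithin hy Γ₀ w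
    have h2 := hΓ₀ w
    have h3 := hΓ₁ (κ' y w)
    have h4 := hcomm (κ' y v) (κ'' w v)
    have h5 := hcomm (κ' y v) (κ'' v w)
    rw [hD, hD] at h2
    rw [hsymm w v] at *
    simp only [map_sub, map_add, sub_apply, add_apply]
    linarith
  by_contra hne
  exact (hpos _ (sub_ne_zero.2 hne)).ne' (hz _)

end Bilinear


/-! ### The Levi-Civita connection in a chart -/

theorem metricMatrix_eq_metricForm {d : ℕ} [NeZero d] {M : Type*} [TopologicalSpace M]
    [ChartedSpace (EuclideanHalfSpace d) M]
    [IsManifold (𝓡∂ d) ∞ M] [RiemannianBundle (fun x : M => TangentSpace (𝓡∂ d) x)]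
    (x₀ : M) (y : Euc d) (i j : Fin d) :
    metricMatrix x₀ y i j =
      metricForm x₀ y (EuclideanSpace.single i (1 : ℝ)) (EuclideanSpace.single j (1 : ℝ)) := by
  rw [metricForm_apply]
  simp

theorem trilin_sum {d : ℕ} (D : Euc d →L[ℝ] Euc d →L[ℝ] Euc d →L[ℝ] ℝ) (a b c : Euc d) :
    D a b c = ∑ i, ∑ j, a i * b j * D (EuclideanSpace.single i (1 : ℝ))
      (EuclideanSpace.single j (1 : ℝ)) c := by
  conv_lhs => rw [euc_sum_single a, euc_sum_single b]
  simp only [map_sum, map_smul, _root_.sum_apply, _root_.smul_apply, smul_eq_mul, Finset.mul_sum]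
  rw [Finset.sum_comm]
  exact Finset.sum_congr rfl fun i _ => Finset.sum_congr rfl fun j _ => by ring

section Christoffel

open Filter Topology Matrix

variable {d : ℕ} [NeZero d] {M : Type*} [TopologicalSpace M] [ChartedSpace (EuclideanHalfSpace d) M]
  [IsManifold (𝓡∂ d) ∞ M] [RiemannianBundle (fun x : M => TangentSpace (𝓡∂ d) x)]

/-- The derivative of the metric form in a chart, one-sided at boundary points. -/
noncomputable def metricDeriv (x₀ : M) (y : Euc d) : Euc d →L[ℝ] Euc d →L[ℝ] Euc d →L[ℝ] ℝ :=
  fderivWithin ℝ (metricForm x₀) (range (𝓡∂ d)) y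

/-- The vector with components `∑ i j, Γ^k_{ij} v^i u^j`. -/
noncomputable def christoffelMap (x₀ : M) (y v u : Euc d) : Euc d :=
  WithLp.toLp 2 fun k => ∑ i, ∑ j, christoffel x₀ y k i j * v i * u j

theorem christoffelMap_apply (x₀ : M) (y v u : Euc d) (k : Fin d) :
    christoffelMap x₀ y v u k = ∑ i, ∑ j, christoffel x₀ y k i j * v i * u j := rfl

theorem metricMatrix_isSymm (x₀ : M) (y : Euc d) : (metricMatrix x₀ y)ᵀ = metricMatrix x₀ y := by
  ext i j
  rw [transpose_apply, metricMatrix_eq_metricForm, metricMatrix_eq_metricForm, metricForm_comm]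

theorem metricForm_eq_dotProduct (x₀ : M) (y v w : Euc d) :
    metricForm x₀ y v w = v.ofLp ⬝ᵥ (metricMatrix x₀ y *ᵥ w.ofLp) := by
  rw [metricForm_apply]
  simp only [dotProduct, mulVec, Finset.mul_sum]
  exact Finset.sum_congr rfl fun i _ => Finset.sum_congr rfl fun j _ => by ring

theorem metricMatrix_posDef (x₀ : M) {y : Euc d} (hy : y ∈ (extChartAt (𝓡∂ d) x₀).target) :
    (metricMatrix x₀ y).PosDef := by
  refine PosDef.of_dotProduct_mulVec_pos ?_ fun v hv => ?_
  · rw [IsHermitian, conjTranspose_eq_transpose_of_trivial, metricMatrix_isSymm]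
  · have := metricForm_pos x₀ hy (v := WithLp.toLp 2 v) (by simpa using hv)
    rwa [metricForm_eq_dotProduct] at this

theorem isUnit_det_metricMatrix (x₀ : M) {y : Euc d} (hy : y ∈ (extChartAt (𝓡∂ d) x₀).target) :
    IsUnit (metricMatrix x₀ y).det :=
  (isUnit_iff_isUnit_det _).1 (metricMatrix_posDef x₀ hy).isUnit

variable [IsContMDiffRiemannianBundle (𝓡∂ d) ∞ (EuclideanSpace ℝ (Fin d))
      (fun x : M => TangentSpace (𝓡∂ d) x)]

theorem hasFDerivWithinAt_metricForm (x₀ : M) {y : Euc d}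
    (hy : y ∈ (extChartAt (𝓡∂ d) x₀).target) :
    HasFDerivWithinAt (metricForm x₀) (metricDeriv x₀ y) (range (𝓡∂ d)) y :=
  ((contDiffWithinAt_metricForm x₀ hy).differentiableWithinAt (by simp)).hasFDerivWithinAt

theorem partialDeriv_metricMatrix (x₀ : M) {y : Euc d}
    (hy : y ∈ (extChartAt (𝓡∂ d) x₀).target) (i j l : Fin d) :
    partialDeriv i (fun z => metricMatrix x₀ z j l) y =
      metricDeriv x₀ y (EuclideanSpace.single i (1 : ℝ)) (EuclideanSpace.single j (1 : ℝ))
        (EuclideanSpace.single l (1 : ℝ)) := by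
  obtain ⟨L, hL, hL'⟩ := exists_hasFDerivWithinAt_bilin (hasFDerivWithinAt_metricForm x₀ hy)
    (hasFDerivWithinAt_const (EuclideanSpace.single j (1 : ℝ) : Euc d) y _)
    (hasFDerivWithinAt_const (EuclideanSpace.single l (1 : ℝ) : Euc d) y _)
  have hyH : y ∈ range (𝓡∂ d) := extChartAt_target_subset_range x₀ hy
  simp only [← metricMatrix_eq_metricForm] at hL
  rw [partialDeriv, hL.fderivWithin ((𝓡∂ d).uniqueDiffOn y hyH), hL']
  simp

theorem metricDeriv_comm (x₀ : M) {y : Euc d} (hy : y ∈ (extChartAt (𝓡∂ d) x₀).target)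
    (a v w : Euc d) : metricDeriv x₀ y a v w = metricDeriv x₀ y a w v := by
  have hyH : y ∈ range (𝓡∂ d) := extChartAt_target_subset_range x₀ hy
  have h : ∀ v w : Euc d, ∃ L : Euc d →L[ℝ] ℝ, HasFDerivWithinAt (fun z => metricForm x₀ z v w) L
      (range (𝓡∂ d)) y ∧ ∀ a, L a = metricDeriv x₀ y a v w := by
    intro v w
    obtain ⟨L, hL, hL'⟩ := exists_hasFDerivWithinAt_bilin (hasFDerivWithinAt_metricForm x₀ hy)
      (hasFDerivWithinAt_const v y _) (hasFDerivWithinAt_const w y _)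
    exact ⟨L, hL, fun a => by rw [hL']; simp⟩
  obtain ⟨L, hL, hL'⟩ := h v w
  obtain ⟨L₁, hL₁, hL₁'⟩ := h w v
  simp only [metricForm_comm x₀ _ w v] at hL₁
  rw [← hL', ← hL₁', ((𝓡∂ d).uniqueDiffOn y hyH).eq hL hL₁]

/-- The defining property of the Levi-Civita connection, in a chart. -/
theorem metricForm_christoffelMap (x₀ : M) {y : Euc d} (hy : y ∈ (extChartAt (𝓡∂ d) x₀).target)
    (v u w : Euc d) : metricForm x₀ y (christoffelMap x₀ y v u) w =
      (metricDeriv x₀ y v u w + metricDeriv x₀ y u v w - metricDeriv x₀ y w v u) / 2 := by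
  set D := metricDeriv x₀ y with hD
  let b : Fin d → ℝ := fun l => (D v u (EuclideanSpace.single l (1 : ℝ))
    + D u v (EuclideanSpace.single l (1 : ℝ)) - D (EuclideanSpace.single l (1 : ℝ)) v u) / 2
  have hΓ : (christoffelMap x₀ y v u).ofLp = (metricMatrix x₀ y)⁻¹ *ᵥ b := by
    ext k
    rw [christoffelMap_apply]
    have hb : ∀ l, b l = ∑ i, ∑ j, (1 / 2) * (partialDeriv i (fun z => metricMatrix x₀ z j l) y
      + partialDeriv j (fun z => metricMatrix x₀ z i l) y
      - partialDeriv l (fun z => metricMatrix x₀ z i j) y) * v i * u j := by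
      intro l
      have h3 : D (EuclideanSpace.single l (1 : ℝ)) v u = ∑ i, ∑ j, v i * u j *
          D (EuclideanSpace.single l (1 : ℝ)) (EuclideanSpace.single i (1 : ℝ))
            (EuclideanSpace.single j (1 : ℝ)) := by
        conv_lhs => rw [euc_sum_single v, euc_sum_single u]
        simp only [map_sum, map_smul, _root_.sum_apply, _root_.smul_apply, smul_eq_mul,
          Finset.mul_sum]
        rw [Finset.sum_comm]
        exact Finset.sum_congr rfl fun i _ => Finset.sum_congr rfl fun j _ => by ring
      have h2 : D u v (EuclideanSpace.single l (1 : ℝ)) = ∑ i, ∑ j, v i * u j *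
          D (EuclideanSpace.single j (1 : ℝ)) (EuclideanSpace.single i (1 : ℝ))
            (EuclideanSpace.single l (1 : ℝ)) := by
        rw [trilin_sum, Finset.sum_comm]
        exact Finset.sum_congr rfl fun i _ => Finset.sum_congr rfl fun j _ => by ring
      simp only [b]
      rw [h3, h2, trilin_sum D v u, ← Finset.sum_add_distrib, ← Finset.sum_sub_distrib,
        Finset.sum_div]
      refine Finset.sum_congr rfl fun i _ => ?_
      rw [← Finset.sum_add_distrib, ← Finset.sum_sub_distrib, Finset.sum_div]
      refine Finset.sum_congr rfl fun j _ => ?_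
      rw [partialDeriv_metricMatrix x₀ hy, partialDeriv_metricMatrix x₀ hy,
        partialDeriv_metricMatrix x₀ hy, ← hD]
      ring
    simp only [mulVec, dotProduct, hb, christoffel, Finset.mul_sum, Finset.sum_mul]
    have : ∀ i, (∑ j, ∑ l, 1 / 2 * ((metricMatrix x₀ y)⁻¹ k l *
        (partialDeriv i (fun z => metricMatrix x₀ z j l) y
          + partialDeriv j (fun z => metricMatrix x₀ z i l) y
          - partialDeriv l (fun z => metricMatrix x₀ z i j) y)) * v i * u j) =
        ∑ l, ∑ j, 1 / 2 * ((metricMatrix x₀ y)⁻¹ k l *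
        (partialDeriv i (fun z => metricMatrix x₀ z j l) y
          + partialDeriv j (fun z => metricMatrix x₀ z i l) y
          - partialDeriv l (fun z => metricMatrix x₀ z i j) y)) * v i * u j := fun i =>
      Finset.sum_comm
    simp only [this]
    rw [Finset.sum_comm]
    exact Finset.sum_congr rfl fun l _ => Finset.sum_congr rfl fun i _ =>
      Finset.sum_congr rfl fun j _ => by ring
  have hlin : ∀ w : Euc d, w.ofLp ⬝ᵥ b = (D v u w + D u v w - D w v u) / 2 := by
    intro w
    conv_rhs => rw [euc_sum_single w]
    simp only [map_sum, map_smul, _root_.sum_apply, _root_.smul_apply, smul_eq_mul, dotProduct, b]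
    rw [← Finset.sum_add_distrib, ← Finset.sum_sub_distrib, Finset.sum_div]
    exact Finset.sum_congr rfl fun i _ => by ring
  rw [metricForm_comm, metricForm_eq_dotProduct, hΓ, mulVec_mulVec,
    mul_nonsing_inv _ (isUnit_det_metricMatrix x₀ hy), one_mulVec, hlin]

end Christoffel


/-! ### Changes of coordinates and the geodesic equation -/

section MatrixInverse

open Matrix

variable {ι E : Type*} [Fintype ι] [DecidableEq ι] [NormedAddCommGroup E] [NormedSpace ℝ E]
  {A : E → Matrix ι ι ℝ} {k : WithTop ℕ∞} {s : Set E} {x : E}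

theorem contDiffWithinAt_det (hA : ∀ i j, ContDiffWithinAt ℝ k (fun y => A y i j) s x) :
    ContDiffWithinAt ℝ k (fun y => (A y).det) s x := by
  simp only [det_apply']
  exact ContDiffWithinAt.sum fun σ _ => contDiffWithinAt_const.mul
    (contDiffWithinAt_prod fun i _ => hA _ _)

theorem contDiffWithinAt_matrix_inv (hA : ∀ i j, ContDiffWithinAt ℝ k (fun y => A y i j) s x)
    (hdet : (A x).det ≠ 0) (i j : ι) :
    ContDiffWithinAt ℝ k (fun y => (A y)⁻¹ i j) s x := by
  simp only [inv_def, Ring.inverse_eq_inv, Matrix.smul_apply, smul_eq_mul, adjugate_apply]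
  refine ((contDiffWithinAt_det hA).inv hdet).mul (contDiffWithinAt_det fun a b => ?_)
  by_cases h : a = j
  · subst h
    simpa using contDiffWithinAt_const
  · simpa [updateRow_ne h] using hA a b

end MatrixInverse

section Charts

open Filter Topology

variable {d : ℕ} [NeZero d] {M : Type*} [TopologicalSpace M] [ChartedSpace (EuclideanHalfSpace d) M]

/-- The change of coordinates from the preferred chart at `x₀` to that at `x₁`. -/
noncomputable def coordChange (x₀ x₁ : M) : Euc d → Euc d :=
  extChartAt (𝓡∂ d) x₁ ∘ (extChartAt (𝓡∂ d) x₀).symm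

theorem extChartAt_mem_range (x₀ z : M) : extChartAt (𝓡∂ d) x₀ z ∈ range (𝓡∂ d) := by
  rw [extChartAt_coe]; exact mem_range_self _

theorem coordChange_apply {x₀ x₁ z : M} (h₀ : z ∈ (extChartAt (𝓡∂ d) x₀).source) :
    coordChange x₀ x₁ (extChartAt (𝓡∂ d) x₀ z) = extChartAt (𝓡∂ d) x₁ z := by
  rw [coordChange, Function.comp_apply, (extChartAt (𝓡∂ d) x₀).left_inv h₀]

/-- Near a point of the first chart domain that lies in the second one, the points of the
half space are coordinates of points in both chart domains. -/
theorem eventually_mem_sources {x₀ x₁ z : M} (h₀ : z ∈ (extChartAt (𝓡∂ d) x₀).source)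
    (h₁ : z ∈ (extChartAt (𝓡∂ d) x₁).source) :
    ∀ᶠ y in 𝓝[range (𝓡∂ d)] (extChartAt (𝓡∂ d) x₀ z),
      ∃ z' ∈ (extChartAt (𝓡∂ d) x₀).source, z' ∈ (extChartAt (𝓡∂ d) x₁).source ∧
        extChartAt (𝓡∂ d) x₀ z' = y := by
  have hy := (extChartAt (𝓡∂ d) x₀).map_source h₀
  have hc : ContinuousWithinAt (extChartAt (𝓡∂ d) x₀).symm (range (𝓡∂ d))
      (extChartAt (𝓡∂ d) x₀ z) :=
    ((continuousOn_extChartAt_symm x₀) _ hy).mono_of_mem_nhdsWithin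
      (extChartAt_target_mem_nhdsWithin_of_mem hy)
  have h2 := hc.preimage_mem_nhdsWithin (t := (extChartAt (𝓡∂ d) x₁).source)
    (by
      rw [(extChartAt (𝓡∂ d) x₀).left_inv h₀]
      exact extChartAt_source_mem_nhds' h₁)
  filter_upwards [h2, extChartAt_target_mem_nhdsWithin_of_mem hy] with y hy1 hy2
  exact ⟨_, (extChartAt (𝓡∂ d) x₀).map_target hy2, hy1, (extChartAt (𝓡∂ d) x₀).right_inv hy2⟩

theorem mem_nhdsWithin_target {x₀ : M} {q : Euc d × Euc d}
    (hq : q.1 ∈ (extChartAt (𝓡∂ d) x₀).target) :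
    ∀ᶠ q' in 𝓝[range (𝓡∂ d) ×ˢ univ] q, q'.1 ∈ (extChartAt (𝓡∂ d) x₀).target := by
  have h : Tendsto Prod.fst (𝓝[range (𝓡∂ d) ×ˢ univ] q) (𝓝[range (𝓡∂ d)] q.1) :=
    tendsto_nhdsWithin_of_tendsto_nhds_of_eventually_within _
      (continuousAt_fst.mono_left nhdsWithin_le_nhds)
      (eventually_nhdsWithin_of_forall fun q hq => hq.1)
  exact h (extChartAt_target_mem_nhdsWithin_of_mem hq)

end Charts

section Coords

open Filter Topology

variable {d : ℕ} [NeZero d] {M : Type*} [TopologicalSpace M] [ChartedSpace (EuclideanHalfSpace d) M]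
  [IsManifold (𝓡∂ d) ∞ M]

/-- The derivative of the change of coordinates. -/
noncomputable def coordChangeDeriv (x₀ x₁ : M) : Euc d → Euc d →L[ℝ] Euc d :=
  fderivWithin ℝ (coordChange x₀ x₁) (range (𝓡∂ d))

/-- The coordinates of `TM` given by the preferred chart at `x₀`. -/
noncomputable def coords (x₀ : M) (p : TangentBundle (𝓡∂ d) M) : Euc d × Euc d :=
  (extChartAt (𝓡∂ d) x₀ p.1, componentsAt x₀ p.2)

/-- The preferred charts of `TM` are those induced by the preferred charts of `M`. -/
theorem extChartAt_tangent (q p : TangentBundle (𝓡∂ d) M) :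
    extChartAt (𝓡∂ d).tangent q p = coords q.1 p := by
  have h := congrArg (fun e : PartialEquiv (TangentBundle (𝓡∂ d) M) (Euc d × Euc d) => e p)
    (FiberBundle.extChartAt (IB := 𝓡∂ d) (F := Euc d) (E := TangentSpace (𝓡∂ d)) (B := M) q)
  have h2 := TangentBundle.trivializationAt_apply (I := 𝓡∂ d) q.1 p
  refine h.trans ?_
  simp only [PartialEquiv.coe_trans, Function.comp_apply, PartialEquiv.prod_coe,
    PartialEquiv.refl_coe, id_eq]
  have h3 : (trivializationAt (Euc d) (TangentSpace (𝓡∂ d)) q.1).toPartialEquiv p =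
    (trivializationAt (Euc d) (TangentSpace (𝓡∂ d)) q.1) p := rfl
  rw [h3, h2]
  rfl

theorem contDiffWithinAt_coordChange {x₀ x₁ z : M} (h₀ : z ∈ (extChartAt (𝓡∂ d) x₀).source)
    (h₁ : z ∈ (extChartAt (𝓡∂ d) x₁).source) :
    ContDiffWithinAt ℝ ∞ (coordChange x₀ x₁) (range (𝓡∂ d)) (extChartAt (𝓡∂ d) x₀ z) := by
  refine contDiffWithinAt_ext_coord_change x₁ x₀ ?_
  rw [PartialEquiv.trans_source, PartialEquiv.symm_source]
  exact ⟨(extChartAt (𝓡∂ d) x₀).map_source h₀, by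
    rw [mem_preimage, (extChartAt (𝓡∂ d) x₀).left_inv h₀]; exact h₁⟩

theorem componentsAt_eq_coordChangeDeriv {x₀ x₁ z : M} (h₀ : z ∈ (extChartAt (𝓡∂ d) x₀).source)
    (h₁ : z ∈ (extChartAt (𝓡∂ d) x₁).source) (v : TangentSpace (𝓡∂ d) z) :
    componentsAt x₁ v =
      coordChangeDeriv x₀ x₁ (extChartAt (𝓡∂ d) x₀ z) (componentsAt x₀ v) := by
  have hzz : z ∈ (extChartAt (𝓡∂ d) z).source := mem_extChartAt_source z
  have := (tangentCoordChange_comp (I := 𝓡∂ d) (w := z) (x := x₀) (y := x₁) (v := v)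
    ⟨⟨hzz, h₀⟩, h₁⟩).symm
  rw [tangentCoordChange_def (x := x₀)] at this
  exact this

theorem hasFDerivWithinAt_coordChange {x₀ x₁ z : M} (h₀ : z ∈ (extChartAt (𝓡∂ d) x₀).source)
    (h₁ : z ∈ (extChartAt (𝓡∂ d) x₁).source) :
    HasFDerivWithinAt (coordChange x₀ x₁)
      (coordChangeDeriv x₀ x₁ (extChartAt (𝓡∂ d) x₀ z)) (range (𝓡∂ d)) (extChartAt (𝓡∂ d) x₀ z) :=
  ((contDiffWithinAt_coordChange h₀ h₁).differentiableWithinAt (by simp)).hasFDerivWithinAt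

theorem coordChangeDeriv_surjective {x₀ x₁ z : M} (h₀ : z ∈ (extChartAt (𝓡∂ d) x₀).source)
    (h₁ : z ∈ (extChartAt (𝓡∂ d) x₁).source) :
    Function.Surjective (coordChangeDeriv x₀ x₁ (extChartAt (𝓡∂ d) x₀ z)) := fun w =>
  ⟨componentsAt x₀ (tangentOf x₁ z w), by
    rw [← componentsAt_eq_coordChangeDeriv h₀ h₁, componentsAt_tangentOf h₁]⟩

end Coords

section Spray

open Filter Topology

variable {d : ℕ} [NeZero d] {M : Type*} [TopologicalSpace M] [ChartedSpace (EuclideanHalfSpace d) M]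
  [IsManifold (𝓡∂ d) ∞ M] [RiemannianBundle (fun x : M => TangentSpace (𝓡∂ d) x)]

/-- The geodesic vector field in the coordinates of `TM` given by the preferred chart at `x₀`. -/
noncomputable def spray (x₀ : M) (q : Euc d × Euc d) : Euc d × Euc d :=
  (q.2, -christoffelMap x₀ q.1 q.2 q.2)

theorem metricForm_coordChange {x₀ x₁ z : M} (h₀ : z ∈ (extChartAt (𝓡∂ d) x₀).source)
    (h₁ : z ∈ (extChartAt (𝓡∂ d) x₁).source) (v w : Euc d) :
    metricForm x₀ (extChartAt (𝓡∂ d) x₀ z) v w = metricForm x₁ (extChartAt (𝓡∂ d) x₁ z)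
      (coordChangeDeriv x₀ x₁ (extChartAt (𝓡∂ d) x₀ z) v)
      (coordChangeDeriv x₀ x₁ (extChartAt (𝓡∂ d) x₀ z) w) := by
  rw [metricForm_eq_inner x₀ h₀, inner_eq_metricForm x₁ h₁,
    componentsAt_eq_coordChangeDeriv h₀ h₁, componentsAt_eq_coordChangeDeriv h₀ h₁,
    componentsAt_tangentOf h₀, componentsAt_tangentOf h₀]

variable [IsContMDiffRiemannianBundle (𝓡∂ d) ∞ (EuclideanSpace ℝ (Fin d))
      (fun x : M => TangentSpace (𝓡∂ d) x)]

theorem contDiffWithinAt_christoffel (x₀ : M) {y : Euc d}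
    (hy : y ∈ (extChartAt (𝓡∂ d) x₀).target) (k i j : Fin d) :
    ContDiffWithinAt ℝ ∞ (fun y => christoffel x₀ y k i j) (range (𝓡∂ d)) y := by
  have hg : ∀ i j, ContDiffWithinAt ℝ ∞ (fun y => metricMatrix x₀ y i j) (range (𝓡∂ d)) y :=
    fun i j => (contDiffOn_metricMatrix x₀ i j y hy).mono_of_mem_nhdsWithin
      (extChartAt_target_mem_nhdsWithin_of_mem hy)
  have hp : ∀ i j l, ContDiffWithinAt ℝ ∞ (partialDeriv i (fun z => metricMatrix x₀ z j l))
      (range (𝓡∂ d)) y := fun i j l =>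
    ((hg j l).fderivWithin_right (𝓡∂ d).uniqueDiffOn (by simp)
      (extChartAt_target_subset_range x₀ hy)).clm_apply contDiffWithinAt_const
  have hdet := (isUnit_det_metricMatrix x₀ hy).ne_zero
  exact contDiffWithinAt_const.mul (ContDiffWithinAt.sum fun l _ =>
    (contDiffWithinAt_matrix_inv hg hdet k l).mul (((hp i j l).add (hp j i l)).sub (hp l i j)))

theorem contDiffWithinAt_spray (x₀ : M) {q : Euc d × Euc d}
    (hq : q.1 ∈ (extChartAt (𝓡∂ d) x₀).target) :
    ContDiffWithinAt ℝ ∞ (spray x₀) (range (𝓡∂ d) ×ˢ univ) q := by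
  refine ContDiffWithinAt.prodMk (f := fun q : Euc d × Euc d => q.2)
    (g := fun q : Euc d × Euc d => -christoffelMap x₀ q.1 q.2 q.2) contDiffWithinAt_snd
    (ContDiffWithinAt.neg ?_)
  rw [contDiffWithinAt_euclidean]
  intro k
  have h2 : ∀ i, ContDiffWithinAt ℝ ∞ (fun q : Euc d × Euc d => q.2 i)
      (range (𝓡∂ d) ×ˢ univ) q := fun i =>
    (((EuclideanSpace.proj i : Euc d →L[ℝ] ℝ).comp
      (ContinuousLinearMap.snd ℝ (Euc d) (Euc d))).contDiff).contDiffWithinAt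
  have h1 : ∀ i j, ContDiffWithinAt ℝ ∞ (fun q : Euc d × Euc d => christoffel x₀ q.1 k i j)
      (range (𝓡∂ d) ×ˢ univ) q := fun i j =>
    ContDiffWithinAt.comp (g := fun y => christoffel x₀ y k i j) (t := range (𝓡∂ d)) q
      (contDiffWithinAt_christoffel x₀ hq k i j) contDiffWithinAt_fst (fun q hq => hq.1)
  have h3 : ContDiffWithinAt ℝ ∞ (fun q : Euc d × Euc d =>
      ∑ i, ∑ j, christoffel x₀ q.1 k i j * q.2 i * q.2 j) (range (𝓡∂ d) ×ˢ univ) q :=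
    ContDiffWithinAt.sum fun i _ => ContDiffWithinAt.sum fun j _ => ((h1 i j).mul (h2 i)).mul (h2 j)
  exact h3

/-- The geodesic equation does not depend on the chart: by the transformation law of the spray, the
second derivative of the change of coordinates accounts for the difference of the Christoffel
symbols. -/
theorem hasDerivWithinAt_coords_change {x₀ x₁ : M} {c : ℝ → TangentBundle (𝓡∂ d) M} {s : Set ℝ}
    {t : ℝ} (ht : t ∈ s) (hc : ContinuousWithinAt (fun t => (c t).1) s t)
    (h₀ : (c t).1 ∈ (extChartAt (𝓡∂ d) x₀).source) (h₁ : (c t).1 ∈ (extChartAt (𝓡∂ d) x₁).source)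
    (h : HasDerivWithinAt (fun t => coords x₀ (c t)) (spray x₀ (coords x₀ (c t))) s t) :
    HasDerivWithinAt (fun t => coords x₁ (c t)) (spray x₁ (coords x₁ (c t))) s t := by
  set z := (c t).1 with hz
  set y := extChartAt (𝓡∂ d) x₀ z with hy
  set H : Set (Euc d) := range (𝓡∂ d) with hH
  have hyH : y ∈ H := extChartAt_mem_range x₀ z
  have hκ := hasFDerivWithinAt_coordChange h₀ h₁
  have hκ' : HasFDerivWithinAt (coordChangeDeriv x₀ x₁)
      (fderivWithin ℝ (coordChangeDeriv x₀ x₁) H y) H y :=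
    (((contDiffWithinAt_coordChange h₀ h₁).fderivWithin_right (m := 1) (𝓡∂ d).uniqueDiffOn
      (by norm_cast) hyH).differentiableWithinAt (by simp)).hasFDerivWithinAt
  have hsymm : ∀ a b, fderivWithin ℝ (coordChangeDeriv x₀ x₁) H y a b =
      fderivWithin ℝ (coordChangeDeriv x₀ x₁) H y b a :=
    (contDiffWithinAt_coordChange h₀ h₁).isSymmSndFDerivWithinAt
      (by simp [minSmoothness_of_isRCLikeNormedField]; norm_cast)
      (𝓡∂ d).uniqueDiffOn ((𝓡∂ d).range_subset_closure_interior hyH) hyH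
  have hκy : coordChange x₀ x₁ y = extChartAt (𝓡∂ d) x₁ z := coordChange_apply h₀
  have hy0 := (extChartAt (𝓡∂ d) x₀).map_source h₀
  have hy1 := (extChartAt (𝓡∂ d) x₁).map_source h₁
  set v := componentsAt x₀ (c t).2 with hv
  have hv1 : componentsAt x₁ (c t).2 = coordChangeDeriv x₀ x₁ y v :=
    componentsAt_eq_coordChangeDeriv h₀ h₁ _
  have key := spray_transformation (κ := coordChange x₀ x₁) (κ' := coordChangeDeriv x₀ x₁)
    (g₁ := metricForm x₁) (v := v) (Γ₀ := christoffelMap x₀ y v v)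
    (Γ₁ := christoffelMap x₁ (extChartAt (𝓡∂ d) x₁ z) (coordChangeDeriv x₀ x₁ y v)
      (coordChangeDeriv x₀ x₁ y v)) ((𝓡∂ d).uniqueDiffOn y hyH) hyH
    (t := H) (fun _ _ => extChartAt_mem_range x₁ _) hκ hκ' hsymm
    (coordChangeDeriv_surjective h₀ h₁) (hasFDerivWithinAt_metricForm x₀ hy0)
    (by rw [hκy]; exact hasFDerivWithinAt_metricForm x₁ hy1)
    (by
      filter_upwards [eventually_mem_sources h₀ h₁] with y' hy' v w
      obtain ⟨z', hz0, hz1, rfl⟩ := hy'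
      rw [coordChange_apply hz0]
      exact metricForm_coordChange hz0 hz1 v w)
    (fun a b => metricForm_comm _ _ _ _)
    (fun a ha => by rw [hκy]; exact metricForm_pos x₁ hy1 ha)
    (fun w => by rw [metricForm_christoffelMap x₀ hy0]; ring)
    (fun w => by rw [hκy, metricForm_christoffelMap x₁ hy1]; ring)
  have hyt : HasDerivWithinAt (fun t => (coords x₀ (c t)).1) v s t := h.fst
  have hvt : HasDerivWithinAt (fun t => (coords x₀ (c t)).2) (-christoffelMap x₀ y v v) s t := h.snd
  have hmaps : MapsTo (fun t => (coords x₀ (c t)).1) s H := fun _ _ => extChartAt_mem_range x₀ _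
  have d1 := HasFDerivWithinAt.comp_hasDerivWithinAt t (hκ : HasFDerivWithinAt _ _ H
    ((fun t => (coords x₀ (c t)).1) t)) hyt hmaps
  have d2 := (HasFDerivWithinAt.comp_hasDerivWithinAt t (hκ' : HasFDerivWithinAt _ _ H
    ((fun t => (coords x₀ (c t)).1) t)) hyt hmaps).clm_apply hvt
  have hev : ∀ᶠ t' in 𝓝[s] t, coords x₁ (c t') =
      (coordChange x₀ x₁ (coords x₀ (c t')).1,
        coordChangeDeriv x₀ x₁ (coords x₀ (c t')).1 (coords x₀ (c t')).2) := by
    filter_upwards [hc.preimage_mem_nhdsWithin (extChartAt_source_mem_nhds' h₀),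
      hc.preimage_mem_nhdsWithin (extChartAt_source_mem_nhds' h₁)] with t' ht0 ht1
    exact Prod.ext (coordChange_apply ht0).symm (componentsAt_eq_coordChangeDeriv ht0 ht1 _)
  have hd : spray x₁ (coords x₁ (c t)) = (coordChangeDeriv x₀ x₁ y v,
      fderivWithin ℝ (coordChangeDeriv x₀ x₁) H y v v +
        coordChangeDeriv x₀ x₁ y (-christoffelMap x₀ y v v)) := by
    refine Prod.ext hv1 ?_
    show -christoffelMap x₁ (extChartAt (𝓡∂ d) x₁ z) (componentsAt x₁ (c t).2)
      (componentsAt x₁ (c t).2) = _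
    rw [hv1, map_neg, key, neg_add]
    exact (add_neg_cancel_left _ _).symm
  rw [hd]
  exact (d1.prodMk d2).congr_of_eventuallyEq hev (hev.self_of_nhdsWithin ht)

end Spray


/-! ### Geodesics in a chart -/

section TangentCoords

open Filter Topology

variable {d : ℕ} [NeZero d] {M : Type*} [TopologicalSpace M] [ChartedSpace (EuclideanHalfSpace d) M]
  [IsManifold (𝓡∂ d) ∞ M]

/-- The point of `TM` with given coordinates in the preferred chart at `x₀`. -/
noncomputable def ofCoords (x₀ : M) (q : Euc d × Euc d) : TangentBundle (𝓡∂ d) M :=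
  ⟨(extChartAt (𝓡∂ d) x₀).symm q.1, tangentOf x₀ _ q.2⟩

theorem componentsAt_self {z : M} (v : TangentSpace (𝓡∂ d) z) : componentsAt z v = v :=
  tangentCoordChange_self (mem_extChartAt_source z)

theorem coords_ofCoords {x₀ : M} {q : Euc d × Euc d} (hq : q.1 ∈ (extChartAt (𝓡∂ d) x₀).target) :
    coords x₀ (ofCoords x₀ q) = q :=
  Prod.ext ((extChartAt (𝓡∂ d) x₀).right_inv hq)
    (componentsAt_tangentOf ((extChartAt (𝓡∂ d) x₀).map_target hq) q.2)

theorem extChartAt_tangent_source (q : TangentBundle (𝓡∂ d) M) :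
    (extChartAt (𝓡∂ d).tangent q).source = {p | p.1 ∈ (extChartAt (𝓡∂ d) q.1).source} := by
  ext p
  rw [extChartAt_source, TangentBundle.mem_chart_source_iff]
  change _ ↔ p.1 ∈ (extChartAt (𝓡∂ d) q.1).source
  rw [extChartAt_source]

theorem mem_extChartAt_tangent_target (p₀ : TangentBundle (𝓡∂ d) M) {q : Euc d × Euc d}
    (hq : q.1 ∈ (extChartAt (𝓡∂ d) p₀.1).target) :
    q ∈ (extChartAt (𝓡∂ d).tangent p₀).target := by
  have hp : ofCoords p₀.1 q ∈ (extChartAt (𝓡∂ d).tangent p₀).source := by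
    rw [extChartAt_tangent_source]
    exact (extChartAt (𝓡∂ d) p₀.1).map_target hq
  have := (extChartAt (𝓡∂ d).tangent p₀).map_source hp
  rwa [extChartAt_tangent, coords_ofCoords hq] at this

theorem extChartAt_tangent_symm (p₀ : TangentBundle (𝓡∂ d) M) {q : Euc d × Euc d}
    (hq : q.1 ∈ (extChartAt (𝓡∂ d) p₀.1).target) :
    (extChartAt (𝓡∂ d).tangent p₀).symm q = ofCoords p₀.1 q := by
  have hp : ofCoords p₀.1 q ∈ (extChartAt (𝓡∂ d).tangent p₀).source := by
    rw [extChartAt_tangent_source]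
    exact (extChartAt (𝓡∂ d) p₀.1).map_target hq
  have h := (extChartAt (𝓡∂ d).tangent p₀).left_inv hp
  rwa [extChartAt_tangent, coords_ofCoords hq] at h

theorem ofCoords_coords {x₀ : M} {p : TangentBundle (𝓡∂ d) M}
    (hp : p.1 ∈ (extChartAt (𝓡∂ d) x₀).source) : ofCoords x₀ (coords x₀ p) = p := by
  have hp' : p ∈ (extChartAt (𝓡∂ d).tangent (⟨x₀, 0⟩ : TangentBundle (𝓡∂ d) M)).source := by
    rw [extChartAt_tangent_source]; exact hp
  have h := (extChartAt (𝓡∂ d).tangent (⟨x₀, 0⟩ : TangentBundle (𝓡∂ d) M)).left_inv hp'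
  rwa [extChartAt_tangent, extChartAt_tangent_symm] at h
  exact (extChartAt (𝓡∂ d) x₀).map_source hp

theorem continuousAt_coords {x₀ : M} {p : TangentBundle (𝓡∂ d) M}
    (hp : p.1 ∈ (extChartAt (𝓡∂ d) x₀).source) : ContinuousAt (coords x₀) p := by
  have hp' : p ∈ (extChartAt (𝓡∂ d).tangent (⟨x₀, 0⟩ : TangentBundle (𝓡∂ d) M)).source := by
    rw [extChartAt_tangent_source]; exact hp
  have h := continuousAt_extChartAt' (I := (𝓡∂ d).tangent) hp'
  exact h.congr (Eventually.of_forall fun q => extChartAt_tangent _ q)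

theorem continuousWithinAt_ofCoords {x₀ : M} {q : Euc d × Euc d}
    (hq : q.1 ∈ (extChartAt (𝓡∂ d) x₀).target) :
    ContinuousWithinAt (ofCoords x₀) (range (𝓡∂ d) ×ˢ univ) q := by
  set p₀ : TangentBundle (𝓡∂ d) M := ⟨x₀, 0⟩
  have h := continuousOn_extChartAt_symm (I := (𝓡∂ d).tangent) p₀ q
    (mem_extChartAt_tangent_target p₀ hq)
  have h2 : ContinuousWithinAt (extChartAt (𝓡∂ d).tangent p₀).symm (range (𝓡∂ d) ×ˢ univ) q := by
    refine h.mono_of_mem_nhdsWithin ?_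
    filter_upwards [mem_nhdsWithin_target hq] with q' hq'
    exact mem_extChartAt_tangent_target p₀ hq'
  refine h2.congr_of_eventuallyEq_of_mem ?_ ⟨extChartAt_target_subset_range x₀ hq, mem_univ _⟩
  filter_upwards [mem_nhdsWithin_target hq] with q' hq'
  exact (extChartAt_tangent_symm p₀ hq').symm

end TangentCoords

section GeodesicCoords

open Filter Topology

variable {d : ℕ} [NeZero d] {M : Type*} [TopologicalSpace M] [ChartedSpace (EuclideanHalfSpace d) M]
  [IsManifold (𝓡∂ d) ∞ M] [RiemannianBundle (fun x : M => TangentSpace (𝓡∂ d) x)]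

theorem geodesicField_eq_spray (p : TangentBundle (𝓡∂ d) M) :
    geodesicField p = spray p.1 (coords p.1 p) := by
  have h : coords p.1 p = (extChartAt (𝓡∂ d) p.1 p.1, p.2) :=
    Prod.ext rfl (componentsAt_self p.2)
  rw [h]
  refine Prod.ext rfl ?_
  refine PiLp.ext fun k => rfl

theorem norm_eq_one_iff {x₀ : M} {p : TangentBundle (𝓡∂ d) M}
    (hp : p.1 ∈ (extChartAt (𝓡∂ d) x₀).source) : ‖p.2‖ = 1 ↔
      metricForm x₀ (coords x₀ p).1 (coords x₀ p).2 (coords x₀ p).2 = 1 := by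
  have h := inner_eq_metricForm x₀ hp p.2 p.2
  rw [real_inner_self_eq_norm_sq] at h
  rw [coords, ← h]
  exact (pow_eq_one_iff_of_nonneg (norm_nonneg _) two_ne_zero).symm

variable [IsContMDiffRiemannianBundle (𝓡∂ d) ∞ (EuclideanSpace ℝ (Fin d))
      (fun x : M => TangentSpace (𝓡∂ d) x)]

/-- Geodesics solve the geodesic equation in every chart. -/
theorem hasDerivWithinAt_coords {x₀ : M} {c : ℝ → TangentBundle (𝓡∂ d) M} {s : Set ℝ}
    (hc : IsMIntegralCurveOn c (geodesicField (d := d) (M := M)) s) {t : ℝ} (ht : t ∈ s)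
    (h₀ : (c t).1 ∈ (extChartAt (𝓡∂ d) x₀).source) :
    HasDerivWithinAt (fun t => coords x₀ (c t)) (spray x₀ (coords x₀ (c t))) s t := by
  have h1 := hc.hasDerivWithinAt (t₀ := t) ht (mem_extChartAt_source _)
  have h2 : HasDerivWithinAt (fun t' => coords (c t).1 (c t'))
      (spray (c t).1 (coords (c t).1 (c t))) s t := by
    rw [← geodesicField_eq_spray]
    have h3 := h1.congr_deriv (tangentCoordChange_self (mem_extChartAt_source _))
    refine h3.congr_of_eventuallyEq (Eventually.of_forall fun t' => ?_) ?_
    · exact (extChartAt_tangent _ _).symm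
    · exact (extChartAt_tangent _ _).symm
  have hcont : ContinuousWithinAt (fun t => (c t).1) s t :=
    (FiberBundle.continuous_proj (Euc d) (TangentSpace (𝓡∂ d))).continuousAt.comp_continuousWithinAt
      (hc t ht).1
  exact hasDerivWithinAt_coords_change ht hcont (mem_extChartAt_source _) h₀ h2

theorem hasMFDerivWithinAt_of_coords {x₀ : M} {c : ℝ → TangentBundle (𝓡∂ d) M} {s : Set ℝ}
    {t : ℝ} (ht : t ∈ s) (hcont : ContinuousWithinAt c s t)
    (h₀ : (c t).1 ∈ (extChartAt (𝓡∂ d) x₀).source)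
    (h : HasDerivWithinAt (fun t => coords x₀ (c t)) (spray x₀ (coords x₀ (c t))) s t) :
    HasMFDerivWithinAt 𝓘(ℝ, ℝ) (𝓡∂ d).tangent c s t
      ((1 : ℝ →L[ℝ] ℝ).smulRight (geodesicField (c t))) := by
  have h2 := hasDerivWithinAt_coords_change ht
    ((FiberBundle.continuous_proj (Euc d)
      (TangentSpace (𝓡∂ d))).continuousAt.comp_continuousWithinAt hcont)
    h₀ (mem_extChartAt_source _) h
  rw [← geodesicField_eq_spray] at h2
  refine ⟨hcont, ?_⟩
  have h3 := h2.hasFDerivWithinAt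
  simp only [mfld_simps]
  refine HasFDerivWithinAt.congr_of_eventuallyEq (h3 : HasFDerivWithinAt _ _ _ _)
    (Eventually.of_forall fun t' => ?_) ?_
  · exact extChartAt_tangent _ _
  · exact extChartAt_tangent _ _

/-- A solution of the geodesic equation in a chart is a geodesic. -/
theorem isMIntegralCurveOn_ofCoords {x₀ : M} {q : ℝ → Euc d × Euc d} {s : Set ℝ}
    (hq : ∀ t ∈ s, (q t).1 ∈ (extChartAt (𝓡∂ d) x₀).target)
    (hd : ∀ t ∈ s, HasDerivWithinAt q (spray x₀ (q t)) s t) :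
    IsMIntegralCurveOn (fun t => ofCoords x₀ (q t)) (geodesicField (d := d) (M := M)) s := by
  intro t ht
  have hcont : ContinuousWithinAt (fun t => ofCoords x₀ (q t)) s t :=
    (continuousWithinAt_ofCoords (hq t ht)).comp (hd t ht).continuousWithinAt
      fun t' ht' => ⟨extChartAt_target_subset_range x₀ (hq t' ht'), mem_univ _⟩
  refine hasMFDerivWithinAt_of_coords (x₀ := x₀) ht hcont
    ((extChartAt (𝓡∂ d) x₀).map_target (hq t ht)) ?_
  rw [coords_ofCoords (hq t ht)]
  exact (hd t ht).congr (fun t' ht' => coords_ofCoords (hq t' ht')) (coords_ofCoords (hq t ht))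

/-- The speed is constant along solutions of the geodesic equation in a chart. -/
theorem metricForm_eq_of_hasDerivWithinAt {x₀ : M} {q : ℝ → Euc d × Euc d} {s : Set ℝ}
    (hs : Convex ℝ s) (hq : ∀ t ∈ s, (q t).1 ∈ (extChartAt (𝓡∂ d) x₀).target)
    (hd : ∀ t ∈ s, HasDerivWithinAt q (spray x₀ (q t)) s t) {t t' : ℝ} (ht : t ∈ s)
    (ht' : t' ∈ s) :
    metricForm x₀ (q t).1 (q t).2 (q t).2 = metricForm x₀ (q t').1 (q t').2 (q t').2 := by
  have key : ∀ t ∈ s, HasDerivWithinAt (fun t => metricForm x₀ (q t).1 (q t).2 (q t).2) 0 s t := by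
    intro t ht
    have h1 : HasDerivWithinAt (fun t => (q t).1) (q t).2 s t := (hd t ht).fst
    have h2 : HasDerivWithinAt (fun t => (q t).2)
        (-christoffelMap x₀ (q t).1 (q t).2 (q t).2) s t := (hd t ht).snd
    have hg : HasFDerivWithinAt (fun t => metricForm x₀ (q t).1) _ s t :=
      HasFDerivWithinAt.comp (g := metricForm x₀) (f := fun t => (q t).1) t
        (hasFDerivWithinAt_metricForm x₀ (hq t ht)) h1.hasFDerivWithinAt
        (fun t' ht' => extChartAt_target_subset_range x₀ (hq t' ht'))
    obtain ⟨L, hL, hL'⟩ := exists_hasFDerivWithinAt_bilin hg h2.hasFDerivWithinAt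
      h2.hasFDerivWithinAt
    refine hL.hasDerivWithinAt.congr_deriv ?_
    rw [hL']
    simp only [ContinuousLinearMap.comp_apply, ContinuousLinearMap.toSpanSingleton_apply, one_smul]
    rw [metricForm_comm x₀ _ (q t).2, map_neg, neg_apply, metricForm_christoffelMap x₀ (hq t ht)]
    ring
  have := hs.norm_image_sub_le_of_norm_hasDerivWithin_le (C := 0) key (by simp) ht' ht
  rw [zero_mul, norm_le_zero_iff, sub_eq_zero] at this
  exact this

end GeodesicCoords


/-! ### The boundary and its second fundamental form -/

section Boundary

open Filter Topology

variable {d : ℕ} [NeZero d] {M : Type*} [TopologicalSpace M] [ChartedSpace (EuclideanHalfSpace d) M]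

theorem mem_range_iff {y : Euc d} : y ∈ range (𝓡∂ d) ↔ 0 ≤ y 0 := by
  rw [range_modelWithCornersEuclideanHalfSpace]; rfl

theorem extChartAt_zero_nonneg (x₀ z : M) : 0 ≤ extChartAt (𝓡∂ d) x₀ z 0 :=
  mem_range_iff.1 (extChartAt_mem_range x₀ z)

variable [IsManifold (𝓡∂ d) ∞ M]

theorem mem_boundary_iff {x₀ z : M} (hz : z ∈ (extChartAt (𝓡∂ d) x₀).source) :
    z ∈ (𝓡∂ d).boundary M ↔ extChartAt (𝓡∂ d) x₀ z 0 = 0 := by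
  have hz' : z ∈ (chartAt (EuclideanHalfSpace d) x₀).source := by rwa [extChartAt_source] at hz
  have h1 := (𝓡∂ d).isInteriorPoint_iff_of_mem_atlas (n := ∞) (by simp)
    (chart_mem_atlas (EuclideanHalfSpace d) x₀) hz'
  have h2 : extChartAt (𝓡∂ d) x₀ z ∈ interior (extChartAt (𝓡∂ d) x₀).target ↔
      0 < extChartAt (𝓡∂ d) x₀ z 0 := by
    have h3 : extChartAt (𝓡∂ d) x₀ z ∈ interior (range (𝓡∂ d)) ↔
        0 < extChartAt (𝓡∂ d) x₀ z 0 := by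
      rw [interior_range_modelWithCornersEuclideanHalfSpace]; rfl
    rw [← h3]
    exact ⟨fun h =>
        (chartAt (EuclideanHalfSpace d) x₀).interior_extend_target_subset_interior_range h,
      fun h => (chartAt (EuclideanHalfSpace d) x₀).mem_interior_extend_target
        ((chartAt (EuclideanHalfSpace d) x₀).map_source hz') h⟩
  have h4 : z ∈ (𝓡∂ d).boundary M ↔ ¬ (𝓡∂ d).IsInteriorPoint z := by
    rw [(𝓡∂ d).isInteriorPoint_iff_not_isBoundaryPoint, not_not]; rfl
  rw [h4, h1]
  change ¬ extChartAt (𝓡∂ d) x₀ z ∈ interior (extChartAt (𝓡∂ d) x₀).target ↔ _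
  rw [h2, not_lt]
  exact ⟨fun h => le_antisymm h (extChartAt_zero_nonneg x₀ z), fun h => h.le⟩

/-- Whether a tangent vector at a boundary point points outwards does not depend on the chart: the
`0`-th component of the change of coordinates attains its minimum `0` there, so that its derivative
is nonnegative on inward vectors. -/
theorem componentsAt_zero_nonpos {x₀ x₁ z : M} (h₀ : z ∈ (extChartAt (𝓡∂ d) x₀).source)
    (h₁ : z ∈ (extChartAt (𝓡∂ d) x₁).source) (hz : z ∈ (𝓡∂ d).boundary M)
    {v : TangentSpace (𝓡∂ d) z} (hv : (componentsAt x₀ v) 0 ≤ 0) : (componentsAt x₁ v) 0 ≤ 0 := by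
  set y := extChartAt (𝓡∂ d) x₀ z with hy
  have hy0 : y 0 = 0 := (mem_boundary_iff h₀).1 hz
  have hκ0 : coordChange x₀ x₁ y 0 = 0 := by
    rw [coordChange_apply h₀]; exact (mem_boundary_iff h₁).1 hz
  have hd : HasFDerivWithinAt (fun y => coordChange x₀ x₁ y 0)
      ((EuclideanSpace.proj 0 : Euc d →L[ℝ] ℝ).comp (coordChangeDeriv x₀ x₁ y)) (range (𝓡∂ d)) y :=
    (EuclideanSpace.proj 0 : Euc d →L[ℝ] ℝ).hasFDerivAt.comp_hasFDerivWithinAt y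
      (hasFDerivWithinAt_coordChange h₀ h₁)
  have hmin : IsLocalMinOn (fun y => coordChange x₀ x₁ y 0) (range (𝓡∂ d)) y := by
    refine Eventually.of_forall fun y' => ?_
    change coordChange x₀ x₁ y 0 ≤ coordChange x₀ x₁ y' 0
    rw [hκ0]
    exact extChartAt_zero_nonneg x₁ _
  have hcone : -componentsAt x₀ v ∈ posTangentConeAt (range (𝓡∂ d)) y := by
    refine mem_posTangentConeAt_of_segment_subset
      (((𝓡∂ d).convex_range).segment_subset (extChartAt_mem_range x₀ z) ?_)
    rw [mem_range_iff]
    simp [hy0, hv]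
  have h : 0 ≤ (coordChangeDeriv x₀ x₁ y (-componentsAt x₀ v)) 0 :=
    hmin.hasFDerivWithinAt_nonneg hd hcone
  rw [map_neg, PiLp.neg_apply] at h
  rw [componentsAt_eq_coordChangeDeriv h₀ h₁]
  linarith

end Boundary

section Normal

open Filter Topology Matrix

variable {d : ℕ} [NeZero d] {M : Type*} [TopologicalSpace M] [ChartedSpace (EuclideanHalfSpace d) M]
  [IsManifold (𝓡∂ d) ∞ M] [RiemannianBundle (fun x : M => TangentSpace (𝓡∂ d) x)]

/-- The outer unit normal of the level sets of the coordinate `y⁰`, as a vector field in the chart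
at `x₀`. -/
noncomputable def normalField (x₀ : M) (y : Euc d) : Euc d :=
  WithLp.toLp 2 fun k => normalComponent x₀ k y

theorem inv_metricMatrix_zero_pos (x₀ : M) {y : Euc d}
    (hy : y ∈ (extChartAt (𝓡∂ d) x₀).target) : 0 < (metricMatrix x₀ y)⁻¹ 0 0 :=
  (metricMatrix_posDef x₀ hy).inv.diag_pos

/-- The field is orthogonal to the level sets of `y⁰`. -/
theorem metricForm_normalField (x₀ : M) {y : Euc d} (hy : y ∈ (extChartAt (𝓡∂ d) x₀).target)
    (w : Euc d) : metricForm x₀ y (normalField x₀ y) w =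
      -(w 0) / Real.sqrt ((metricMatrix x₀ y)⁻¹ 0 0) := by
  have h : (normalField x₀ y).ofLp =
      (-(Real.sqrt ((metricMatrix x₀ y)⁻¹ 0 0))⁻¹) • ((metricMatrix x₀ y)⁻¹ *ᵥ Pi.single 0 1) := by
    ext k
    rw [mulVec_single_one]
    change normalComponent x₀ k y = _
    simp only [normalComponent, Pi.smul_apply, col_apply, smul_eq_mul]
    ring
  rw [metricForm_comm, metricForm_eq_dotProduct, h, mulVec_smul, mulVec_mulVec,
    mul_nonsing_inv _ (isUnit_det_metricMatrix x₀ hy), one_mulVec, dotProduct_smul,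
    dotProduct_single_one, smul_eq_mul]
  ring

theorem outerNormal_eq_tangentOf (x : M) :
    outerNormal x = tangentOf x x (normalField x (extChartAt (𝓡∂ d) x x)) := by
  rw [tangentOf_eq_sum (mem_extChartAt_source x)]
  rfl

/-- The sign of `⟨v, ν⟩` is opposite to that of the component `v⁰`. -/
theorem inner_outerNormal {x : M} (v : TangentSpace (𝓡∂ d) x) :
    inner ℝ v (outerNormal x) = -((componentsAt x v) 0) /
      Real.sqrt ((metricMatrix x (extChartAt (𝓡∂ d) x x))⁻¹ 0 0) := by
  have hx := mem_extChartAt_source (I := 𝓡∂ d) x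
  rw [inner_eq_metricForm x hx, outerNormal_eq_tangentOf, componentsAt_tangentOf hx,
    metricForm_comm, metricForm_normalField x ((extChartAt (𝓡∂ d) x).map_source hx)]

theorem mem_outwardBoundary_iff {p : SphereBundle d M} : p ∈ outwardBoundary d M ↔
    p.1.1 ∈ (𝓡∂ d).boundary M ∧ (componentsAt p.1.1 p.1.2) 0 ≤ 0 := by
  have hpos := Real.sqrt_pos.2 (inv_metricMatrix_zero_pos p.1.1
    ((extChartAt (𝓡∂ d) p.1.1).map_source (mem_extChartAt_source p.1.1)))
  refine and_congr Iff.rfl ?_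
  rw [inner_outerNormal, le_div_iff₀ hpos, zero_mul, neg_nonneg]

theorem mem_inwardBoundary_iff {p : SphereBundle d M} : p ∈ inwardBoundary d M ↔
    p.1.1 ∈ (𝓡∂ d).boundary M ∧ 0 ≤ (componentsAt p.1.1 p.1.2) 0 := by
  have hpos := Real.sqrt_pos.2 (inv_metricMatrix_zero_pos p.1.1
    ((extChartAt (𝓡∂ d) p.1.1).map_source (mem_extChartAt_source p.1.1)))
  refine and_congr Iff.rfl ?_
  rw [inner_outerNormal, div_le_iff₀ hpos, zero_mul, neg_nonpos]

variable [IsContMDiffRiemannianBundle (𝓡∂ d) ∞ (EuclideanSpace ℝ (Fin d))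
      (fun x : M => TangentSpace (𝓡∂ d) x)]

theorem hasFDerivWithinAt_normalField (x₀ : M) {y : Euc d}
    (hy : y ∈ (extChartAt (𝓡∂ d) x₀).target) :
    ∃ N' : Euc d →L[ℝ] Euc d, HasFDerivWithinAt (normalField x₀) N' (range (𝓡∂ d)) y ∧
      ∀ i k, N' (EuclideanSpace.single i (1 : ℝ)) k = partialDeriv i (normalComponent x₀ k) y := by
  have hyH : y ∈ range (𝓡∂ d) := extChartAt_target_subset_range x₀ hy
  have hg : ∀ i j, ContDiffWithinAt ℝ ∞ (fun y => metricMatrix x₀ y i j) (range (𝓡∂ d)) y :=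
    fun i j => (contDiffOn_metricMatrix x₀ i j y hy).mono_of_mem_nhdsWithin
      (extChartAt_target_mem_nhdsWithin_of_mem hy)
  have hdet := (isUnit_det_metricMatrix x₀ hy).ne_zero
  have hpos := inv_metricMatrix_zero_pos x₀ hy
  have hk : ∀ k, ContDiffWithinAt ℝ ∞ (normalComponent x₀ k) (range (𝓡∂ d)) y := fun k =>
    (contDiffWithinAt_matrix_inv hg hdet k 0).neg.div
      ((contDiffWithinAt_matrix_inv hg hdet 0 0).sqrt hpos.ne') (Real.sqrt_pos.2 hpos).ne'
  have hN : DifferentiableWithinAt ℝ (normalField x₀) (range (𝓡∂ d)) y := by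
    have : ContDiffWithinAt ℝ ∞ (normalField x₀) (range (𝓡∂ d)) y :=
      contDiffWithinAt_euclidean.2 hk
    exact this.differentiableWithinAt (by simp)
  refine ⟨_, hN.hasFDerivWithinAt, fun i k => ?_⟩
  have h := (hasFDerivWithinAt_euclidean.1 hN.hasFDerivWithinAt k).fderivWithin
    ((𝓡∂ d).uniqueDiffOn y hyH)
  have h2 : partialDeriv i (normalComponent x₀ k) y = _ :=
    congrArg (fun L : Euc d →L[ℝ] ℝ => L (EuclideanSpace.single i (1 : ℝ))) h
  rw [h2]
  rfl

/-- The second fundamental form of the boundary is `Π(w, w) = Γ⁰(w, w) / √g⁰⁰`. -/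
theorem inner_covDerivNormal (x : M) (w : Euc d) (hw : w 0 = 0) :
    inner ℝ (covDerivNormal x w.ofLp) (∑ i, w i • coordField x i x) =
      christoffelMap x (extChartAt (𝓡∂ d) x x) w w 0 /
        Real.sqrt ((metricMatrix x (extChartAt (𝓡∂ d) x x))⁻¹ 0 0) := by
  have hx := mem_extChartAt_source (I := 𝓡∂ d) x
  set y := extChartAt (𝓡∂ d) x x with hy
  have hyt : y ∈ (extChartAt (𝓡∂ d) x).target := (extChartAt (𝓡∂ d) x).map_source hx
  obtain ⟨N', hN', hN'k⟩ := hasFDerivWithinAt_normalField x hyt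
  set N := normalField x y with hN
  have hcov : covDerivNormal x w.ofLp = tangentOf x x (N' w + christoffelMap x y w N) := by
    rw [tangentOf_eq_sum hx, covDerivNormal]
    refine Finset.sum_congr rfl fun k _ => ?_
    congr 1
    rw [PiLp.add_apply, christoffelMap_apply]
    congr 1
    conv_rhs => rw [euc_sum_single w, map_sum]
    simp only [map_smul, WithLp.ofLp_sum, Finset.sum_apply, PiLp.smul_apply, smul_eq_mul, hN'k]
    rfl
  rw [← tangentOf_eq_sum hx, hcov, ← metricForm_eq_inner x hx, ← hy, map_add,
    _root_.add_apply, metricForm_christoffelMap x hyt]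
  obtain ⟨L, hL, hL'⟩ := exists_hasFDerivWithinAt_bilin (hasFDerivWithinAt_metricForm x hyt) hN'
    (hasFDerivWithinAt_const w y _)
  -- `g(ν, w)` vanishes identically for the constant field `w`, so that
  -- `g(∇_w ν, w) = -g(ν, ∇_w w)`.
  have hzero : HasFDerivWithinAt (fun z => metricForm x z (normalField x z) w) (0 : Euc d →L[ℝ] ℝ)
      (range (𝓡∂ d)) y := by
    refine (hasFDerivWithinAt_const (0 : ℝ) y _).congr_of_eventuallyEq ?_ ?_
    · filter_upwards [extChartAt_target_mem_nhdsWithin_of_mem hyt] with z hz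
      rw [metricForm_normalField x hz, hw]
      simp
    · rw [metricForm_normalField x hyt, hw]
      simp
  have hLw := congrArg (fun L : Euc d →L[ℝ] ℝ => L w)
    (((𝓡∂ d).uniqueDiffOn y (extChartAt_target_subset_range x hyt)).eq hL hzero)
  simp only [hL', _root_.zero_apply, map_zero, add_zero] at hLw
  have h1 := metricForm_christoffelMap x hyt w w N
  rw [metricForm_comm, metricForm_normalField x hyt] at h1
  have h2 := metricDeriv_comm x hyt w w N
  rw [← hN] at hLw
  rw [neg_div] at h1
  linarith

/-- Strict convexity in a chart: the component `-Γ⁰(w, w)` of the acceleration of a geodesic tangent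
to the boundary is negative. -/
theorem christoffelMap_zero_pos (hconvex : StrictlyConvexBoundary d M) {x : M}
    (hx : x ∈ (𝓡∂ d).boundary M) {w : Euc d} (hw : w 0 = 0) (hw' : w ≠ 0) :
    0 < christoffelMap x (extChartAt (𝓡∂ d) x x) w w 0 := by
  have h := hconvex x hx w.ofLp hw (by simpa using hw')
  rw [inner_covDerivNormal x w hw] at h
  by_contra hneg
  exact absurd h (not_lt.2 (div_nonpos_of_nonpos_of_nonneg (not_lt.1 hneg) (Real.sqrt_nonneg _)))

end Normal


/-! ### Functions on the unit sphere bundle -/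

section ExtendZero

variable {d : ℕ} [NeZero d] {M : Type*} [TopologicalSpace M] [ChartedSpace (EuclideanHalfSpace d) M]
  [RiemannianBundle (fun x : M => TangentSpace (𝓡∂ d) x)]

variable (d M) in
/-- The unit sphere bundle as a subset of `TM`. -/
def sphereSet : Set (TangentBundle (𝓡∂ d) M) := {p | ‖p.2‖ = 1}

/-- A function on `SM` extended by `0` to `TM`. -/
noncomputable def extendZero {F : Type*} [Zero F] (u : SphereBundle d M → F) :
    TangentBundle (𝓡∂ d) M → F :=
  Function.extend (fun p : SphereBundle d M => p.1) u (fun _ => 0)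

theorem extendZero_apply {F : Type*} [Zero F] (u : SphereBundle d M → F) (p : SphereBundle d M) :
    extendZero u p.1 = u p :=
  Subtype.val_injective.extend_apply u _ p

end ExtendZero

section UnitSet

open Filter Topology

variable {d : ℕ} [NeZero d] {M : Type*} [TopologicalSpace M] [ChartedSpace (EuclideanHalfSpace d) M]
  [IsManifold (𝓡∂ d) ∞ M] [RiemannianBundle (fun x : M => TangentSpace (𝓡∂ d) x)]

/-- The set of coordinates of the unit vectors in the preferred chart at `x₀`. -/
def unitSet (x₀ : M) : Set (Euc d × Euc d) :=
  {q | q.1 ∈ (extChartAt (𝓡∂ d) x₀).target ∧ metricForm x₀ q.1 q.2 q.2 = 1}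

/-- A function on `SM` in the coordinates given by the preferred chart at `x₀`. -/
noncomputable def inCoords {F : Type*} [Zero F] (x₀ : M) (u : SphereBundle d M → F)
    (q : Euc d × Euc d) : F :=
  extendZero u (ofCoords x₀ q)

theorem coords_mem_unitSet {x₀ : M} {p : SphereBundle d M}
    (hp : p.1.1 ∈ (extChartAt (𝓡∂ d) x₀).source) : coords x₀ p.1 ∈ unitSet x₀ :=
  ⟨(extChartAt (𝓡∂ d) x₀).map_source hp, (norm_eq_one_iff hp).1 p.2⟩

theorem inCoords_coords {F : Type*} [Zero F] {x₀ : M} (u : SphereBundle d M → F)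
    {p : SphereBundle d M} (hp : p.1.1 ∈ (extChartAt (𝓡∂ d) x₀).source) :
    inCoords x₀ u (coords x₀ p.1) = u p := by
  rw [inCoords, ofCoords_coords hp, extendZero_apply]

theorem ofCoords_mem_sphereSet_iff {x₀ : M} {q : Euc d × Euc d}
    (hq : q.1 ∈ (extChartAt (𝓡∂ d) x₀).target) :
    ofCoords x₀ q ∈ sphereSet d M ↔ q ∈ unitSet x₀ := by
  have h := norm_eq_one_iff (p := ofCoords x₀ q) ((extChartAt (𝓡∂ d) x₀).map_target hq)
  rw [coords_ofCoords hq] at h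
  exact h.trans ⟨fun h => ⟨hq, h⟩, fun h => h.2⟩

theorem exists_eq_coords {x₀ : M} {q : Euc d × Euc d} (hq : q ∈ unitSet x₀) :
    ∃ p : SphereBundle d M, p.1 = ofCoords x₀ q ∧ p.1.1 ∈ (extChartAt (𝓡∂ d) x₀).source ∧
      coords x₀ p.1 = q :=
  ⟨⟨ofCoords x₀ q, (ofCoords_mem_sphereSet_iff hq.1).2 hq⟩, rfl,
    (extChartAt (𝓡∂ d) x₀).map_target hq.1, coords_ofCoords hq.1⟩

theorem unitSet_subset (x₀ : M) : unitSet x₀ ⊆ range (𝓡∂ d) ×ˢ univ := fun _ hq =>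
  ⟨extChartAt_target_subset_range x₀ hq.1, mem_univ _⟩

/-- Smoothness of a function on `SM` at a point can be read off in any chart of `M`. -/
theorem contMDiffWithinAt_extendZero_iff {F : Type*} [NormedAddCommGroup F] [NormedSpace ℝ F]
    {u : SphereBundle d M → F} {k : ℕ} {x₀ : M} {p : SphereBundle d M}
    (hp : p.1.1 ∈ (extChartAt (𝓡∂ d) x₀).source) :
    ContMDiffWithinAt (𝓡∂ d).tangent 𝓘(ℝ, F) k (extendZero u) (sphereSet d M) p.1 ↔
      ContDiffWithinAt ℝ k (inCoords x₀ u) (unitSet x₀) (coords x₀ p.1) := by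
  have : IsManifold (𝓡∂ d).tangent k (TangentBundle (𝓡∂ d) M) :=
    IsManifold.of_le (n := ∞) (by exact_mod_cast le_top)
  set p₀ : TangentBundle (𝓡∂ d) M := ⟨x₀, 0⟩
  have hp₀ : p.1 ∈ (extChartAt (𝓡∂ d).tangent p₀).source := by
    rw [extChartAt_tangent_source]; exact hp
  have hp₁ := hp₀
  rw [extChartAt_source] at hp₁
  rw [contMDiffWithinAt_iff_of_mem_source' (x := p₀) (y := (0 : F)) hp₁
    (show extendZero u p.1 ∈ (chartAt F (0 : F)).source by rw [chartAt_self_eq]; exact mem_univ _)]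
  have hcoord : extChartAt (𝓡∂ d).tangent p₀ p.1 = coords x₀ p.1 := extChartAt_tangent _ _
  have hmem := (extChartAt (𝓡∂ d) x₀).map_source hp
  set q := coords x₀ p.1 with hq
  -- The domain of the coordinate expression and `unitSet x₀` coincide.
  have htarget : ∀ q', q' ∈ (extChartAt (𝓡∂ d).tangent p₀).target ↔
      q'.1 ∈ (extChartAt (𝓡∂ d) x₀).target := by
    refine fun q' => ⟨fun h => ?_, fun h => mem_extChartAt_tangent_target p₀ h⟩
    have h1 := (extChartAt (𝓡∂ d).tangent p₀).map_target h
    rw [extChartAt_tangent_source] at h1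
    have h2 := (extChartAt (𝓡∂ d) x₀).map_source h1
    have h3 := (extChartAt (𝓡∂ d).tangent p₀).right_inv h
    rw [extChartAt_tangent] at h3
    rw [← h3]
    exact h2
  have hset : (extChartAt (𝓡∂ d).tangent p₀).target ∩
      (extChartAt (𝓡∂ d).tangent p₀).symm ⁻¹'
        (sphereSet d M ∩ extendZero u ⁻¹' (extChartAt 𝓘(ℝ, F) (0 : F)).source) =
      unitSet x₀ := by
    ext q'
    simp only [extChartAt_source, chartAt_self_eq, mem_inter_iff, mem_preimage,
      OpenPartialHomeomorph.refl_source, mem_univ, and_true, htarget]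
    constructor
    · rintro ⟨h1, h2⟩
      rw [extChartAt_tangent_symm p₀ h1] at h2
      exact (ofCoords_mem_sphereSet_iff h1).1 h2
    · intro h
      refine ⟨h.1, ?_⟩
      rw [extChartAt_tangent_symm p₀ h.1]
      exact (ofCoords_mem_sphereSet_iff h.1).2 h
  have hqS : q ∈ unitSet x₀ := coords_mem_unitSet hp
  have heq : EqOn (extChartAt 𝓘(ℝ, F) (0 : F) ∘ extendZero u ∘
      (extChartAt (𝓡∂ d).tangent p₀).symm) (inCoords x₀ u) (unitSet x₀) := by
    intro q' hq'
    simp only [Function.comp_apply, extChartAt_model_space_eq_id, PartialEquiv.refl_coe, id_eq]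
    rw [extChartAt_tangent_symm p₀ hq'.1]
    rfl
  rw [hset, hcoord]
  refine ⟨fun h => h.2.congr (fun q' hq' => (heq hq').symm) (heq hqS).symm, fun h => ⟨?_,
    h.congr heq (heq hqS)⟩⟩
  -- continuity follows from continuity of the coordinate expression
  have hc : ContinuousWithinAt (fun p' => inCoords x₀ u (coords x₀ p'))
      (sphereSet d M ∩ {p | p.1 ∈ (extChartAt (𝓡∂ d) x₀).source}) p.1 := by
    refine ContinuousWithinAt.comp (g := inCoords x₀ u) (f := coords x₀) (t := unitSet x₀)
      h.continuousWithinAt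
      (continuousAt_coords hp).continuousWithinAt ?_
    rintro p' ⟨h1, h2⟩
    exact coords_mem_unitSet (p := ⟨p', h1⟩) h2
  have hnear : {p : TangentBundle (𝓡∂ d) M | p.1 ∈ (extChartAt (𝓡∂ d) x₀).source} ∈ 𝓝 p.1 :=
    (FiberBundle.continuous_proj (Euc d) (TangentSpace (𝓡∂ d))).continuousAt.preimage_mem_nhds
      (extChartAt_source_mem_nhds' hp)
  refine ((continuousWithinAt_inter hnear).1 (hc.congr (fun p' hp' => ?_) ?_))
  · rw [inCoords, ofCoords_coords hp'.2]
  · rw [inCoords, ofCoords_coords hp]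

theorem IsSmooth.contDiffWithinAt {F : Type*} [NormedAddCommGroup F] [NormedSpace ℝ F]
    {u : SphereBundle d M → F} (hu : IsSmooth u) (k : ℕ) {x₀ : M} {p : SphereBundle d M}
    (hp : p.1.1 ∈ (extChartAt (𝓡∂ d) x₀).source) :
    ContDiffWithinAt ℝ k (inCoords x₀ u) (unitSet x₀) (coords x₀ p.1) :=
  (contMDiffWithinAt_extendZero_iff hp).1 ((hu p.1 p.2).of_le (by exact_mod_cast le_top))

theorem isSmooth_of_forall {F : Type*} [NormedAddCommGroup F] [NormedSpace ℝ F]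
    {u : SphereBundle d M → F} (h : ∀ k : ℕ, k ≠ 0 → ∀ p : SphereBundle d M,
      ContMDiffWithinAt (𝓡∂ d).tangent 𝓘(ℝ, F) k (extendZero u) (sphereSet d M) p.1) :
    IsSmooth u := fun p hp =>
  contMDiffWithinAt_infty.2 fun k =>
    (h (k + 1) k.succ_ne_zero ⟨p, hp⟩).of_le (by exact_mod_cast k.le_succ)

variable [IsContMDiffRiemannianBundle (𝓡∂ d) ∞ (EuclideanSpace ℝ (Fin d))
      (fun x : M => TangentSpace (𝓡∂ d) x)]

/-- A smooth function on `SM`, in coordinates, has `C^k` extensions to all values of the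
coordinates: the extension is homogeneous of degree `0` inside `TM`. -/
theorem IsSmooth.exists_extension {F : Type*} [NormedAddCommGroup F] [NormedSpace ℝ F]
    {u : SphereBundle d M → F} (hu : IsSmooth u) (k : ℕ) {x₀ : M} {q₀ : Euc d × Euc d}
    (hq₀ : q₀ ∈ unitSet x₀) :
    ∃ g : Euc d × Euc d → F, ContDiff ℝ k g ∧ g =ᶠ[𝓝[unitSet x₀] q₀] inCoords x₀ u := by
  set H : Set (Euc d × Euc d) := range (𝓡∂ d) ×ˢ univ with hH
  let ℓ : Euc d × Euc d →L[ℝ] ℝ :=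
    (EuclideanSpace.proj 0 : Euc d →L[ℝ] ℝ).comp (ContinuousLinearMap.fst ℝ (Euc d) (Euc d))
  have hHℓ : H = {q | 0 ≤ ℓ q} := by
    ext q
    rw [hH, mem_prod, mem_range_iff]
    exact ⟨fun h => h.1, fun h => ⟨h, mem_univ _⟩⟩
  have hq₀H : q₀ ∈ H := unitSet_subset x₀ hq₀
  let G : Euc d × Euc d → ℝ := fun q => metricForm x₀ q.1 q.2 q.2
  have hg : ContDiffWithinAt ℝ ∞ (fun q : Euc d × Euc d => metricForm x₀ q.1) H q₀ :=
    ContDiffWithinAt.comp (g := metricForm x₀) (t := range (𝓡∂ d)) q₀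
      (contDiffWithinAt_metricForm x₀ hq₀.1) contDiffWithinAt_fst (fun q hq => hq.1)
  have hG : ContDiffWithinAt ℝ ∞ G H q₀ :=
    (hg.clm_apply contDiffWithinAt_snd).clm_apply contDiffWithinAt_snd
  have hG1 : G q₀ = 1 := hq₀.2
  let ρ : Euc d × Euc d → Euc d × Euc d := fun q => (q.1, (Real.sqrt (G q))⁻¹ • q.2)
  have hρ : ContDiffWithinAt ℝ ∞ ρ H q₀ :=
    ContDiffWithinAt.prodMk contDiffWithinAt_fst
      ((((hG.sqrt (by rw [hG1]; exact one_ne_zero)).inv (by rw [hG1]; simp))).smul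
        contDiffWithinAt_snd)
  have hρ0 : ∀ q, G q = 1 → ρ q = q := fun q hq => by simp [ρ, hq]
  have hmaps : ∀ᶠ q in 𝓝[H] q₀, ρ q ∈ unitSet x₀ := by
    have hpos : ∀ᶠ q in 𝓝[H] q₀, 0 < G q :=
      hG.continuousWithinAt.eventually (lt_mem_nhds (by rw [hG1]; exact one_pos))
    filter_upwards [mem_nhdsWithin_target hq₀.1, hpos] with q hq1 hq2
    refine ⟨hq1, ?_⟩
    have h3 : (Real.sqrt (G q))⁻¹ * ((Real.sqrt (G q))⁻¹ * G q) = 1 := by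
      have := Real.mul_self_sqrt hq2.le
      have h5 := (Real.sqrt_pos.2 hq2).ne'
      field_simp
      nlinarith
    simpa [ρ] using h3
  obtain ⟨p, -, hp, hpq⟩ := exists_eq_coords hq₀
  have hu1 : ContDiffWithinAt ℝ k (inCoords x₀ u) (unitSet x₀) (ρ q₀) := by
    rw [hρ0 q₀ hG1, ← hpq]
    exact hu.contDiffWithinAt k hp
  have hcomp : ContDiffWithinAt ℝ k (fun q => inCoords x₀ u (ρ q)) {q | 0 ≤ ℓ q} q₀ := by
    rw [← hHℓ]
    exact hu1.comp_of_preimage_mem_nhdsWithin q₀ (hρ.of_le (by exact_mod_cast le_top)) hmaps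
  obtain ⟨g, hg, hgu⟩ := exists_contDiff_eventuallyEq_halfSpace ℓ
    (e := (EuclideanSpace.single 0 1, 0)) (by simp [ℓ]) hcomp (by rw [hHℓ] at hq₀H; exact hq₀H)
  refine ⟨g, hg, ?_⟩
  rw [← hHℓ] at hgu
  filter_upwards [hgu.filter_mono (nhdsWithin_mono _ (unitSet_subset x₀)), self_mem_nhdsWithin]
    with q hq1 hq2
  rw [hq1, hρ0 q hq2.2]

end UnitSet


/-! ### The geodesic flow extended across the boundary -/

section RealLine

open Filter Topology

/-- A differentiable real function that starts nonnegative either stays so, or there is a first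
zero with nonpositive derivative up to which it does. -/
theorem nonneg_or_exists_first_exit {y v : ℝ → ℝ} {ε : ℝ}
    (hy : ∀ t ∈ Icc 0 ε, HasDerivAt y (v t) t) (h0 : 0 ≤ y 0) :
    (∀ t ∈ Icc 0 ε, 0 ≤ y t) ∨
      ∃ T ∈ Icc 0 ε, (∀ t ∈ Icc 0 T, 0 ≤ y t) ∧ y T = 0 ∧ v T ≤ 0 := by
  by_cases hK : ∀ t ∈ Icc 0 ε, 0 ≤ y t
  · exact Or.inl hK
  right
  push Not at hK
  obtain ⟨t₁, ht₁, hyt₁⟩ := hK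
  set K : Set ℝ := {t | t ∈ Icc 0 ε ∧ y t < 0} with hKdef
  have hne : K.Nonempty := ⟨t₁, ht₁, hyt₁⟩
  have hbdd : BddBelow K := ⟨0, fun t ht => ht.1.1⟩
  set T := sInf K with hT
  have hT0 : 0 ≤ T := le_csInf hne fun t ht => ht.1.1
  have hTt₁ : T ≤ t₁ := csInf_le hbdd ⟨ht₁, hyt₁⟩
  have hTm : T ∈ Icc 0 ε := ⟨hT0, hTt₁.trans ht₁.2⟩
  have hlt : ∀ t, 0 ≤ t → t < T → 0 ≤ y t := fun t ht htT => by
    by_contra hneg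
    exact notMem_of_lt_csInf htT hbdd ⟨⟨ht, htT.le.trans hTm.2⟩, not_le.1 hneg⟩
  have hcont : ContinuousAt y T := (hy T hTm).continuousAt
  have hyT0 : 0 ≤ y T := by
    rcases hT0.eq_or_lt with h | h
    · rwa [← h]
    · refine ge_of_tendsto (hcont.mono_left nhdsWithin_le_nhds : Tendsto y (𝓝[<] T) _) ?_
      filter_upwards [Ioo_mem_nhdsLT h] with t ht
      exact hlt t ht.1.le ht.2
  -- Points of `K` accumulate at `T` from the right.
  have hfreq : ∃ᶠ t in 𝓝[>] T, y t < 0 := by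
    rw [frequently_iff]
    intro U hU
    obtain ⟨δ, hδ, hU⟩ := mem_nhdsGT_iff_exists_Ioo_subset.1 hU
    obtain ⟨t, ht, htδ⟩ := exists_lt_of_csInf_lt hne (hδ : T < δ)
    have h1 : T ≤ t := csInf_le hbdd ht
    refine ⟨t, hU ⟨h1.lt_of_ne ?_, htδ⟩, ht.2⟩
    rintro h
    rw [h] at hyT0
    exact absurd ht.2 (not_lt.2 hyT0)
  have hyT : y T = 0 := by
    refine le_antisymm ?_ hyT0
    by_contra hpos
    have := (hcont.mono_left nhdsWithin_le_nhds : Tendsto y (𝓝[>] T) _).eventually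
      (lt_mem_nhds (not_le.1 hpos))
    obtain ⟨t, h1, h2⟩ := (hfreq.and_eventually this).exists
    exact absurd h1 (not_lt.2 h2.le)
  refine ⟨T, hTm, fun t ht => ?_, hyT, ?_⟩
  · rcases ht.2.eq_or_lt with h | h
    · rw [h, hyT]
    · exact hlt t ht.1 h
  · by_contra hpos
    have h1 := ((hasDerivAt_iff_tendsto_slope.1 (hy T hTm)).mono_left
      (nhdsWithin_mono T fun t (ht : T < t) => ht.ne')).eventually (lt_mem_nhds (not_le.1 hpos))
    obtain ⟨t, ⟨h2, h3⟩, h4⟩ := ((hfreq.and_eventually h1).and_eventually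
      self_mem_nhdsWithin).exists
    rw [slope_def_field, hyT, sub_zero, div_pos_iff_of_pos_right (sub_pos.2 h4)] at h3
    exact absurd h2 (not_lt.2 h3.le)

end RealLine

section GeodesicFlow

open Filter Topology Metric

variable {d : ℕ} [NeZero d] {M : Type*} [TopologicalSpace M] [ChartedSpace (EuclideanHalfSpace d) M]
  [IsManifold (𝓡∂ d) ∞ M] [RiemannianBundle (fun x : M => TangentSpace (𝓡∂ d) x)]

/-- The geodesic flow in a chart near the point `q₀` of `TM`, extended across the boundary of the
half space. The acceleration `a` is the extension of `-Γ(v, v)`. -/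
structure GeodesicFlow (x₀ : M) (q₀ : Euc d × Euc d) (N : ℕ) where
  /-- The acceleration. -/
  a : Euc d × Euc d → Euc d
  /-- The flow. -/
  φ : (Euc d × Euc d) × ℝ → Euc d × Euc d
  /-- The radius of the ball of initial points, and of the time interval. -/
  r : ℝ
  r_pos : 0 < r
  contDiff_a : ContDiff ℝ N a
  a_base : a q₀ = -christoffelMap x₀ q₀.1 q₀.2 q₀.2
  contDiffAt : ContDiffAt ℝ N φ (q₀, 0)
  zero : ∀ q ∈ ball q₀ r, φ (q, 0) = q
  hasDerivAt : ∀ q ∈ ball q₀ r, ∀ t ∈ Ioo (-r) r,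
    HasDerivAt (fun t => φ (q, t)) ((φ (q, t)).2, a (φ (q, t))) t
  mem_target : ∀ q ∈ ball q₀ r, ∀ t ∈ Ioo (-r) r, 0 ≤ (φ (q, t)).1 0 →
    (φ (q, t)).1 ∈ (extChartAt (𝓡∂ d) x₀).target
  eq_spray : ∀ q ∈ ball q₀ r, ∀ t ∈ Ioo (-r) r, 0 ≤ (φ (q, t)).1 0 →
    ((φ (q, t)).2, a (φ (q, t))) = spray x₀ (φ (q, t))

theorem GeodesicFlow.base {x₀ : M} {q₀ : Euc d × Euc d} {N : ℕ} (g : GeodesicFlow x₀ q₀ N) :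
    g.φ (q₀, 0) = q₀ :=
  g.zero q₀ (mem_ball_self g.r_pos)

theorem GeodesicFlow.hasDerivAt_zero {x₀ : M} {q₀ : Euc d × Euc d} {N : ℕ}
    (g : GeodesicFlow x₀ q₀ N) {q : Euc d × Euc d} (hq : q ∈ ball q₀ g.r) {t : ℝ}
    (ht : t ∈ Ioo (-g.r) g.r) :
    HasDerivAt (fun t => (g.φ (q, t)).1 0) ((g.φ (q, t)).2 0) t := by
  have h := (EuclideanSpace.proj 0 : Euc d →L[ℝ] ℝ).hasFDerivAt.comp_hasDerivAt t
    (g.hasDerivAt q hq t ht).fst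
  exact h

theorem sphereBundle_ext_coords {x₀ : M} {p p' : SphereBundle d M}
    (hp : p.1.1 ∈ (extChartAt (𝓡∂ d) x₀).source) (hp' : p'.1.1 ∈ (extChartAt (𝓡∂ d) x₀).source)
    (h : coords x₀ p.1 = coords x₀ p'.1) : p = p' := by
  apply Subtype.ext
  rw [← ofCoords_coords hp, h, ofCoords_coords hp']

theorem mem_outwardBoundary_of_coords {x₀ : M} {p : SphereBundle d M}
    (hp : p.1.1 ∈ (extChartAt (𝓡∂ d) x₀).source) (h0 : (coords x₀ p.1).1 0 = 0)
    (h1 : (coords x₀ p.1).2 0 ≤ 0) : p ∈ outwardBoundary d M := by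
  have hb := (mem_boundary_iff hp).2 h0
  exact mem_outwardBoundary_iff.2
    ⟨hb, componentsAt_zero_nonpos hp (mem_extChartAt_source _) hb h1⟩

variable [IsContMDiffRiemannianBundle (𝓡∂ d) ∞ (EuclideanSpace ℝ (Fin d))
      (fun x : M => TangentSpace (𝓡∂ d) x)]

/-- The acceleration of the geodesic equation in a chart has `C^N` extensions. -/
theorem exists_extension_spray (x₀ : M) {q₀ : Euc d × Euc d}
    (hq₀ : q₀.1 ∈ (extChartAt (𝓡∂ d) x₀).target) (N : ℕ) :
    ∃ a : Euc d × Euc d → Euc d, ContDiff ℝ N a ∧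
      ∀ᶠ q in 𝓝[range (𝓡∂ d) ×ˢ univ] q₀, (q.2, a q) = spray x₀ q := by
  set H : Set (Euc d × Euc d) := range (𝓡∂ d) ×ˢ univ with hH
  let ℓ : Euc d × Euc d →L[ℝ] ℝ :=
    (EuclideanSpace.proj 0 : Euc d →L[ℝ] ℝ).comp (ContinuousLinearMap.fst ℝ (Euc d) (Euc d))
  have hHℓ : H = {q | 0 ≤ ℓ q} := by
    ext q
    rw [hH, mem_prod, mem_range_iff]
    exact ⟨fun h => h.1, fun h => ⟨h, mem_univ _⟩⟩
  have hq₀H : q₀ ∈ H := ⟨extChartAt_target_subset_range x₀ hq₀, mem_univ _⟩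
  have hs : ContDiffWithinAt ℝ N (fun q => (spray x₀ q).2) {q | 0 ≤ ℓ q} q₀ := by
    rw [← hHℓ]
    exact ((contDiffWithinAt_spray x₀ hq₀).of_le (by exact_mod_cast le_top)).snd
  obtain ⟨a, ha, has⟩ := exists_contDiff_eventuallyEq_halfSpace ℓ
    (e := (EuclideanSpace.single 0 1, 0)) (by simp [ℓ]) hs (by rw [hHℓ] at hq₀H; exact hq₀H)
  rw [← hHℓ] at has
  exact ⟨a, ha, has.mono fun q hq => Prod.ext rfl hq⟩

theorem nonempty_geodesicFlow (x₀ : M) {q₀ : Euc d × Euc d}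
    (hq₀ : q₀.1 ∈ (extChartAt (𝓡∂ d) x₀).target) {N : ℕ} (hN : N ≠ 0) :
    Nonempty (GeodesicFlow x₀ q₀ N) := by
  set H : Set (Euc d × Euc d) := range (𝓡∂ d) ×ˢ univ with hH
  have hq₀H : q₀ ∈ H := ⟨extChartAt_target_subset_range x₀ hq₀, mem_univ _⟩
  obtain ⟨a, ha, has⟩ := exists_extension_spray x₀ hq₀ N
  have hV : ContDiff ℝ N (fun q : Euc d × Euc d => (q.2, a q)) := contDiff_snd.prodMk ha
  obtain ⟨φ, hφ, r, hr, hflow⟩ := exists_contDiffAt_flow hN hV q₀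
  have hφ0 : φ (q₀, 0) = q₀ := (hflow q₀ (mem_ball_self hr)).1
  have hev : ∀ᶠ x in 𝓝 (q₀, (0 : ℝ)), φ x ∈ H →
      (φ x).1 ∈ (extChartAt (𝓡∂ d) x₀).target ∧ ((φ x).2, a (φ x)) = spray x₀ (φ x) := by
    have h1 := eventually_nhdsWithin_iff.1 ((mem_nhdsWithin_target hq₀).and has)
    have h2 := hφ.continuousAt
    rw [ContinuousAt, hφ0] at h2
    exact h2.eventually h1
  obtain ⟨r', hr', hball⟩ := Metric.eventually_nhds_iff_ball.1 hev
  have hmem : ∀ q ∈ ball q₀ (min r r'), ∀ t ∈ Ioo (-(min r r')) (min r r'),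
      0 ≤ (φ (q, t)).1 0 → (φ (q, t)).1 ∈ (extChartAt (𝓡∂ d) x₀).target ∧
        ((φ (q, t)).2, a (φ (q, t))) = spray x₀ (φ (q, t)) := by
    intro q hq t ht h0
    refine hball (q, t) ?_ ⟨mem_range_iff.2 h0, mem_univ _⟩
    rw [mem_ball, Prod.dist_eq, max_lt_iff]
    refine ⟨(mem_ball.1 hq).trans_le (min_le_right _ _), ?_⟩
    rw [Real.dist_eq, sub_zero, abs_lt]
    exact ⟨(neg_le_neg (min_le_right _ _)).trans_lt ht.1, ht.2.trans_le (min_le_right _ _)⟩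
  have hsub : ball q₀ (min r r') ⊆ ball q₀ r := ball_subset_ball (min_le_left _ _)
  have hsub' : Ioo (-(min r r')) (min r r') ⊆ Ioo (-r) r :=
    Ioo_subset_Ioo (neg_le_neg (min_le_left _ _)) (min_le_left _ _)
  exact ⟨{
    a := a
    φ := φ
    r := min r r'
    r_pos := lt_min hr hr'
    contDiff_a := ha
    a_base := congrArg Prod.snd (has.self_of_nhdsWithin hq₀H)
    contDiffAt := hφ
    zero := fun q hq => (hflow q (hsub hq)).1
    hasDerivAt := fun q hq t ht => (hflow q (hsub hq)).2 t (hsub' ht)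
    mem_target := fun q hq t ht h0 => (hmem q hq t ht h0).1
    eq_spray := fun q hq t ht h0 => (hmem q hq t ht h0).2 }⟩

/-- A solution of the geodesic equation in a chart with initial speed `1` is an orbit in `SM`. -/
theorem exists_isGeodesicOn_of_coords {x₀ : M} {q : ℝ → Euc d × Euc d} {s₁ s₂ t₀ : ℝ}
    (ht₀ : t₀ ∈ Icc s₁ s₂) (hq : ∀ t ∈ Icc s₁ s₂, (q t).1 ∈ (extChartAt (𝓡∂ d) x₀).target)
    (hd : ∀ t ∈ Icc s₁ s₂, HasDerivWithinAt q (spray x₀ (q t)) (Icc s₁ s₂) t)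
    (h1 : q t₀ ∈ unitSet x₀) :
    (∀ t ∈ Icc s₁ s₂, q t ∈ unitSet x₀) ∧ ∃ c : ℝ → SphereBundle d M, IsGeodesicOn c (Icc s₁ s₂) ∧
      ∀ t ∈ Icc s₁ s₂, (c t).1.1 ∈ (extChartAt (𝓡∂ d) x₀).source ∧ coords x₀ (c t).1 = q t := by
  have hunit : ∀ t ∈ Icc s₁ s₂, q t ∈ unitSet x₀ := fun t ht => ⟨hq t ht, by
    rw [metricForm_eq_of_hasDerivWithinAt (convex_Icc s₁ s₂) hq hd ht ht₀]
    exact h1.2⟩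
  refine ⟨hunit, ?_⟩
  have hle : s₁ ≤ s₂ := ht₀.1.trans ht₀.2
  let q' : ℝ → Euc d × Euc d := fun t => q (projIcc s₁ s₂ hle t)
  have hqq' : EqOn q' q (Icc s₁ s₂) := fun t ht => by
    simp only [q', projIcc_of_mem hle ht]
  have hmem : ∀ t, q' t ∈ unitSet x₀ := fun t => hunit _ (projIcc s₁ s₂ hle t).2
  refine ⟨fun t => ⟨ofCoords x₀ (q' t), (ofCoords_mem_sphereSet_iff (hmem t).1).2 (hmem t)⟩, ?_, ?_⟩
  · refine isMIntegralCurveOn_ofCoords (fun t _ => (hmem t).1) fun t ht => ?_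
    rw [hqq' ht]
    exact (hd t ht).congr hqq' (hqq' ht)
  · intro t ht
    refine ⟨(extChartAt (𝓡∂ d) x₀).map_target (hmem t).1, ?_⟩
    rw [← hqq' ht]
    exact coords_ofCoords (hmem t).1

/-- As long as it stays in the half space, the extended flow is the geodesic flow. -/
theorem GeodesicFlow.exists_isGeodesicOn {x₀ : M} {q₀ : Euc d × Euc d} {N : ℕ}
    (g : GeodesicFlow x₀ q₀ N) {q : Euc d × Euc d} (hq : q ∈ ball q₀ g.r) (hqu : q ∈ unitSet x₀)
    {s₁ s₂ : ℝ} (hs₁ : -g.r < s₁) (hs₂ : s₂ < g.r) (h0 : (0 : ℝ) ∈ Icc s₁ s₂)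
    (hpos : ∀ s ∈ Icc s₁ s₂, 0 ≤ (g.φ (q, s)).1 0) :
    (∀ s ∈ Icc s₁ s₂, g.φ (q, s) ∈ unitSet x₀) ∧
      ∃ c : ℝ → SphereBundle d M, IsGeodesicOn c (Icc s₁ s₂) ∧
        ∀ s ∈ Icc s₁ s₂, (c s).1.1 ∈ (extChartAt (𝓡∂ d) x₀).source ∧
          coords x₀ (c s).1 = g.φ (q, s) := by
  have hs : ∀ s ∈ Icc s₁ s₂, s ∈ Ioo (-g.r) g.r := fun s hs =>
    ⟨hs₁.trans_le hs.1, hs.2.trans_lt hs₂⟩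
  refine exists_isGeodesicOn_of_coords h0 (fun s h => g.mem_target q hq s (hs s h) (hpos s h))
    (fun s h => ?_) (by rw [g.zero q hq]; exact hqu)
  rw [← g.eq_spray q hq s (hs s h) (hpos s h)]
  exact (g.hasDerivAt q hq s (hs s h)).hasDerivWithinAt

/-- Near each point of `SM`, geodesics exist for a uniform time, unless they reach the boundary in
an outward direction before. -/
theorem eventually_exists_isGeodesicOn (p₀ : SphereBundle d M) : ∃ ε > 0, ∀ᶠ P in 𝓝 p₀.1,
    ∀ p : SphereBundle d M, p.1 = P →
      (∃ c : ℝ → SphereBundle d M, c 0 = p ∧ IsGeodesicOn c (Icc 0 ε)) ∨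
      ∃ T ∈ Icc 0 ε, ∃ c : ℝ → SphereBundle d M, c 0 = p ∧ IsGeodesicOn c (Icc 0 T) ∧
        c T ∈ outwardBoundary d M := by
  set x₀ := p₀.1.1
  have hx₀ := mem_extChartAt_source (I := 𝓡∂ d) x₀
  obtain ⟨g⟩ := nonempty_geodesicFlow x₀ (q₀ := coords x₀ p₀.1)
    ((extChartAt (𝓡∂ d) x₀).map_source hx₀) one_ne_zero
  have hr := g.r_pos
  refine ⟨g.r / 2, half_pos hr, ?_⟩
  have hnear : {p : TangentBundle (𝓡∂ d) M | p.1 ∈ (extChartAt (𝓡∂ d) x₀).source} ∈ 𝓝 p₀.1 :=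
    (FiberBundle.continuous_proj (Euc d) (TangentSpace (𝓡∂ d))).continuousAt.preimage_mem_nhds
      (extChartAt_source_mem_nhds' hx₀)
  filter_upwards [hnear, (continuousAt_coords hx₀).eventually (ball_mem_nhds _ hr)]
    with P hP1 hP2 p hpP
  subst hpP
  set q := coords x₀ p.1
  have hqu : q ∈ unitSet x₀ := coords_mem_unitSet hP1
  have hlt : ∀ t ∈ Icc 0 (g.r / 2), t ∈ Ioo (-g.r) g.r := fun t ht =>
    ⟨by linarith [ht.1], by linarith [ht.2]⟩
  have hφ0 : g.φ (q, 0) = q := g.zero q hP2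
  have hgeo : ∀ T ∈ Icc 0 (g.r / 2), (∀ t ∈ Icc 0 T, 0 ≤ (g.φ (q, t)).1 0) →
      ∃ c : ℝ → SphereBundle d M, c 0 = p ∧ IsGeodesicOn c (Icc 0 T) ∧
        (c T).1.1 ∈ (extChartAt (𝓡∂ d) x₀).source ∧ coords x₀ (c T).1 = g.φ (q, T) := by
    intro T hT hpos
    have h0T : (0 : ℝ) ∈ Icc 0 T := left_mem_Icc.2 hT.1
    obtain ⟨-, c, hc, hcq⟩ := g.exists_isGeodesicOn hP2 hqu (s₁ := 0) (s₂ := T) (by linarith)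
      (by linarith [hT.2]) h0T hpos
    refine ⟨c, sphereBundle_ext_coords (hcq 0 h0T).1 hP1 ?_, hc, hcq T (right_mem_Icc.2 hT.1)⟩
    rw [(hcq 0 h0T).2, hφ0]
  rcases nonneg_or_exists_first_exit (fun t ht => g.hasDerivAt_zero hP2 (hlt t ht))
    (by rw [hφ0]; exact extChartAt_zero_nonneg x₀ _) with h | ⟨T, hT, hpos, hyT, hvT⟩
  · obtain ⟨c, hc0, hc, -⟩ := hgeo _ (right_mem_Icc.2 (half_pos hr).le) h
    exact Or.inl ⟨c, hc0, hc⟩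
  · obtain ⟨c, hc0, hc, hcT, hcq⟩ := hgeo T hT hpos
    refine Or.inr ⟨T, hT, c, hc0, hc, mem_outwardBoundary_of_coords hcT ?_ ?_⟩
    · rw [hcq, hyT]
    · rw [hcq]; exact hvT

end GeodesicFlow


/-! ### Uniqueness of geodesics and of their exit points -/

section RealLine

open Filter Topology

/-- A nonnegative function on an interval that vanishes at the left end cannot start with
nonpositive velocity if it has negative acceleration there whenever the velocity vanishes. -/
theorem not_nonneg_of_deriv_nonpos {y v : ℝ → ℝ} {a b w : ℝ} (hab : a < b)
    (hy : ∀ t ∈ Icc a b, HasDerivWithinAt y (v t) (Icc a b) t)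
    (hv : HasDerivWithinAt v w (Icc a b) a) (hpos : ∀ t ∈ Icc a b, 0 ≤ y t) (hya : y a = 0)
    (hva : v a ≤ 0) (hw : v a = 0 → w < 0) : False := by
  have ha : a ∈ Icc a b := left_mem_Icc.2 hab.le
  have hIoo : Ioo a b ∈ 𝓝[>] a := Ioo_mem_nhdsGT hab
  have hle : 𝓝[>] a ≤ 𝓝[Icc a b \ {a}] a := by
    refine nhdsWithin_le_iff.2 ?_
    filter_upwards [hIoo] with t ht
    exact ⟨Ioo_subset_Icc_self ht, ht.1.ne'⟩
  have hva0 : v a = 0 := by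
    refine le_antisymm hva ?_
    have h := (hasDerivWithinAt_iff_tendsto_slope.1 (hy a ha)).mono_left hle
    refine ge_of_tendsto h ?_
    filter_upwards [hIoo] with t ht
    rw [slope_def_field, hya, sub_zero]
    exact div_nonneg (hpos t (Ioo_subset_Icc_self ht)) (sub_nonneg.2 ht.1.le)
  have hneg : ∀ᶠ t in 𝓝[>] a, v t < 0 := by
    have h := ((hasDerivWithinAt_iff_tendsto_slope.1 hv).mono_left hle).eventually
      (gt_mem_nhds (hw hva0))
    filter_upwards [h, hIoo] with t ht ht'
    rw [slope_def_field, hva0, sub_zero] at ht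
    by_contra hcon
    exact absurd ht (not_lt.2 (div_nonneg (not_lt.1 hcon) (sub_nonneg.2 ht'.1.le)))
  obtain ⟨δ, hδ, hsub⟩ := mem_nhdsGT_iff_exists_Ioo_subset.1 (inter_mem hneg hIoo)
  obtain ⟨t, ht⟩ := exists_between (show a < δ from hδ)
  have hmem : ∀ s ∈ Ioc a t, v s < 0 ∧ s ∈ Ioo a b := fun s hs =>
    hsub ⟨hs.1, hs.2.trans_lt ht.2⟩
  have htb : t < b := (hmem t ⟨ht.1, le_rfl⟩).2.2
  obtain ⟨s, hs, hslope⟩ := exists_hasDerivAt_eq_slope y v ht.1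
    (fun s hs => ((hy s ⟨hs.1, hs.2.trans htb.le⟩).continuousWithinAt).mono
      (Icc_subset_Icc_right htb.le))
    (fun s hs => (hy s ⟨hs.1.le, (hs.2.trans htb).le⟩).hasDerivAt
      (Icc_mem_nhds hs.1 (hs.2.trans htb)))
  have h1 := (hmem s ⟨hs.1, hs.2.le⟩).1
  rw [hslope, hya, sub_zero] at h1
  exact absurd h1 (not_lt.2 (div_nonneg (hpos t ⟨ht.1.le, htb.le⟩) (sub_nonneg.2 ht.1.le)))

end RealLine

section GlueCurves

open Filter Topology

variable {d : ℕ} [NeZero d] {M : Type*} [TopologicalSpace M] [ChartedSpace (EuclideanHalfSpace d) M]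
  [IsManifold (𝓡∂ d) ∞ M] [RiemannianBundle (fun x : M => TangentSpace (𝓡∂ d) x)]

theorem IsGeodesicOn.mono {c : ℝ → SphereBundle d M} {s t : Set ℝ} (hc : IsGeodesicOn c s)
    (hts : t ⊆ s) : IsGeodesicOn c t :=
  IsMIntegralCurveOn.mono hc hts

theorem IsGeodesicOn.comp_add {c : ℝ → SphereBundle d M} {s : Set ℝ} (hc : IsGeodesicOn c s)
    (τ : ℝ) : IsGeodesicOn (fun t => c (t + τ)) {t | t + τ ∈ s} :=
  IsMIntegralCurveOn.comp_add hc τ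

theorem IsGeodesicOn.congr {c c' : ℝ → SphereBundle d M} {s : Set ℝ} (hc : IsGeodesicOn c s)
    (h : EqOn c' c s) : IsGeodesicOn c' s := by
  intro t ht
  have h1 := hc t ht
  have h2 : HasMFDerivWithinAt 𝓘(ℝ, ℝ) (𝓡∂ d).tangent (fun t => (c' t).1) s t
      ((1 : ℝ →L[ℝ] ℝ).smulRight (geodesicField (c t).1)) :=
    h1.congr_of_eventuallyEq (eventually_nhdsWithin_of_forall fun t' ht' =>
      congrArg Subtype.val (h ht')) (congrArg Subtype.val (h ht))
  rw [← h ht] at h2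
  exact h2

/-- Two orbits, one starting where the other one ends, make up one orbit. -/
theorem IsGeodesicOn.glue {c c' : ℝ → SphereBundle d M} {a b e : ℝ} (hab : a ≤ b) (hbe : b ≤ e)
    (hc : IsGeodesicOn c (Icc a b)) (hc' : IsGeodesicOn c' (Icc b e)) (h : c b = c' b) :
    IsGeodesicOn (fun t => if t ≤ b then c t else c' t) (Icc a e) := by
  set k : ℝ → SphereBundle d M := fun t => if t ≤ b then c t else c' t with hk
  have h1 : IsGeodesicOn k (Icc a b) := hc.congr fun t ht => by simp [hk, ht.2]
  have h2 : IsGeodesicOn k (Icc b e) := hc'.congr fun t ht => by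
    rcases ht.1.eq_or_lt with h' | h'
    · simp [hk, ← h', h]
    · simp [hk, not_le.2 h']
  intro t ht
  rcases lt_trichotomy t b with htb | htb | htb
  · refine (h1 t ⟨ht.1, htb.le⟩).mono_of_mem_nhdsWithin ?_
    filter_upwards [self_mem_nhdsWithin, nhdsWithin_le_nhds (Iio_mem_nhds htb)] with s hs hs'
    exact ⟨hs.1, (hs' : s < b).le⟩
  · have := (h1 t ⟨ht.1, htb.le⟩).union (h2 t ⟨htb.ge, ht.2⟩)
    rwa [Icc_union_Icc_eq_Icc hab hbe] at this
  · refine (h2 t ⟨htb.le, ht.2⟩).mono_of_mem_nhdsWithin ?_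
    filter_upwards [self_mem_nhdsWithin, nhdsWithin_le_nhds (Ioi_mem_nhds htb)] with s hs hs'
    exact ⟨(hs' : b < s).le, hs.2⟩

/-- A geodesic of length `T` prolonged by one of length `T'` issued from its end point. -/
theorem IsGeodesicOn.exists_concat {c c' : ℝ → SphereBundle d M} {a b T : ℝ} (hab : a ≤ b)
    (hT : 0 ≤ T) (hc : IsGeodesicOn c (Icc a b)) (hc' : IsGeodesicOn c' (Icc 0 T))
    (h : c' 0 = c b) :
    ∃ k : ℝ → SphereBundle d M, IsGeodesicOn k (Icc a (b + T)) ∧ EqOn k c (Icc a b) ∧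
      k (b + T) = c' T := by
  have h2 : IsGeodesicOn (fun t => c' (t + -b)) (Icc b (b + T)) :=
    (hc'.comp_add (-b)).mono fun t ht => ⟨by linarith [ht.1], by linarith [ht.2]⟩
  refine ⟨_, hc.glue hab (by linarith) h2 (by simp [h]), fun t ht => by simp [ht.2], ?_⟩
  rcases hT.eq_or_lt with h' | h'
  · simp [← h', h]
  · simp [h']

theorem isGeodesicOn_singleton (p : SphereBundle d M) :
    IsGeodesicOn (fun _ => p) (Icc 0 (0 : ℝ)) := by
  intro t ht
  refine ⟨(continuousWithinAt_const : ContinuousWithinAt (fun _ : ℝ => p.1) (Icc 0 0) t), ?_⟩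
  refine HasFDerivWithinAt.of_subsingleton (𝕜 := ℝ) (E := ℝ) (F := Euc d × Euc d) ?_
  rintro x ⟨⟨h1, h2⟩, -⟩ y ⟨⟨h3, h4⟩, -⟩
  exact (le_antisymm h2 h1).trans (le_antisymm h4 h3).symm

end GlueCurves

section GeodesicUniqueness

open Filter Topology

variable {d : ℕ} [NeZero d] {M : Type*} [TopologicalSpace M] [ChartedSpace (EuclideanHalfSpace d) M]
  [IsManifold (𝓡∂ d) ∞ M]

theorem tangentBundle_eq_of_ultrafilter_le [T2Space M] {p p' : TangentBundle (𝓡∂ d) M}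
    {f : Ultrafilter (TangentBundle (𝓡∂ d) M)} (h : ↑f ≤ 𝓝 p) (h' : ↑f ≤ 𝓝 p') : p = p' := by
  have hproj := FiberBundle.continuous_proj (Euc d) (TangentSpace (𝓡∂ d) (M := M))
  have hb : p.1 = p'.1 := tendsto_nhds_unique (f := fun q : TangentBundle (𝓡∂ d) M => q.1)
    ((hproj.tendsto p).mono_left h) ((hproj.tendsto p').mono_left h')
  have hp : p.1 ∈ (extChartAt (𝓡∂ d) p.1).source := mem_extChartAt_source _
  have hp' : p'.1 ∈ (extChartAt (𝓡∂ d) p.1).source := by rw [← hb]; exact hp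
  have hc : coords p.1 p = coords p.1 p' := tendsto_nhds_unique (f := coords p.1)
    ((continuousAt_coords hp).mono_left h) ((continuousAt_coords hp').mono_left h')
  rw [← ofCoords_coords hp, hc, ofCoords_coords hp']

/-- `TM` is Hausdorff, so that the set of times at which two geodesics agree is closed. -/
instance [T2Space M] : T2Space (TangentBundle (𝓡∂ d) M) :=
  t2_iff_ultrafilter.2 fun _ h h' => tangentBundle_eq_of_ultrafilter_le h h'

variable [RiemannianBundle (fun x : M => TangentSpace (𝓡∂ d) x)]

theorem IsGeodesicOn.continuousOn {c : ℝ → SphereBundle d M} {s : Set ℝ} (hc : IsGeodesicOn c s) :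
    ContinuousOn (fun t => (c t).1) s := fun t ht => (hc t ht).1

theorem IsGeodesicOn.eventually_mem_source {c : ℝ → SphereBundle d M} {s : Set ℝ}
    (hc : IsGeodesicOn c s) {t : ℝ} (ht : t ∈ s) {x₀ : M}
    (h : (c t).1.1 ∈ (extChartAt (𝓡∂ d) x₀).source) :
    ∀ᶠ t' in 𝓝[s] t, (c t').1.1 ∈ (extChartAt (𝓡∂ d) x₀).source :=
  ((FiberBundle.continuous_proj (Euc d)
    (TangentSpace (𝓡∂ d))).continuousAt.comp_continuousWithinAt
      (hc.continuousOn t ht)).preimage_mem_nhdsWithin (extChartAt_source_mem_nhds' h)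

variable [IsContMDiffRiemannianBundle (𝓡∂ d) ∞ (EuclideanSpace ℝ (Fin d))
      (fun x : M => TangentSpace (𝓡∂ d) x)]

/-- Geodesics are determined by their initial vectors. -/
theorem IsGeodesicOn.eqOn [T2Space M] {c c' : ℝ → SphereBundle d M} {a b : ℝ}
    (hc : IsGeodesicOn c (Icc a b)) (hc' : IsGeodesicOn c' (Icc a b)) (h : c a = c' a) :
    EqOn c c' (Icc a b) := by
  have hclosed : IsClosed ({t | (c t).1 = (c' t).1} ∩ Icc a b) := by
    rw [inter_comm]
    exact (hc.continuousOn.prodMk hc'.continuousOn).preimage_isClosed_of_isClosed isClosed_Icc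
      isClosed_diagonal
  have hsub := hclosed.Icc_subset_of_forall_mem_nhdsWithin (congrArg Subtype.val h) ?_
  · exact fun t ht => Subtype.ext (hsub ht)
  rintro t ⟨ht, htab⟩
  have htI : t ∈ Icc a b := Ico_subset_Icc_self htab
  set x₀ := (c t).1.1
  have hsrc : (c t).1.1 ∈ (extChartAt (𝓡∂ d) x₀).source := mem_extChartAt_source _
  have hsrc' : (c' t).1.1 ∈ (extChartAt (𝓡∂ d) x₀).source := by
    rw [← show (c t).1 = (c' t).1 from ht]; exact hsrc
  obtain ⟨A, hA, hAs⟩ := exists_extension_spray x₀ (q₀ := coords x₀ (c t).1)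
    ((extChartAt (𝓡∂ d) x₀).map_source hsrc) 1
  have hnear : ∀ k : ℝ → SphereBundle d M, IsGeodesicOn k (Icc a b) → (k t).1 = (c t).1 →
      ∀ᶠ s in 𝓝[Icc a b] t, (k s).1.1 ∈ (extChartAt (𝓡∂ d) x₀).source ∧
        ((coords x₀ (k s).1).2, A (coords x₀ (k s).1)) = spray x₀ (coords x₀ (k s).1) := by
    intro k hk hkt
    have hks : (k t).1.1 ∈ (extChartAt (𝓡∂ d) x₀).source := by rw [hkt]; exact hsrc
    have htend : Tendsto (fun s => coords x₀ (k s).1) (𝓝[Icc a b] t)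
        (𝓝[range (𝓡∂ d) ×ˢ univ] (coords x₀ (c t).1)) := by
      refine tendsto_nhdsWithin_of_tendsto_nhds_of_eventually_within _ ?_
        (Eventually.of_forall fun s => ⟨extChartAt_mem_range x₀ _, mem_univ _⟩)
      rw [← hkt]
      exact ContinuousAt.comp_continuousWithinAt (g := coords x₀) (f := fun s => (k s).1)
        (continuousAt_coords hks) (hk.continuousOn t htI)
    exact (hk.eventually_mem_source htI hks).and (htend hAs)
  obtain ⟨δ, hδ, hδsub⟩ := Metric.mem_nhdsWithin_iff.1 ((hnear c hc rfl).and (hnear c' hc' ht.symm))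
  set e := min b (t + δ / 2) with he
  have hte : t < e := lt_min htab.2 (by linarith)
  have hsubI : Icc t e ⊆ Icc a b := Icc_subset_Icc htab.1 (min_le_left _ _)
  have hgood : ∀ s ∈ Icc t e, s ∈ Metric.ball t δ ∩ Icc a b := fun s hs => ⟨by
    rw [Metric.mem_ball, Real.dist_eq, abs_lt]
    have := hs.2.trans (min_le_right _ _)
    constructor <;> linarith [hs.1], hsubI hs⟩
  have heq := eqOn_Icc_of_contDiff (V := fun q : Euc d × Euc d => (q.2, A q))
    (contDiff_snd.prodMk hA) (left_mem_Icc.2 hte.le) (f := fun s => coords x₀ (c s).1)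
    (g := fun s => coords x₀ (c' s).1)
    (fun s hs => by
      have h1 := (hδsub (hgood s hs)).1
      rw [h1.2]
      exact (hasDerivWithinAt_coords hc (hsubI hs) h1.1).mono hsubI)
    (fun s hs => by
      have h1 := (hδsub (hgood s hs)).2
      rw [h1.2]
      exact (hasDerivWithinAt_coords hc' (hsubI hs) h1.1).mono hsubI)
    (by rw [show (c t).1 = (c' t).1 from ht])
  filter_upwards [Ioo_mem_nhdsGT hte] with s hs
  have hs' := hgood s (Ioo_subset_Icc_self hs)
  have := heq (Ioo_subset_Icc_self hs)
  exact congrArg Subtype.val (sphereBundle_ext_coords (hδsub hs').1.1 (hδsub hs').2.1 this)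

/-- If the boundary is strictly convex, a geodesic cannot be continued beyond a boundary point where
it is directed outwards or tangent to the boundary. -/
theorem IsGeodesicOn.not_mem_outwardBoundary (hconvex : StrictlyConvexBoundary d M)
    {c : ℝ → SphereBundle d M} {a b : ℝ} (hab : a < b) (hc : IsGeodesicOn c (Icc a b)) :
    c a ∉ outwardBoundary d M := by
  intro hout
  rw [mem_outwardBoundary_iff] at hout
  set x₀ := (c a).1.1 with hx₀
  have ha : a ∈ Icc a b := left_mem_Icc.2 hab.le
  have hsrc : (c a).1.1 ∈ (extChartAt (𝓡∂ d) x₀).source := mem_extChartAt_source _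
  obtain ⟨δ, hδ, hδsub⟩ := Metric.mem_nhdsWithin_iff.1 (hc.eventually_mem_source ha hsrc)
  set e := min b (a + δ / 2) with he
  have hae : a < e := lt_min hab (by linarith)
  have hsubI : Icc a e ⊆ Icc a b := Icc_subset_Icc le_rfl (min_le_left _ _)
  have hd : ∀ s ∈ Icc a e, HasDerivWithinAt (fun t => coords x₀ (c t).1)
      (spray x₀ (coords x₀ (c s).1)) (Icc a e) s := by
    intro s hs
    refine (hasDerivWithinAt_coords hc (hsubI hs) (hδsub ⟨?_, hsubI hs⟩)).mono hsubI
    rw [Metric.mem_ball, Real.dist_eq, abs_lt]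
    have := hs.2.trans (min_le_right _ _)
    constructor <;> linarith [hs.1]
  have hproj : ∀ {f : ℝ → Euc d} {f' : Euc d} {s : Set ℝ} {t : ℝ}, HasDerivWithinAt f f' s t →
      HasDerivWithinAt (fun t => f t 0) (f' 0) s t := fun {f f' s t} h =>
    (EuclideanSpace.proj 0 : Euc d →L[ℝ] ℝ).hasFDerivAt.comp_hasDerivWithinAt t h
  refine not_nonneg_of_deriv_nonpos hae (y := fun t => (coords x₀ (c t).1).1 0)
    (v := fun t => (coords x₀ (c t).1).2 0) (fun t ht => hproj (hd t ht).fst)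
    (hproj (hd a (left_mem_Icc.2 hae.le)).snd) (fun t _ => extChartAt_zero_nonneg x₀ _)
    ((mem_boundary_iff hsrc).1 hout.1) hout.2 fun hv0 => ?_
  set v := (coords x₀ (c a).1).2 with hv
  have hvne : v ≠ 0 := by
    intro h0
    have h1 := (coords_mem_unitSet hsrc).2
    rw [← hv, h0] at h1
    simp at h1
  have := christoffelMap_zero_pos hconvex hout.1 hv0 hvne
  change (-christoffelMap x₀ _ v v) 0 < 0
  rw [PiLp.neg_apply, neg_lt_zero]
  exact this

end GeodesicUniqueness


/-! ### Geodesics reach the boundary -/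

section Compactness

open Filter Topology Metric

theorem exists_lower_bound_of_pos {E : Type*} [NormedAddCommGroup E] [NormedSpace ℝ E]
    [FiniteDimensional ℝ E] (B : E →L[ℝ] E →L[ℝ] ℝ) (hB : ∀ v, v ≠ 0 → 0 < B v v) :
    ∃ m > 0, ∀ v, m * ‖v‖ ^ 2 ≤ B v v := by
  rcases subsingleton_or_nontrivial E with h | h
  · exact ⟨1, one_pos, fun v => by simp [Subsingleton.elim v 0]⟩
  have hne : (sphere (0 : E) 1).Nonempty := NormedSpace.sphere_nonempty.2 zero_le_one
  have hcont : Continuous fun v => B v v := B.continuous.clm_apply continuous_id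
  obtain ⟨w, hw, hmin⟩ := (isCompact_sphere (0 : E) 1).exists_isMinOn hne hcont.continuousOn
  have hw1 : ‖w‖ = 1 := by simpa using hw
  refine ⟨B w w, hB w (norm_ne_zero_iff.1 (by rw [hw1]; exact one_ne_zero)), fun v => ?_⟩
  rcases eq_or_ne v 0 with rfl | hv
  · simp
  have hn := norm_pos_iff.2 hv
  have h1 : ‖v‖⁻¹ • v ∈ sphere (0 : E) 1 := by
    simp [norm_smul, hn.ne']
  have h2 : B w w ≤ B (‖v‖⁻¹ • v) (‖v‖⁻¹ • v) := hmin h1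
  simp only [map_smul, smul_apply, smul_eq_mul] at h2
  calc B w w * ‖v‖ ^ 2 ≤ (‖v‖⁻¹ * (‖v‖⁻¹ * B v v)) * ‖v‖ ^ 2 := by gcongr
    _ = B v v := by field_simp

variable {d : ℕ} [NeZero d] {M : Type*} [TopologicalSpace M] [ChartedSpace (EuclideanHalfSpace d) M]
  [IsManifold (𝓡∂ d) ∞ M] [RiemannianBundle (fun x : M => TangentSpace (𝓡∂ d) x)]
  [IsContMDiffRiemannianBundle (𝓡∂ d) ∞ (EuclideanSpace ℝ (Fin d))
      (fun x : M => TangentSpace (𝓡∂ d) x)]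

/-- The unit vectors over a neighbourhood of a point have bounded components. -/
theorem eventually_lower_bound_metricForm (x₀ : M) {y₀ : Euc d}
    (hy₀ : y₀ ∈ (extChartAt (𝓡∂ d) x₀).target) :
    ∃ m > 0, ∀ᶠ y in 𝓝[range (𝓡∂ d)] y₀, ∀ v, m * ‖v‖ ^ 2 ≤ metricForm x₀ y v v := by
  obtain ⟨m, hm, hB⟩ := exists_lower_bound_of_pos (metricForm x₀ y₀)
    fun v hv => metricForm_pos x₀ hy₀ hv
  have hc : ContinuousWithinAt (metricForm x₀) (range (𝓡∂ d)) y₀ :=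
    (contDiffWithinAt_metricForm x₀ hy₀).continuousWithinAt
  refine ⟨m / 2, half_pos hm, ?_⟩
  filter_upwards [hc.eventually (ball_mem_nhds _ (half_pos hm))] with y hy v
  rw [dist_eq_norm] at hy
  have h1 : |(metricForm x₀ y - metricForm x₀ y₀) v v| ≤ m / 2 * ‖v‖ ^ 2 := by
    have := (metricForm x₀ y - metricForm x₀ y₀).le_opNorm₂ v v
    rw [Real.norm_eq_abs] at this
    nlinarith [sq_nonneg ‖v‖]
  have h2 := neg_le_of_abs_le h1
  simp only [sub_apply] at h2
  linarith [hB v]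

/-- The unit sphere bundle of a compact manifold is compact, stated for ultrafilters. -/
theorem exists_le_nhds_of_ultrafilter [CompactSpace M] (f : Ultrafilter (SphereBundle d M)) :
    ∃ p : SphereBundle d M, Tendsto (fun p : SphereBundle d M => p.1) f (𝓝 p.1) := by
  obtain ⟨x₀, -, hx₀⟩ := isCompact_univ.ultrafilter_le_nhds
    (f.map fun p : SphereBundle d M => p.1.1) (by simp)
  have hb : Tendsto (fun p : SphereBundle d M => p.1.1) f (𝓝 x₀) := hx₀
  have hsrc := hb.eventually (extChartAt_source_mem_nhds (I := 𝓡∂ d) x₀)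
  set y₀ := extChartAt (𝓡∂ d) x₀ x₀
  have hy₀ : y₀ ∈ (extChartAt (𝓡∂ d) x₀).target := mem_extChartAt_target x₀
  have hy : Tendsto (fun p : SphereBundle d M => (coords x₀ p.1).1) f (𝓝[range (𝓡∂ d)] y₀) :=
    tendsto_nhdsWithin_of_tendsto_nhds_of_eventually_within _
      ((continuousAt_extChartAt x₀).tendsto.comp hb)
      (Eventually.of_forall fun p => extChartAt_mem_range x₀ _)
  obtain ⟨m, hm, hmB⟩ := eventually_lower_bound_metricForm x₀ hy₀
  have hbound : ∀ᶠ p : SphereBundle d M in f,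
      (coords x₀ p.1).2 ∈ closedBall (0 : Euc d) (Real.sqrt (1 / m)) := by
    filter_upwards [hy.eventually hmB, hsrc] with p hp1 hp2
    have h1 := hp1 (coords x₀ p.1).2
    rw [(coords_mem_unitSet hp2).2] at h1
    rw [mem_closedBall_zero_iff]
    refine Real.le_sqrt_of_sq_le ?_
    rw [le_div_iff₀ hm]
    linarith
  obtain ⟨v₀, -, hv₀⟩ := (isCompact_closedBall (0 : Euc d) (Real.sqrt (1 / m))).ultrafilter_le_nhds
    (f.map fun p : SphereBundle d M => (coords x₀ p.1).2) (le_principal_iff.2 hbound)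
  have hv : Tendsto (fun p : SphereBundle d M => (coords x₀ p.1).2) f (𝓝 v₀) := hv₀
  have hq : Tendsto (fun p : SphereBundle d M => coords x₀ p.1) f
      (𝓝[range (𝓡∂ d) ×ˢ univ] (y₀, v₀)) :=
    tendsto_nhdsWithin_of_tendsto_nhds_of_eventually_within _
      ((hy.mono_right nhdsWithin_le_nhds).prodMk_nhds hv)
      (Eventually.of_forall fun p => ⟨extChartAt_mem_range x₀ _, mem_univ _⟩)
  have hone : metricForm x₀ y₀ v₀ v₀ = 1 := by
    have hc : ContinuousWithinAt (fun q : Euc d × Euc d => metricForm x₀ q.1 q.2 q.2)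
        (range (𝓡∂ d) ×ˢ univ) (y₀, v₀) := by
      have h1 : ContinuousWithinAt (fun q : Euc d × Euc d => metricForm x₀ q.1)
          (range (𝓡∂ d) ×ˢ univ) (y₀, v₀) :=
        ContinuousWithinAt.comp (g := metricForm x₀) (t := range (𝓡∂ d))
          (contDiffWithinAt_metricForm x₀ hy₀).continuousWithinAt continuousWithinAt_fst
          (fun q hq => hq.1)
      exact (h1.clm_apply continuousWithinAt_snd).clm_apply continuousWithinAt_snd
    have h2 : Tendsto (fun p : SphereBundle d M =>
        metricForm x₀ (coords x₀ p.1).1 (coords x₀ p.1).2 (coords x₀ p.1).2) f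
        (𝓝 (metricForm x₀ y₀ v₀ v₀)) := hc.tendsto.comp hq
    refine tendsto_nhds_unique h2 (tendsto_const_nhds.congr' ?_)
    filter_upwards [hsrc] with p hp
    exact (coords_mem_unitSet hp).2.symm
  obtain ⟨p, hp, -⟩ := exists_eq_coords (q := (y₀, v₀)) ⟨hy₀, hone⟩
  refine ⟨p, ?_⟩
  rw [hp]
  refine ((continuousWithinAt_ofCoords (q := (y₀, v₀)) hy₀).tendsto.comp hq).congr' ?_
  filter_upwards [hsrc] with p hp
  exact ofCoords_coords hp

/-- In a nontrapping manifold every geodesic reaches the boundary in an outward direction. Otherwise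
geodesics defined almost up to the exit time would, near an accumulation point of their end points
in the compact space `SM`, be prolonged for a uniform time. -/
theorem exists_isGeodesicOn_outwardBoundary [CompactSpace M] (hnt : Nontrapping d M)
    (p : SphereBundle d M) : ∃ T ≥ 0, ∃ c : ℝ → SphereBundle d M, c 0 = p ∧
      IsGeodesicOn c (Icc 0 T) ∧ c T ∈ outwardBoundary d M := by
  by_contra hcon
  set K : Set ℝ := {T : ℝ | 0 ≤ T ∧ ∃ c : ℝ → SphereBundle d M, c 0 = p ∧ IsGeodesicOn c (Icc 0 T)}
  have hne : K.Nonempty := ⟨0, le_rfl, fun _ => p, rfl, isGeodesicOn_singleton p⟩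
  have hbdd : BddAbove K := by
    refine ⟨(exitTime p).toReal, fun T hT => ?_⟩
    have h1 : ENNReal.ofReal T ≤ exitTime p := le_iSup₂_of_le T hT le_rfl
    exact (ENNReal.ofReal_le_iff_le_toReal (hnt p).ne).1 h1
  obtain ⟨t, -, htend, htK⟩ := exists_seq_tendsto_sSup hne hbdd
  choose ht0 c hc0 hc using htK
  obtain ⟨q, hq⟩ := exists_le_nhds_of_ultrafilter ((hyperfilter ℕ).map fun n => c n (t n))
  obtain ⟨ε, hε, hloc⟩ := eventually_exists_isGeodesicOn q
  have h1 : ∀ᶠ n in (hyperfilter ℕ : Filter ℕ), ∀ p' : SphereBundle d M, p'.1 = (c n (t n)).1 → _ :=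
    (tendsto_map'_iff.1 hq).eventually hloc
  have h2 : ∀ᶠ n in (hyperfilter ℕ : Filter ℕ), sSup K - ε < t n :=
    (htend.mono_left (by rw [← Nat.cofinite_eq_atTop]; exact hyperfilter_le_cofinite)).eventually
      (lt_mem_nhds (by linarith))
  obtain ⟨n, hn1, hn2⟩ := (h1.and h2).exists
  rcases hn1 (c n (t n)) rfl with ⟨c', hc'0, hc'⟩ | ⟨T, hT, c', hc'0, hc', hout⟩
  · obtain ⟨k, hk, hkc, -⟩ := (hc n).exists_concat (ht0 n) hε.le hc' hc'0
    have h3 : t n + ε ∈ K :=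
      ⟨by linarith [ht0 n], k, by rw [hkc (left_mem_Icc.2 (ht0 n)), hc0], hk⟩
    linarith [le_csSup hbdd h3]
  · obtain ⟨k, hk, hkc, hkT⟩ := (hc n).exists_concat (ht0 n) hT.1 hc' hc'0
    exact hcon ⟨t n + T, by linarith [ht0 n, hT.1], k,
      by rw [hkc (left_mem_Icc.2 (ht0 n)), hc0], hk, by rw [hkT]; exact hout⟩

end Compactness


/-! ### Existence and uniqueness for the transport equation -/

section TransportAlong

variable {d : ℕ} [NeZero d] {M : Type*} [TopologicalSpace M] [ChartedSpace (EuclideanHalfSpace d) M]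
  [RiemannianBundle (fun x : M => TangentSpace (𝓡∂ d) x)] {n : ℕ}
  {A : SphereBundle d M → Matrix (Fin n) (Fin n) ℂ} {f : SphereBundle d M → Fin n → ℂ}

/-- `z` solves the transport equation along the curve `c` on `[a, b]`. -/
def IsTransportAlong (A : SphereBundle d M → Matrix (Fin n) (Fin n) ℂ)
    (f : SphereBundle d M → Fin n → ℂ) (c : ℝ → SphereBundle d M) (z : ℝ → Fin n → ℂ) (a b : ℝ) :
    Prop :=
  ∀ t ∈ Icc a b, HasDerivWithinAt z (-(A (c t)).mulVec (z t) - f (c t)) (Icc a b) t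

theorem IsTransportAlong.congr {c c' : ℝ → SphereBundle d M} {z : ℝ → Fin n → ℂ} {a b : ℝ}
    (hz : IsTransportAlong A f c z a b) (h : EqOn c' c (Icc a b)) :
    IsTransportAlong A f c' z a b := fun t ht => by
  rw [h ht]; exact hz t ht

theorem IsTransportAlong.shift {c : ℝ → SphereBundle d M} {z : ℝ → Fin n → ℂ} {a b s : ℝ}
    (hz : IsTransportAlong A f c z a b) (hs : a ≤ s) :
    IsTransportAlong A f (fun t => c (t + s)) (fun t => z (t + s)) 0 (b - s) := by
  intro t ht
  have hmaps : MapsTo (fun t => t + s) (Icc 0 (b - s)) (Icc a b) := fun t ht =>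
    ⟨by linarith [ht.1], by linarith [ht.2]⟩
  have h := (hz (t + s) (hmaps ht)).scomp t ((hasDerivWithinAt_id t _).add_const s) hmaps
  rw [one_smul] at h
  exact h

end TransportAlong

section TransportODE

open Filter Topology

open scoped NNReal

variable {d : ℕ} [NeZero d] {M : Type*} [TopologicalSpace M] [ChartedSpace (EuclideanHalfSpace d) M]
  [IsManifold (𝓡∂ d) ∞ M] [RiemannianBundle (fun x : M => TangentSpace (𝓡∂ d) x)] {n : ℕ}
  {A : SphereBundle d M → Matrix (Fin n) (Fin n) ℂ} {f : SphereBundle d M → Fin n → ℂ}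

theorem IsSmooth.continuousOn_comp {F : Type*} [NormedAddCommGroup F] [NormedSpace ℝ F]
    {u : SphereBundle d M → F} (hu : IsSmooth u) {c : ℝ → SphereBundle d M} {s : Set ℝ}
    (hc : IsGeodesicOn c s) : ContinuousOn (fun t => u (c t)) s := by
  have h1 : ContinuousOn (extendZero u) (sphereSet d M) := ContMDiffOn.continuousOn hu
  have h2 : ContinuousOn (fun t => extendZero u (c t).1) s :=
    h1.comp hc.continuousOn fun t _ => (c t).2
  exact h2.congr fun t _ => (extendZero_apply u (c t)).symm

theorem norm_mulVec_le {B : Matrix (Fin n) (Fin n) ℂ} {C : ℝ} (hC : 0 ≤ C)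
    (hB : ∀ i j, ‖B i j‖ ≤ C) (z : Fin n → ℂ) : ‖B.mulVec z‖ ≤ n * C * ‖z‖ := by
  refine (pi_norm_le_iff_of_nonneg (by positivity)).2 fun i => ?_
  calc ‖∑ j, B i j * z j‖ ≤ ∑ j : Fin n, C * ‖z‖ := norm_sum_le_of_le _ fun j _ => by
        rw [norm_mul]
        exact mul_le_mul (hB i j) (norm_le_pi_norm z j) (norm_nonneg _) hC
    _ = n * C * ‖z‖ := by simp [mul_assoc]

theorem exists_lipschitzWith_transport (hA : ∀ i j, IsSmooth (fun p => A p i j))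
    {c : ℝ → SphereBundle d M} {a b : ℝ} (hc : IsGeodesicOn c (Icc a b)) :
    ∃ K : ℝ≥0, ∀ t ∈ Icc a b, LipschitzWith K fun z => -(A (c t)).mulVec z - f (c t) := by
  have hcont : ContinuousOn (fun t => (fun i j => A (c t) i j : Fin n → Fin n → ℂ)) (Icc a b) :=
    continuousOn_pi.2 fun i => continuousOn_pi.2 fun j => (hA i j).continuousOn_comp hc
  obtain ⟨C, hC⟩ := isCompact_Icc.exists_bound_of_continuousOn hcont
  have hC' : ∀ t ∈ Icc a b, ∀ i j, ‖A (c t) i j‖ ≤ max C 0 := fun t ht i j =>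
    (((norm_le_pi_norm (A (c t) i) j).trans
      (norm_le_pi_norm (fun i j => A (c t) i j : Fin n → Fin n → ℂ) i)).trans (hC t ht)).trans
        (le_max_left _ _)
  refine ⟨⟨n * max C 0, by positivity⟩, fun t ht => LipschitzWith.of_dist_le_mul fun z w => ?_⟩
  rw [dist_eq_norm, dist_eq_norm]
  have : -(A (c t)).mulVec z - f (c t) - (-(A (c t)).mulVec w - f (c t)) =
      (A (c t)).mulVec (w - z) := by
    rw [Matrix.mulVec_sub]; abel
  rw [this, norm_sub_rev z w]
  exact norm_mulVec_le (le_max_right _ _) (hC' t ht) _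

theorem exists_isTransportAlong (hA : ∀ i j, IsSmooth (fun p => A p i j)) (hf : IsSmooth f)
    {c : ℝ → SphereBundle d M} {a b : ℝ} (hab : a ≤ b) (hc : IsGeodesicOn c (Icc a b)) :
    ∃ z, z b = 0 ∧ IsTransportAlong A f c z a b := by
  obtain ⟨K, hK⟩ := exists_lipschitzWith_transport (f := f) hA hc
  refine exists_solution_of_lipschitzWith hab hK (fun z => ?_) 0
  refine ContinuousOn.sub (ContinuousOn.neg ?_) (hf.continuousOn_comp hc)
  refine continuousOn_pi.2 fun i => ?_
  have h : ContinuousOn (fun t => ∑ j, A (c t) i j * z j) (Icc a b) :=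
    continuousOn_finsetSum _ fun j _ => ((hA i j).continuousOn_comp hc).mul continuousOn_const
  exact h

theorem IsTransportAlong.eqOn (hA : ∀ i j, IsSmooth (fun p => A p i j))
    {c : ℝ → SphereBundle d M} {a b t₀ : ℝ} (hc : IsGeodesicOn c (Icc a b)) (ht₀ : t₀ ∈ Icc a b)
    {z w : ℝ → Fin n → ℂ} (hz : IsTransportAlong A f c z a b) (hw : IsTransportAlong A f c w a b)
    (h : z t₀ = w t₀) : EqOn z w (Icc a b) := by
  obtain ⟨K, hK⟩ := exists_lipschitzWith_transport (f := f) hA hc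
  exact eqOn_Icc_of_lipschitzOnWith (s := univ)
    (fun t ht => (hK t ht).lipschitzOnWith) ht₀ hz hw (fun _ _ => mem_univ _)
    (fun _ _ => mem_univ _) h

end TransportODE

section Solution

variable {d : ℕ} [NeZero d] {M : Type*} [TopologicalSpace M]
  [ChartedSpace (EuclideanHalfSpace d) M] [IsManifold (𝓡∂ d) ∞ M]
  [RiemannianBundle (fun x : M => TangentSpace (𝓡∂ d) x)]
  [IsContMDiffRiemannianBundle (𝓡∂ d) ∞ (EuclideanSpace ℝ (Fin d))
      (fun x : M => TangentSpace (𝓡∂ d) x)] {n : ℕ}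
  {A : SphereBundle d M → Matrix (Fin n) (Fin n) ℂ} {f : SphereBundle d M → Fin n → ℂ}

/-- The geodesic from a given vector to an outward boundary vector is unique. -/
theorem exit_unique [T2Space M] (hconvex : StrictlyConvexBoundary d M) {c c' : ℝ → SphereBundle d M}
    {T T' : ℝ} (hT : 0 ≤ T) (hT' : 0 ≤ T') (hc : IsGeodesicOn c (Icc 0 T))
    (hc' : IsGeodesicOn c' (Icc 0 T')) (h : c 0 = c' 0) (hout : c T ∈ outwardBoundary d M)
    (hout' : c' T' ∈ outwardBoundary d M) : T = T' ∧ EqOn c c' (Icc 0 T) := by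
  have key : ∀ {c c' : ℝ → SphereBundle d M} {T T' : ℝ}, 0 ≤ T → T ≤ T' →
      IsGeodesicOn c (Icc 0 T) → IsGeodesicOn c' (Icc 0 T') → c 0 = c' 0 →
      c T ∈ outwardBoundary d M → T = T' ∧ EqOn c c' (Icc 0 T) := by
    intro c c' T T' hT hTT' hc hc' h hout
    have heq := hc.eqOn (hc'.mono (Icc_subset_Icc_right hTT')) h
    refine ⟨hTT'.eq_of_not_lt fun hlt => ?_, heq⟩
    refine (hc'.mono (Icc_subset_Icc_left hT)).not_mem_outwardBoundary hconvex hlt ?_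
    rwa [← heq (right_mem_Icc.2 hT)]
  rcases le_total T T' with hle | hle
  · exact key hT hle hc hc' h hout
  · obtain ⟨h1, h2⟩ := key hT' hle hc' hc h.symm hout'
    exact ⟨h1.symm, fun t ht => (h2 (by rwa [h1])).symm⟩

/-- `w` is the value at `p` of the solution of the transport equation along the geodesic issued
from `p` that vanishes at the exit point. -/
def IsTransportValue (A : SphereBundle d M → Matrix (Fin n) (Fin n) ℂ)
    (f : SphereBundle d M → Fin n → ℂ) (p : SphereBundle d M) (w : Fin n → ℂ) : Prop :=
  ∃ T ≥ 0, ∃ (c : ℝ → SphereBundle d M) (z : ℝ → Fin n → ℂ), c 0 = p ∧ IsGeodesicOn c (Icc 0 T) ∧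
    c T ∈ outwardBoundary d M ∧ IsTransportAlong A f c z 0 T ∧ z T = 0 ∧ z 0 = w

theorem exists_isTransportValue [CompactSpace M] (hnt : Nontrapping d M)
    (hA : ∀ i j, IsSmooth (fun p => A p i j)) (hf : IsSmooth f) (p : SphereBundle d M) :
    ∃ w, IsTransportValue A f p w := by
  obtain ⟨T, hT, c, hc0, hc, hout⟩ := exists_isGeodesicOn_outwardBoundary hnt p
  obtain ⟨z, hzT, hz⟩ := exists_isTransportAlong hA hf hT hc
  exact ⟨z 0, T, hT, c, z, hc0, hc, hout, hz, hzT, rfl⟩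

theorem IsTransportValue.unique [T2Space M] (hconvex : StrictlyConvexBoundary d M)
    (hA : ∀ i j, IsSmooth (fun p => A p i j)) {p : SphereBundle d M} {w w' : Fin n → ℂ}
    (h : IsTransportValue A f p w) (h' : IsTransportValue A f p w') : w = w' := by
  obtain ⟨T, hT, c, z, hc0, hc, hout, hz, hzT, rfl⟩ := h
  obtain ⟨T', hT', c', z', hc0', hc', hout', hz', hzT', rfl⟩ := h'
  obtain ⟨rfl, heq⟩ := exit_unique hconvex hT hT' hc hc' (hc0.trans hc0'.symm) hout hout'
  exact hz.eqOn hA hc (right_mem_Icc.2 hT) (hz'.congr heq) (hzT.trans hzT'.symm)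
    (left_mem_Icc.2 hT)

theorem IsTransportSolution.isTransportValue [CompactSpace M] (hnt : Nontrapping d M)
    {u : SphereBundle d M → Fin n → ℂ} (hu : IsTransportSolution A f u) (p : SphereBundle d M) :
    IsTransportValue A f p (u p) := by
  obtain ⟨T, hT, c, hc0, hc, hout⟩ := exists_isGeodesicOn_outwardBoundary hnt p
  exact ⟨T, hT, c, fun t => u (c t), hc0, hc, hout, hu.hasDerivWithinAt 0 T c hc,
    hu.eq_zero _ hout, congrArg u hc0⟩

/-- The value of the solution at a vector is found by solving the linear equation backwards from the
exit point of its geodesic; along a given geodesic these values are those of one solution, as all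
its points have the same exit point. -/
theorem existsUnique_isTransportSolution [T2Space M] [CompactSpace M] (hnt : Nontrapping d M)
    (hconvex : StrictlyConvexBoundary d M) (hA : ∀ i j, IsSmooth (fun p => A p i j))
    (hf : IsSmooth f) : ∃! u, IsTransportSolution A f u := by
  choose u hu using exists_isTransportValue hnt hA hf
  refine ⟨u, ⟨fun a b c hc t ht => ?_, fun p hp => ?_⟩, fun w hw => ?_⟩
  · have hab : a ≤ b := ht.1.trans ht.2
    obtain ⟨T, hT, k, hk0, hk, hout⟩ := exists_isGeodesicOn_outwardBoundary hnt (c b)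
    obtain ⟨K, hK, hKc, hKT⟩ := hc.exists_concat hab hT hk hk0
    obtain ⟨z, hzT, hz⟩ := exists_isTransportAlong hA hf (by linarith : a ≤ b + T) hK
    have huz : ∀ s ∈ Icc a b, u (c s) = z s := fun s hs => by
      refine (hu (c s)).unique hconvex hA ⟨b + T - s, by linarith [hs.2], fun t => K (t + s),
        fun t => z (t + s), by simp [hKc hs], (hK.comp_add s).mono fun t ht =>
          ⟨by linarith [ht.1, hs.1], by linarith [ht.2]⟩, by simpa [hKT] using hout,
        hz.shift hs.1, by simpa using hzT, by simp⟩
    have h1 := (hz t ⟨ht.1, by linarith [ht.2]⟩).mono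
      (Icc_subset_Icc_right (by linarith : b ≤ b + T))
    rw [hKc ht, ← huz t ht] at h1
    exact h1.congr huz (huz t ht)
  · refine (hu p).unique hconvex hA ⟨0, le_rfl, fun _ => p, fun _ => 0, rfl,
      isGeodesicOn_singleton p, hp, fun t ht => ?_, rfl, rfl⟩
    refine HasFDerivWithinAt.of_subsingleton ?_
    rw [Icc_self]
    exact subsingleton_singleton
  · funext p
    exact (hw.isTransportValue hnt p).unique hconvex hA (hu p)

end Solution


/-! ### The transport equation along short geodesics -/

section TransportFlow

open Filter Topology Metric

variable {d : ℕ} [NeZero d] {M : Type*} [TopologicalSpace M]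
  [ChartedSpace (EuclideanHalfSpace d) M] [IsManifold (𝓡∂ d) ∞ M]
  [RiemannianBundle (fun x : M => TangentSpace (𝓡∂ d) x)]
  [IsContMDiffRiemannianBundle (𝓡∂ d) ∞ (EuclideanSpace ℝ (Fin d))
      (fun x : M => TangentSpace (𝓡∂ d) x)] {n : ℕ}
  {A : SphereBundle d M → Matrix (Fin n) (Fin n) ℂ} {f u : SphereBundle d M → Fin n → ℂ}

/-- The value of the solution at a point is a `C^N` function `Ψ` of its value at another point of
the same short geodesic, of that point, and of the time in between. -/
theorem exists_transportFlow (hA : ∀ i j, IsSmooth (fun p => A p i j)) (hf : IsSmooth f)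
    (hu : IsTransportSolution A f u) {x₀ : M} {q₀ : Euc d × Euc d} (hq₀ : q₀ ∈ unitSet x₀) {N : ℕ}
    (hN : N ≠ 0) (g : GeodesicFlow x₀ q₀ N) (z₀ : Fin n → ℂ) :
    ∃ Ψ : ((Euc d × Euc d) × (Fin n → ℂ)) × ℝ → Fin n → ℂ, ContDiffAt ℝ N Ψ ((q₀, z₀), 0) ∧
      ∃ r > 0, r ≤ g.r ∧ ∀ q ∈ ball q₀ r, q ∈ unitSet x₀ → ∀ t ∈ Ioo (-r) r,
        (∀ s ∈ uIcc 0 t, 0 ≤ (g.φ (q, s)).1 0) →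
        dist (inCoords x₀ u (g.φ (q, t))) z₀ < r →
        inCoords x₀ u q = Ψ ((g.φ (q, t), inCoords x₀ u (g.φ (q, t))), -t) := by
  choose A' hA' hAA' using fun i j => (hA i j).exists_extension N hq₀
  obtain ⟨f', hf', hff'⟩ := hf.exists_extension N hq₀
  -- The geodesic equation and the transport equation as one autonomous system, with all
  -- coefficients extended across the boundary; `Φ` is its flow.
  let W : (Euc d × Euc d) × (Fin n → ℂ) → (Euc d × Euc d) × (Fin n → ℂ) := fun x =>
    ((x.1.2, g.a x.1), fun i => -(∑ j, A' i j x.1 * x.2 j) - f' x.1 i)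
  have hW : ContDiff ℝ N W := by
    refine ContDiff.prodMk (contDiff_fst.snd.prodMk (g.contDiff_a.comp contDiff_fst))
      (contDiff_pi.2 fun i => ContDiff.sub (ContDiff.neg (ContDiff.sum fun j _ => ?_)) ?_)
    · exact ((hA' i j).comp contDiff_fst).mul ((contDiff_apply ℝ ℂ j).comp contDiff_snd)
    · exact (contDiff_apply ℝ ℂ i).comp (hf'.comp contDiff_fst)
  obtain ⟨Φ, hΦ, r₁, hr₁, hflow⟩ := exists_contDiffAt_flow hN hW (q₀, z₀)
  have hgood : ∀ᶠ q in 𝓝 q₀, q ∈ unitSet x₀ →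
      (∀ i j, A' i j q = inCoords x₀ (fun p => A p i j) q) ∧ f' q = inCoords x₀ f q := by
    refine eventually_nhdsWithin_iff.1 ((eventually_all.2 fun i => eventually_all.2 fun j =>
      hAA' i j).and hff')
  have hnear : ∀ᶠ x in 𝓝 (q₀, (0 : ℝ)), dist (g.φ x) q₀ < r₁ ∧ (g.φ x ∈ unitSet x₀ →
      (∀ i j, A' i j (g.φ x) = inCoords x₀ (fun p => A p i j) (g.φ x)) ∧
        f' (g.φ x) = inCoords x₀ f (g.φ x)) := by
    have h := g.contDiffAt.continuousAt
    rw [ContinuousAt, g.base] at h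
    have hb : ∀ᶠ q in 𝓝 q₀, dist q q₀ < r₁ := ball_mem_nhds q₀ hr₁
    exact h.eventually (hb.and hgood)
  obtain ⟨r₂, hr₂, hball⟩ := Metric.eventually_nhds_iff_ball.1 hnear
  set r := min (min r₁ r₂) g.r with hr
  have hrr₁ : r ≤ r₁ := (min_le_left _ _).trans (min_le_left _ _)
  have hrr₂ : r ≤ r₂ := (min_le_left _ _).trans (min_le_right _ _)
  have hrg : r ≤ g.r := min_le_right _ _
  refine ⟨fun x => (Φ x).2, hΦ.snd, r, lt_min (lt_min hr₁ hr₂) g.r_pos, hrg,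
    fun q hq hqu t ht hpos hdist => ?_⟩
  set s₁ := min 0 t with hs₁
  set s₂ := max 0 t with hs₂
  have hs₁r : -r < s₁ := lt_min (by linarith [ht.1, ht.2]) ht.1
  have hs₂r : s₂ < r := max_lt (by linarith [ht.1, ht.2]) ht.2
  have h0 : (0 : ℝ) ∈ Icc s₁ s₂ := ⟨min_le_left _ _, le_max_left _ _⟩
  have ht' : t ∈ Icc s₁ s₂ := ⟨min_le_right _ _, le_max_right _ _⟩
  have hqg : q ∈ ball q₀ g.r := ball_subset_ball hrg hq
  obtain ⟨hunit, c, hc, hcq⟩ := g.exists_isGeodesicOn hqg hqu (by linarith) (by linarith) h0 hpos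
  have hnear' : ∀ s ∈ Icc s₁ s₂, dist (g.φ (q, s)) q₀ < r₁ ∧
      (∀ i j, A' i j (g.φ (q, s)) = A (c s) i j) ∧ f' (g.φ (q, s)) = f (c s) := by
    intro s hs
    have h1 := hball (q, s) (by
      rw [mem_ball, Prod.dist_eq, max_lt_iff]
      refine ⟨(mem_ball.1 hq).trans_le hrr₂, ?_⟩
      rw [Real.dist_eq, sub_zero, abs_lt]
      constructor <;> linarith [hs.1, hs.2])
    refine ⟨h1.1, fun i j => ?_, ?_⟩
    · rw [(h1.2 (hunit s hs)).1, ← (hcq s hs).2, inCoords_coords _ (hcq s hs).1]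
    · rw [(h1.2 (hunit s hs)).2, ← (hcq s hs).2, inCoords_coords _ (hcq s hs).1]
  have huc : ∀ s ∈ Icc s₁ s₂, inCoords x₀ u (g.φ (q, s)) = u (c s) := fun s hs => by
    rw [← (hcq s hs).2, inCoords_coords _ (hcq s hs).1]
  rw [huc t ht'] at hdist ⊢
  have hstart : (g.φ (q, t), u (c t)) ∈ ball (q₀, z₀) r₁ := by
    rw [mem_ball, Prod.dist_eq]
    exact max_lt (hnear' t ht').1 (hdist.trans_le hrr₁)
  have heq := eqOn_Icc_of_contDiff (V := W)
    (hW.of_le (by exact_mod_cast Nat.one_le_iff_ne_zero.2 hN)) ht'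
    (f := fun s => (g.φ (q, s), u (c s)))
    (g := fun s => Φ ((g.φ (q, t), u (c t)), s - t))
    (fun s hs => by
      have h1 := (g.hasDerivAt q hqg s ⟨by linarith [hs.1], by linarith [hs.2]⟩).hasDerivWithinAt
        (s := Icc s₁ s₂)
      have h2 := hu.hasDerivWithinAt s₁ s₂ c hc s hs
      refine (h1.prodMk h2).congr_deriv (Prod.ext rfl ?_)
      funext i
      simp only [W, (hnear' s hs).2.1, (hnear' s hs).2.2]
      rfl)
    (fun s hs => by
      have h1 := (hflow _ hstart).2 (s - t) (by
        rcases le_total 0 t with h | h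
        · rw [hs₁, min_eq_left h] at hs
          rw [hs₂, max_eq_right h] at hs
          constructor <;> linarith [hs.1, hs.2, ht.1, ht.2]
        · rw [hs₁, min_eq_right h] at hs
          rw [hs₂, max_eq_left h] at hs
          constructor <;> linarith [hs.1, hs.2, ht.1, ht.2])
      have h2 := h1.scomp s ((hasDerivAt_id s).sub_const t)
      rw [one_smul] at h2
      exact h2.hasDerivWithinAt)
    (by
      simp only [sub_self]
      exact (hflow _ hstart).1.symm)
  have h1 := congrArg Prod.snd (heq h0)
  simp only [zero_sub] at h1
  have h2 := huc 0 h0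
  rw [g.zero q hqg] at h2
  exact h2.trans h1

end TransportFlow


/-! ### Regularity near the outward boundary -/

section RealLine

/-- A function with nonpositive second derivative is nonnegative between two points where it is
nonnegative. -/
theorem nonneg_of_deriv2_nonpos {y v w : ℝ → ℝ} {a b : ℝ} (hy : ∀ t ∈ Icc a b, HasDerivAt y (v t) t)
    (hv : ∀ t ∈ Icc a b, HasDerivAt v (w t) t) (hw : ∀ t ∈ Icc a b, w t ≤ 0) (ha : 0 ≤ y a)
    (hb : 0 ≤ y b) : ∀ t ∈ Icc a b, 0 ≤ y t := by
  have hconc : ConcaveOn ℝ (Icc a b) y := concaveOn_of_hasDerivWithinAt2_nonpos (convex_Icc a b)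
    (fun t ht => (hy t ht).continuousAt.continuousWithinAt)
    (fun t ht => (hy t (interior_subset ht)).hasDerivWithinAt)
    (fun t ht => (hv t (interior_subset ht)).hasDerivWithinAt)
    (fun t ht => hw t (interior_subset ht))
  intro t ht
  have hab : a ≤ b := ht.1.trans ht.2
  exact (le_min ha hb).trans (hconc.min_le_of_mem_Icc (left_mem_Icc.2 hab) (right_mem_Icc.2 hab) ht)

theorem contDiffAt_comp_of_eq {E F G : Type*} [NormedAddCommGroup E] [NormedSpace ℝ E]
    [NormedAddCommGroup F] [NormedSpace ℝ F] [NormedAddCommGroup G] [NormedSpace ℝ G]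
    {g : F → G} {f : E → F} {x : E} {y : F} {k : WithTop ℕ∞} (hg : ContDiffAt ℝ k g y)
    (hf : ContDiffAt ℝ k f x) (hy : f x = y) : ContDiffAt ℝ k (fun q => g (f q)) x := by
  subst hy
  exact hg.comp x hf

end RealLine

section Regularity

open Filter Topology Metric

variable {d : ℕ} [NeZero d] {M : Type*} [TopologicalSpace M]
  [ChartedSpace (EuclideanHalfSpace d) M] [IsManifold (𝓡∂ d) ∞ M]
  [RiemannianBundle (fun x : M => TangentSpace (𝓡∂ d) x)]
  {n : ℕ} {u : SphereBundle d M → Fin n → ℂ}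

/-- A ball of initial points and an interval of times on which a property of points near `q₀` holds
along the flow. -/
theorem GeodesicFlow.eventually_comp {x₀ : M} {q₀ : Euc d × Euc d} {N : ℕ}
    (g : GeodesicFlow x₀ q₀ N) {p : Euc d × Euc d → Prop} (hp : ∀ᶠ q in 𝓝 q₀, p q) {R : ℝ}
    (hR : 0 < R) :
    ∃ ρ > 0, ρ ≤ R ∧ ∀ q ∈ ball q₀ ρ, ∀ t ∈ Ioo (-ρ) ρ, p (g.φ (q, t)) := by
  have h := g.contDiffAt.continuousAt
  rw [ContinuousAt, g.base] at h
  obtain ⟨ρ, hρ, hball⟩ := Metric.eventually_nhds_iff_ball.1 (h.eventually hp)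
  refine ⟨min ρ R, lt_min hρ hR, min_le_right _ _, fun q hq t ht => hball (q, t) ?_⟩
  rw [mem_ball, Prod.dist_eq, max_lt_iff]
  refine ⟨(mem_ball.1 hq).trans_le (min_le_left _ _), ?_⟩
  rw [Real.dist_eq, sub_zero, abs_lt]
  exact ⟨(neg_le_neg (min_le_left _ _)).trans_lt ht.1, ht.2.trans_le (min_le_left _ _)⟩

theorem inCoords_eq_zero {x₀ : M} (hb : ∀ p : SphereBundle d M, p.1.1 ∈ (𝓡∂ d).boundary M → u p = 0)
    {q : Euc d × Euc d} (hq : q ∈ unitSet x₀) (h0 : q.1 0 = 0) : inCoords x₀ u q = 0 := by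
  obtain ⟨p, -, hp, rfl⟩ := exists_eq_coords hq
  rw [inCoords_coords u hp]
  exact hb p ((mem_boundary_iff hp).2 h0)

theorem zero_le_of_mem_unitSet {x₀ : M} {q : Euc d × Euc d} (hq : q ∈ unitSet x₀) : 0 ≤ q.1 0 :=
  mem_range_iff.1 (unitSet_subset x₀ hq).1

/-- At a vector that is not on the outward boundary, the geodesics from all nearby vectors exist
for a uniform time. -/
theorem GeodesicFlow.exists_nonneg {x₀ : M} {q₀ : Euc d × Euc d} {N : ℕ}
    (g : GeodesicFlow x₀ q₀ N) (h : 0 < q₀.1 0 ∨ 0 < q₀.2 0) {R : ℝ} (hR : 0 < R) (hRg : R ≤ g.r) :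
    ∃ ρ > 0, ρ ≤ R ∧ ∀ q ∈ ball q₀ ρ, q ∈ unitSet x₀ → ∀ t ∈ Ico 0 ρ, 0 ≤ (g.φ (q, t)).1 0 := by
  rcases h with h | h
  · have hc : Continuous fun q : Euc d × Euc d => q.1 0 :=
      (EuclideanSpace.proj 0 : Euc d →L[ℝ] ℝ).continuous.comp continuous_fst
    obtain ⟨ρ, hρ, hρR, hpos⟩ := g.eventually_comp (hc.continuousAt.eventually (lt_mem_nhds h)) hR
    exact ⟨ρ, hρ, hρR, fun q hq _ t ht => (hpos q hq t ⟨by linarith [ht.1], ht.2⟩).le⟩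
  · have hc : Continuous fun q : Euc d × Euc d => q.2 0 :=
      (EuclideanSpace.proj 0 : Euc d →L[ℝ] ℝ).continuous.comp continuous_snd
    obtain ⟨ρ, hρ, hρR, hpos⟩ := g.eventually_comp (hc.continuousAt.eventually (lt_mem_nhds h)) hR
    refine ⟨ρ, hρ, hρR, fun q hq hqu t ht => ?_⟩
    have hqg : q ∈ ball q₀ g.r := ball_subset_ball (hρR.trans hRg) hq
    have hd1 : ∀ t ∈ Ioo (-ρ) ρ,
        HasDerivAt (fun t => (g.φ (q, t)).1 0) ((g.φ (q, t)).2 0) t := fun t ht =>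
      g.hasDerivAt_zero hqg ⟨by linarith [ht.1], by linarith [ht.2]⟩
    have hmono : MonotoneOn (fun t => (g.φ (q, t)).1 0) (Ioo (-ρ) ρ) := by
      refine monotoneOn_of_deriv_nonneg (convex_Ioo _ _)
        (fun t ht => (hd1 t ht).continuousAt.continuousWithinAt)
        (fun t ht => (hd1 t (interior_subset ht)).differentiableAt.differentiableWithinAt)
        fun t ht => ?_
      rw [(hd1 t (interior_subset ht)).deriv]
      exact (hpos q hq t (interior_subset ht)).le
    have h2 : (g.φ (q, 0)).1 0 ≤ (g.φ (q, t)).1 0 :=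
      hmono ⟨by linarith, hρ⟩ ⟨by linarith [ht.1], ht.2⟩ ht.1
    rw [g.zero q hqg] at h2
    exact (zero_le_of_mem_unitSet hqu).trans h2

variable [IsContMDiffRiemannianBundle (𝓡∂ d) ∞ (EuclideanSpace ℝ (Fin d))
      (fun x : M => TangentSpace (𝓡∂ d) x)]
  {A : SphereBundle d M → Matrix (Fin n) (Fin n) ℂ} {f : SphereBundle d M → Fin n → ℂ}

/-- Regularity of the solution at a vector tangent to the boundary. The height above the boundary
along the extended geodesic from a nearby unit vector has two zeros, one in the past and one in the
future. The solution vanishes at both of them, and is given by the same function of either; so the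
square root singularity of the exit time does not affect it. -/
theorem contDiffWithinAt_of_glancing (hA : ∀ i j, IsSmooth (fun p => A p i j)) (hf : IsSmooth f)
    (hu : IsTransportSolution A f u)
    (hb : ∀ p : SphereBundle d M, p.1.1 ∈ (𝓡∂ d).boundary M → u p = 0) {x₀ : M}
    {q₀ : Euc d × Euc d} (hq₀ : q₀ ∈ unitSet x₀) (h0 : q₀.1 0 = 0) (h1 : q₀.2 0 = 0)
    (h2 : 0 < christoffelMap x₀ q₀.1 q₀.2 q₀.2 0) {k : ℕ} (hk : k ≠ 0) :
    ContDiffWithinAt ℝ k (inCoords x₀ u) (unitSet x₀) q₀ := by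
  -- Half of the derivatives are lost at the fold.
  obtain ⟨g⟩ := nonempty_geodesicFlow x₀ hq₀.1 (N := 2 * k + 1 + 1) (by omega)
  obtain ⟨Ψ, hΨ, r, hr, hrg, hΨu⟩ := exists_transportFlow hA hf hu hq₀ (by omega) g 0
  have ha0 : g.a q₀ 0 < 0 := by
    rw [g.a_base, PiLp.neg_apply]; linarith
  have hacont : ∀ᶠ q in 𝓝 q₀, g.a q 0 < 0 := by
    have hc : Continuous fun q => g.a q 0 :=
      (EuclideanSpace.proj 0 : Euc d →L[ℝ] ℝ).continuous.comp g.contDiff_a.continuous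
    exact hc.continuousAt.eventually (gt_mem_nhds ha0)
  obtain ⟨ρ, hρ, hρr, hρa⟩ := g.eventually_comp hacont hr
  have hproj : ∀ {y : ℝ → Euc d} {y' : Euc d} {t : ℝ}, HasDerivAt y y' t →
      HasDerivAt (fun t => y t 0) (y' 0) t := fun {y y' t} h =>
    (EuclideanSpace.proj 0 : Euc d →L[ℝ] ℝ).hasFDerivAt.comp_hasDerivAt t h
  have hd1 : ∀ q ∈ ball q₀ ρ, ∀ t ∈ Ioo (-ρ) ρ,
      HasDerivAt (fun t => (g.φ (q, t)).1 0) ((g.φ (q, t)).2 0) t := fun q hq t ht =>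
    g.hasDerivAt_zero (ball_subset_ball (hρr.trans hrg) hq)
      ⟨by linarith [ht.1], by linarith [ht.2]⟩
  have hd2 : ∀ q ∈ ball q₀ ρ, ∀ t ∈ Ioo (-ρ) ρ,
      HasDerivAt (fun t => (g.φ (q, t)).2 0) (g.a (g.φ (q, t)) 0) t := fun q hq t ht =>
    hproj (g.hasDerivAt q (ball_subset_ball (hρr.trans hrg) hq) t
      ⟨by linarith [ht.1], by linarith [ht.2]⟩).snd
  have hq₀ρ : q₀ ∈ ball q₀ ρ := mem_ball_self hρ
  have h0ρ : (0 : ℝ) ∈ Ioo (-ρ) ρ := ⟨by linarith, hρ⟩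
  have hφswap : ContDiffAt ℝ (2 * k + 1 + 1 : ℕ) (fun x : ℝ × (Euc d × Euc d) => g.φ (x.2, x.1))
      (0, q₀) :=
    ContDiffAt.comp (g := g.φ) (f := fun x : ℝ × (Euc d × Euc d) => (x.2, x.1)) (0, q₀)
      g.contDiffAt (contDiffAt_snd.prodMk contDiffAt_fst)
  have hle : ((2 * k : ℕ) : WithTop ℕ∞) ≤ (2 * k + 1 + 1 : ℕ) := by norm_cast; omega
  refine contDiffWithinAt_of_fold (h := fun x => (g.φ (x.2, x.1)).1 0)
    (G₀ := fun x => Ψ ((g.φ (x.2, x.1), 0), -x.1)) hk ?_ ?_ ?_ ?_ ?_ hq₀ ?_ ?_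
  · exact (EuclideanSpace.proj 0 : Euc d →L[ℝ] ℝ).contDiff.contDiffAt.comp _ hφswap.fst
  · refine contDiffAt_comp_of_eq (g := Ψ) (f := fun x : ℝ × (Euc d × Euc d) =>
      ((g.φ (x.2, x.1), (0 : Fin n → ℂ)), -x.1)) (hΨ.of_le hle)
      (((hφswap.of_le hle).prodMk contDiffAt_const).prodMk contDiffAt_fst.neg) ?_
    simp only [g.base, neg_zero]
  · simp only [g.base, h0]
  · rw [(hd1 q₀ hq₀ρ 0 h0ρ).deriv, g.base, h1]
  · have hev : (deriv fun t => (g.φ (q₀, t)).1 0) =ᶠ[𝓝 0] fun t => (g.φ (q₀, t)).2 0 := by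
      filter_upwards [Ioo_mem_nhds h0ρ.1 h0ρ.2] with t ht
      exact (hd1 q₀ hq₀ρ t ht).deriv
    rw [hev.deriv_eq, (hd2 q₀ hq₀ρ 0 h0ρ).deriv, g.base]
    exact ha0
  · filter_upwards [self_mem_nhdsWithin, nhdsWithin_le_nhds (ball_mem_nhds q₀ hρ)] with q hqu hq
    rw [g.zero q (ball_subset_ball (hρr.trans hrg) hq)]
    exact zero_le_of_mem_unitSet hqu
  · filter_upwards [(prod_mem_nhds (Ioo_mem_nhds h0ρ.1 h0ρ.2) (ball_mem_nhds q₀ hρ))]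
    rintro ⟨t, q⟩ ⟨ht, hq⟩ hqu hzero
    simp only at ht hq hqu hzero ⊢
    have hqg : q ∈ ball q₀ g.r := ball_subset_ball (hρr.trans hrg) hq
    have hsub : ∀ s ∈ uIcc 0 t, s ∈ Ioo (-ρ) ρ := fun s hs =>
      ⟨(lt_min h0ρ.1 ht.1).trans_le hs.1, hs.2.trans_lt (max_lt h0ρ.2 ht.2)⟩
    have hy0 : 0 ≤ (g.φ (q, 0)).1 0 := by rw [g.zero q hqg]; exact zero_le_of_mem_unitSet hqu
    -- The height above the boundary is concave in time, hence nonnegative up to its second zero.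
    have hpos : ∀ s ∈ uIcc 0 t, 0 ≤ (g.φ (q, s)).1 0 := by
      refine nonneg_of_deriv2_nonpos (fun s hs => hd1 q hq s (hsub s hs))
        (fun s hs => hd2 q hq s (hsub s hs)) (fun s hs => (hρa q hq s (hsub s hs)).le) ?_ ?_
      · rcases min_choice 0 t with h | h <;> rw [h]
        exacts [hy0, hzero.ge]
      · rcases max_choice 0 t with h | h <;> rw [h]
        exacts [hy0, hzero.ge]
    have hunit := (g.exists_isGeodesicOn hqg hqu (s₁ := min 0 t) (s₂ := max 0 t)
      (by linarith [(hsub _ (left_mem_uIcc : (0:ℝ) ∈ uIcc 0 t)).1, lt_min h0ρ.1 ht.1])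
      (by linarith [max_lt h0ρ.2 ht.2]) ⟨min_le_left _ _, le_max_left _ _⟩ hpos).1 t
      ⟨min_le_right _ _, le_max_right _ _⟩
    have hu0 := inCoords_eq_zero hb hunit hzero
    have := hΨu q (ball_subset_ball hρr hq) hqu t ⟨by linarith [ht.1], by linarith [ht.2]⟩ hpos
      (by rw [hu0, dist_self]; exact hr)
    rwa [hu0] at this

/-- Regularity of the solution at a boundary vector that points strictly outwards: the exit time is
smooth there. -/
theorem contDiffWithinAt_of_transversal (hA : ∀ i j, IsSmooth (fun p => A p i j)) (hf : IsSmooth f)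
    (hu : IsTransportSolution A f u)
    (hb : ∀ p : SphereBundle d M, p.1.1 ∈ (𝓡∂ d).boundary M → u p = 0) {x₀ : M}
    {q₀ : Euc d × Euc d} (hq₀ : q₀ ∈ unitSet x₀) (h0 : q₀.1 0 = 0) (h1 : q₀.2 0 < 0)
    {k : ℕ} (hk : k ≠ 0) :
    ContDiffWithinAt ℝ k (inCoords x₀ u) (unitSet x₀) q₀ := by
  obtain ⟨g⟩ := nonempty_geodesicFlow x₀ hq₀.1 (N := k) hk
  obtain ⟨Ψ, hΨ, r, hr, hrg, hΨu⟩ := exists_transportFlow hA hf hu hq₀ hk g 0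
  have hvcont : ∀ᶠ q : Euc d × Euc d in 𝓝 q₀, q.2 0 < 0 := by
    have hc : Continuous fun q : Euc d × Euc d => q.2 0 :=
      (EuclideanSpace.proj 0 : Euc d →L[ℝ] ℝ).continuous.comp continuous_snd
    exact hc.continuousAt.eventually (gt_mem_nhds h1)
  obtain ⟨ρ, hρ, hρr, hρv⟩ := g.eventually_comp hvcont hr
  have hd1 : ∀ q ∈ ball q₀ ρ, ∀ t ∈ Ioo (-ρ) ρ,
      HasDerivAt (fun t => (g.φ (q, t)).1 0) ((g.φ (q, t)).2 0) t := fun q hq t ht =>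
    g.hasDerivAt_zero (ball_subset_ball (hρr.trans hrg) hq)
      ⟨by linarith [ht.1], by linarith [ht.2]⟩
  have hq₀ρ : q₀ ∈ ball q₀ ρ := mem_ball_self hρ
  have h0ρ : (0 : ℝ) ∈ Ioo (-ρ) ρ := ⟨by linarith, hρ⟩
  have hd0 := hd1 q₀ hq₀ρ 0 h0ρ
  rw [g.base] at hd0
  obtain ⟨T, hT, hT0, hTz⟩ := exists_implicit_real (n := k) (by exact_mod_cast hk)
    (g := fun x => (g.φ x).1 0) (p₀ := q₀) (t₀ := 0)
    ((EuclideanSpace.proj 0 : Euc d →L[ℝ] ℝ).contDiff.contDiffAt.comp _ g.contDiffAt.fst)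
    (by simp only [g.base, h0]) hd0 h1.ne
  have hφT : ContDiffAt ℝ k (fun q => g.φ (q, T q)) q₀ :=
    contDiffAt_comp_of_eq (g := g.φ) (f := fun q => (q, T q)) g.contDiffAt
      (contDiffAt_id.prodMk hT) (by rw [hT0])
  have hG : ContDiffAt ℝ k (fun q => Ψ ((g.φ (q, T q), 0), -T q)) q₀ :=
    contDiffAt_comp_of_eq (g := Ψ) (f := fun q => ((g.φ (q, T q), (0 : Fin n → ℂ)), -T q)) hΨ
      ((hφT.prodMk contDiffAt_const).prodMk hT.neg) (by simp only [hT0, g.base, neg_zero])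
  have hTρ : ∀ᶠ q in 𝓝 q₀, T q ∈ Ioo (-ρ) ρ := by
    have := hT.continuousAt
    rw [ContinuousAt, hT0] at this
    exact this.eventually (Ioo_mem_nhds h0ρ.1 h0ρ.2)
  have hev : ∀ᶠ q in 𝓝[unitSet x₀] q₀, inCoords x₀ u q = Ψ ((g.φ (q, T q), 0), -T q) := by
    filter_upwards [self_mem_nhdsWithin, nhdsWithin_le_nhds (ball_mem_nhds q₀ hρ),
      nhdsWithin_le_nhds hTz, nhdsWithin_le_nhds hTρ] with q hqu hq hzero hTq
    have hqg : q ∈ ball q₀ g.r := ball_subset_ball (hρr.trans hrg) hq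
    have hanti : StrictAntiOn (fun t => (g.φ (q, t)).1 0) (Ioo (-ρ) ρ) := by
      refine strictAntiOn_of_deriv_neg (convex_Ioo _ _)
        (fun t ht => (hd1 q hq t ht).continuousAt.continuousWithinAt) fun t ht => ?_
      rw [interior_Ioo] at ht
      rw [(hd1 q hq t ht).deriv]
      exact hρv q hq t ht
    have hy0 : 0 ≤ (g.φ (q, 0)).1 0 := by rw [g.zero q hqg]; exact zero_le_of_mem_unitSet hqu
    have hTq0 : 0 ≤ T q := by
      by_contra hneg
      have h2 : (g.φ (q, 0)).1 0 < (g.φ (q, T q)).1 0 := hanti hTq h0ρ (not_le.1 hneg)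
      rw [show (g.φ (q, T q)).1 0 = 0 from hzero] at h2
      exact absurd hy0 (not_le.2 h2)
    have hpos : ∀ s ∈ Icc 0 (T q), 0 ≤ (g.φ (q, s)).1 0 := fun s hs => by
      have h2 : (g.φ (q, T q)).1 0 ≤ (g.φ (q, s)).1 0 :=
        hanti.antitoneOn ⟨by linarith [hs.1], hs.2.trans_lt hTq.2⟩ hTq hs.2
      rwa [show (g.φ (q, T q)).1 0 = 0 from hzero] at h2
    have hunit := (g.exists_isGeodesicOn hqg hqu (s₁ := 0) (s₂ := T q) (by linarith)
      (by linarith [hTq.2]) (left_mem_Icc.2 hTq0) hpos).1 _ (right_mem_Icc.2 hTq0)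
    have hu0 := inCoords_eq_zero hb hunit hzero
    have := hΨu q (ball_subset_ball hρr hq) hqu (T q) ⟨by linarith [hTq.1], by linarith [hTq.2]⟩
      (by rw [uIcc_of_le hTq0]; exact hpos) (by rw [hu0, dist_self]; exact hr)
    rwa [hu0] at this
  exact hG.contDiffWithinAt.congr_of_eventuallyEq hev (hev.self_of_nhdsWithin hq₀)

end Regularity


/-! ### Propagation of regularity -/

section Propagation

open Filter Topology Metric

variable {d : ℕ} [NeZero d] {M : Type*} [TopologicalSpace M]
  [ChartedSpace (EuclideanHalfSpace d) M] [IsManifold (𝓡∂ d) ∞ M]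
  [RiemannianBundle (fun x : M => TangentSpace (𝓡∂ d) x)] {n : ℕ}
  {u : SphereBundle d M → Fin n → ℂ}

/-- The times at which a function is `C^k` at the point of a geodesic form a relatively open set. -/
theorem IsGeodesicOn.eventually_contMDiffWithinAt {c : ℝ → SphereBundle d M} {s : Set ℝ}
    (hc : IsGeodesicOn c s) {k : ℕ} {t : ℝ} (ht : t ∈ s)
    (h : ContMDiffWithinAt (𝓡∂ d).tangent 𝓘(ℝ, Fin n → ℂ) k (extendZero u) (sphereSet d M)
      (c t).1) :
    ∀ᶠ t' in 𝓝[s] t, ContMDiffWithinAt (𝓡∂ d).tangent 𝓘(ℝ, Fin n → ℂ) k (extendZero u)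
      (sphereSet d M) (c t').1 := by
  have : IsManifold (𝓡∂ d).tangent k (TangentBundle (𝓡∂ d) M) :=
    IsManifold.of_le (n := ∞) (by exact_mod_cast le_top)
  have h1 := (contMDiffWithinAt_iff_contMDiffWithinAt_nhdsWithin (by simp)).1 h
  rw [insert_eq_of_mem (show (c t).1 ∈ sphereSet d M from (c t).2)] at h1
  have h2 : Tendsto (fun t' => (c t').1) (𝓝[s] t) (𝓝[sphereSet d M] (c t).1) :=
    tendsto_nhdsWithin_iff.2 ⟨hc.continuousOn t ht, Eventually.of_forall fun t' => (c t').2⟩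
  exact h2.eventually h1

variable [IsContMDiffRiemannianBundle (𝓡∂ d) ∞ (EuclideanSpace ℝ (Fin d))
      (fun x : M => TangentSpace (𝓡∂ d) x)]
  {A : SphereBundle d M → Matrix (Fin n) (Fin n) ℂ} {f : SphereBundle d M → Fin n → ℂ}

/-- Regularity of the solution propagates backwards along geodesics. By strict convexity the initial
vector of a nontrivial geodesic is not on the outward boundary; so all nearby geodesics exist for a
uniform time, and express the solution near the initial vector in terms of its later values. -/
theorem contMDiffWithinAt_of_forall_later [T2Space M] (hconvex : StrictlyConvexBoundary d M)
    (hA : ∀ i j, IsSmooth (fun p => A p i j)) (hf : IsSmooth f) (hu : IsTransportSolution A f u)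
    {c : ℝ → SphereBundle d M} {T : ℝ} (hT : 0 < T) (hc : IsGeodesicOn c (Icc 0 T)) {k : ℕ}
    (hk : k ≠ 0) (h : ∀ t ∈ Ioc 0 T, ContMDiffWithinAt (𝓡∂ d).tangent 𝓘(ℝ, Fin n → ℂ) k
      (extendZero u) (sphereSet d M) (c t).1) :
    ContMDiffWithinAt (𝓡∂ d).tangent 𝓘(ℝ, Fin n → ℂ) k (extendZero u) (sphereSet d M)
      (c 0).1 := by
  set x₀ := (c 0).1.1 with hx₀
  have hsrc : (c 0).1.1 ∈ (extChartAt (𝓡∂ d) x₀).source := mem_extChartAt_source _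
  rw [contMDiffWithinAt_extendZero_iff hsrc]
  set q₀ := coords x₀ (c 0).1 with hq₀
  have hq₀u : q₀ ∈ unitSet x₀ := coords_mem_unitSet hsrc
  have hdir : 0 < q₀.1 0 ∨ 0 < q₀.2 0 := by
    by_contra hcon
    push Not at hcon
    exact hc.not_mem_outwardBoundary hconvex hT (mem_outwardBoundary_of_coords hsrc
      (le_antisymm hcon.1 (zero_le_of_mem_unitSet hq₀u)) hcon.2)
  obtain ⟨g⟩ := nonempty_geodesicFlow x₀ hq₀u.1 (N := k) hk
  obtain ⟨Ψ, hΨ, r, hr, hrg, hΨu⟩ := exists_transportFlow hA hf hu hq₀u hk g (u (c 0))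
  obtain ⟨ρ, hρ, hρr, hpos⟩ := g.exists_nonneg hdir hr hrg
  have hρg : ρ ≤ g.r := hρr.trans hrg
  set b := min (ρ / 2) T with hb
  have hb0 : 0 < b := lt_min (half_pos hρ) hT
  have hbρ : b < ρ := (min_le_left _ _).trans_lt (half_lt_self hρ)
  have hbT : b ≤ T := min_le_right _ _
  have hstay : ∀ q ∈ ball q₀ ρ, q ∈ unitSet x₀ →
      (∀ t ∈ Icc 0 b, g.φ (q, t) ∈ unitSet x₀) ∧ ∃ c' : ℝ → SphereBundle d M,
        IsGeodesicOn c' (Icc 0 b) ∧ ∀ t ∈ Icc 0 b,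
          (c' t).1.1 ∈ (extChartAt (𝓡∂ d) x₀).source ∧ coords x₀ (c' t).1 = g.φ (q, t) :=
    fun q hq hqu => g.exists_isGeodesicOn (ball_subset_ball hρg hq) hqu (by linarith)
      (by linarith) (left_mem_Icc.2 hb0.le) fun t ht => hpos q hq hqu t ⟨ht.1, ht.2.trans_lt hbρ⟩
  have hflow : ∀ t ∈ Icc 0 b, (c t).1.1 ∈ (extChartAt (𝓡∂ d) x₀).source ∧
      coords x₀ (c t).1 = g.φ (q₀, t) := by
    obtain ⟨-, c', hc', hcq⟩ := hstay q₀ (mem_ball_self hρ) hq₀u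
    have h0 := hcq 0 (left_mem_Icc.2 hb0.le)
    have heq : c 0 = c' 0 := sphereBundle_ext_coords hsrc h0.1 (by rw [h0.2, g.base])
    intro t ht
    rw [(hc.mono (Icc_subset_Icc le_rfl hbT)).eqOn hc' heq ht]
    exact hcq t ht
  -- A small positive time `δ` at which all the data are regular.
  have hT0 : (0 : ℝ) ∈ Icc 0 T := left_mem_Icc.2 hT.le
  have hlim_u : Tendsto (fun t => u (c t)) (𝓝[Ioc 0 b] 0) (𝓝 (u (c 0))) :=
    (hu.hasDerivWithinAt 0 T c hc 0 hT0).continuousWithinAt.mono_left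
      (nhdsWithin_mono _ fun t ht => ⟨ht.1.le, ht.2.trans hbT⟩)
  have hlim_id : Tendsto (fun t : ℝ => t) (𝓝[Ioc 0 b] 0) (𝓝 0) := nhdsWithin_le_nhds
  have hlim_q : Tendsto (fun t => (q₀, t)) (𝓝[Ioc 0 b] 0) (𝓝 (q₀, (0 : ℝ))) :=
    tendsto_const_nhds.prodMk_nhds hlim_id
  have hlim_φ : Tendsto (fun t => g.φ (q₀, t)) (𝓝[Ioc 0 b] 0) (𝓝 q₀) := by
    have h1 := g.contDiffAt.continuousAt.tendsto.comp hlim_q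
    rwa [g.base] at h1
  have hlim_neg : Tendsto (fun t : ℝ => -t) (𝓝[Ioc 0 b] 0) (𝓝 0) := by
    simpa using hlim_id.neg
  have hev1 := hlim_q.eventually (g.contDiffAt.eventually (by simp))
  have hev2 := ((hlim_φ.prodMk_nhds hlim_u).prodMk_nhds hlim_neg).eventually
    (hΨ.eventually (by simp))
  have hev3 := hlim_u.eventually (ball_mem_nhds _ hr)
  have hne : (𝓝[Ioc 0 b] (0 : ℝ)).NeBot := by
    rw [nhdsWithin_Ioc_eq_nhdsGT hb0]; infer_instance
  obtain ⟨δ, ⟨⟨hφδ, hΨδ⟩, huδ⟩, hδ⟩ :=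
    ((hev1.and hev2).and hev3 |>.and self_mem_nhdsWithin).exists
  have hδb : δ ∈ Icc 0 b := Ioc_subset_Icc_self hδ
  have hcδ : inCoords x₀ u (g.φ (q₀, δ)) = u (c δ) := by
    rw [← (hflow δ hδb).2, inCoords_coords u (hflow δ hδb).1]
  have hφ' : ContDiffAt ℝ k (fun q => g.φ (q, δ)) q₀ :=
    contDiffAt_comp_of_eq hφδ (contDiffAt_id.prodMk contDiffAt_const) rfl
  have hmaps : ∀ᶠ q in 𝓝[unitSet x₀] q₀, g.φ (q, δ) ∈ unitSet x₀ := by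
    filter_upwards [self_mem_nhdsWithin, nhdsWithin_le_nhds (ball_mem_nhds q₀ hρ)] with q hqu hq
    exact (hstay q hq hqu).1 δ hδb
  have hlater : ContDiffWithinAt ℝ k (inCoords x₀ u) (unitSet x₀) (g.φ (q₀, δ)) := by
    rw [← (hflow δ hδb).2]
    exact (contMDiffWithinAt_extendZero_iff (hflow δ hδb).1).1 (h δ ⟨hδ.1, hδ.2.trans hbT⟩)
  have hF : ContDiffWithinAt ℝ k (fun q => inCoords x₀ u (g.φ (q, δ))) (unitSet x₀) q₀ :=
    ContDiffWithinAt.comp_of_preimage_mem_nhdsWithin (g := inCoords x₀ u)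
      (f := fun q => g.φ (q, δ)) q₀ hlater hφ'.contDiffWithinAt hmaps
  have hG : ContDiffWithinAt ℝ k
      (fun q => Ψ ((g.φ (q, δ), inCoords x₀ u (g.φ (q, δ))), -δ)) (unitSet x₀) q₀ :=
    ContDiffAt.comp_contDiffWithinAt (g := Ψ)
      (f := fun q => ((g.φ (q, δ), inCoords x₀ u (g.φ (q, δ))), -δ)) q₀
      (by rw [hcδ]; exact hΨδ) ((hφ'.contDiffWithinAt.prodMk hF).prodMk contDiffWithinAt_const)
  have hnear : ∀ᶠ q in 𝓝[unitSet x₀] q₀, inCoords x₀ u (g.φ (q, δ)) ∈ ball (u (c 0)) r :=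
    hF.continuousWithinAt.eventually (isOpen_ball.mem_nhds
      (show inCoords x₀ u (g.φ (q₀, δ)) ∈ ball (u (c 0)) r by rw [hcδ]; exact huδ))
  have hev : ∀ᶠ q in 𝓝[unitSet x₀] q₀,
      inCoords x₀ u q = Ψ ((g.φ (q, δ), inCoords x₀ u (g.φ (q, δ))), -δ) := by
    filter_upwards [self_mem_nhdsWithin, nhdsWithin_le_nhds (ball_mem_nhds q₀ hρ), hnear]
      with q hqu hq hdist
    refine hΨu q (ball_subset_ball hρr hq) hqu δ ⟨by linarith [hδ.1], by linarith [hδ.2]⟩ ?_ hdist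
    rw [uIcc_of_le hδ.1.le]
    exact fun s hs => hpos q hq hqu s ⟨hs.1, (hs.2.trans hδ.2).trans_lt hbρ⟩
  exact hG.congr_of_eventuallyEq hev (hev.self_of_nhdsWithin hq₀u)

/-- Regularity of the solution on the outward boundary, if its boundary values vanish. -/
theorem contMDiffWithinAt_of_mem_outwardBoundary (hconvex : StrictlyConvexBoundary d M)
    (hA : ∀ i j, IsSmooth (fun p => A p i j)) (hf : IsSmooth f) (hu : IsTransportSolution A f u)
    (hb : ∀ p : SphereBundle d M, p.1.1 ∈ (𝓡∂ d).boundary M → u p = 0) {k : ℕ} (hk : k ≠ 0)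
    {p : SphereBundle d M} (hp : p ∈ outwardBoundary d M) :
    ContMDiffWithinAt (𝓡∂ d).tangent 𝓘(ℝ, Fin n → ℂ) k (extendZero u) (sphereSet d M) p.1 := by
  have hsrc : p.1.1 ∈ (extChartAt (𝓡∂ d) p.1.1).source := mem_extChartAt_source _
  rw [contMDiffWithinAt_extendZero_iff hsrc]
  have hqu : coords p.1.1 p.1 ∈ unitSet p.1.1 := coords_mem_unitSet hsrc
  have h0 : (coords p.1.1 p.1).1 0 = 0 := (mem_boundary_iff hsrc).1 hp.1
  have h1 : (coords p.1.1 p.1).2 0 ≤ 0 := (mem_outwardBoundary_iff.1 hp).2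
  rcases h1.eq_or_lt with h1 | h1
  · refine contDiffWithinAt_of_glancing hA hf hu hb hqu h0 h1
      (christoffelMap_zero_pos hconvex hp.1 h1 fun hv => ?_) hk
    have h2 := hqu.2
    rw [show (coords p.1.1 p.1).2 = 0 from hv, map_zero] at h2
    exact zero_ne_one h2
  · exact contDiffWithinAt_of_transversal hA hf hu hb hqu h0 h1 hk

/-- A solution whose boundary values vanish is smooth. -/
theorem IsTransportSolution.isSmooth [T2Space M] [CompactSpace M] (hnt : Nontrapping d M)
    (hconvex : StrictlyConvexBoundary d M) (hA : ∀ i j, IsSmooth (fun p => A p i j))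
    (hf : IsSmooth f) (hu : IsTransportSolution A f u)
    (hb : ∀ p : SphereBundle d M, p.1.1 ∈ (𝓡∂ d).boundary M → u p = 0) : IsSmooth u := by
  refine isSmooth_of_forall fun k hk p => ?_
  obtain ⟨T, hT, c, hc0, hc, hcT⟩ := exists_isGeodesicOn_outwardBoundary hnt p
  let P : ℝ → Prop := fun t => ContMDiffWithinAt (𝓡∂ d).tangent 𝓘(ℝ, Fin n → ℂ) k (extendZero u)
    (sphereSet d M) (c t).1
  suffices hsuff : ∀ t ∈ Icc 0 T, P t by
    rw [← hc0]
    exact hsuff 0 (left_mem_Icc.2 hT)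
  by_contra hcon
  push Not at hcon
  obtain ⟨t₁, ht₁, hPt₁⟩ := hcon
  set K : Set ℝ := {t ∈ Icc 0 T | ¬ P t} with hK
  have hKne : K.Nonempty := ⟨t₁, ht₁, hPt₁⟩
  have hKclosed : IsClosed K := by
    refine isClosed_of_closure_subset fun t ht => ?_
    have htI : t ∈ Icc 0 T := closure_minimal (fun _ h => h.1) isClosed_Icc ht
    refine ⟨htI, fun hP => ?_⟩
    have h1 := hc.eventually_contMDiffWithinAt htI hP
    obtain ⟨s, hs, hPs⟩ := ((mem_closure_iff_frequently.1 ht).and_eventually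
      (eventually_nhdsWithin_iff.1 h1)).exists
    exact hs.2 (hPs hs.1)
  -- The last time at which regularity fails cannot be followed by times at which it holds.
  obtain ⟨t₀, ht₀, hmax⟩ :=
    (isCompact_Icc.of_isClosed_subset hKclosed fun _ h => h.1).exists_isGreatest hKne
  have hPT : P T := contMDiffWithinAt_of_mem_outwardBoundary hconvex hA hf hu hb hk hcT
  have hlt : t₀ < T := ht₀.1.2.lt_of_ne fun h => ht₀.2 (h ▸ hPT)
  have hshift : IsGeodesicOn (fun t => c (t + t₀)) (Icc 0 (T - t₀)) :=
    (hc.comp_add t₀).mono fun t ht => ⟨by linarith [ht.1, ht₀.1.1], by linarith [ht.2]⟩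
  have h0 := contMDiffWithinAt_of_forall_later hconvex hA hf hu (sub_pos.2 hlt) hshift hk
    fun t ht => by
      by_contra hP
      have := hmax ⟨⟨by linarith [ht.1, ht₀.1.1], by linarith [ht.2]⟩, hP⟩
      linarith [ht.1]
  simp only [zero_add] at h0
  exact ht₀.2 h0

end Propagation

end GeodesicTransport

theorem mainTheorem8 {d : ℕ} [NeZero d] (hd : 2 ≤ d)
    {M : Type*} [TopologicalSpace M] [T2Space M] [CompactSpace M]
    [ChartedSpace (EuclideanHalfSpace d) M] [IsManifold (𝓡∂ d) ∞ M]
    [RiemannianBundle (fun x : M => TangentSpace (𝓡∂ d) x)]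
    [IsContMDiffRiemannianBundle (𝓡∂ d) ∞ (EuclideanSpace ℝ (Fin d))
      (fun x : M => TangentSpace (𝓡∂ d) x)]
    (hnontrapping : GeodesicTransport.Nontrapping d M)
    (hconvex : GeodesicTransport.StrictlyConvexBoundary d M)
    {n : ℕ}
    (A : GeodesicTransport.SphereBundle d M → Matrix (Fin n) (Fin n) ℂ)
    (hA : ∀ i j, GeodesicTransport.IsSmooth (fun p => A p i j))
    (f : GeodesicTransport.SphereBundle d M → Fin n → ℂ)
    (hf : GeodesicTransport.IsSmooth f) :
    (∃! u, GeodesicTransport.IsTransportSolution A f u) ∧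
      (GeodesicTransport.rayTransform A f = 0 →
        GeodesicTransport.IsSmooth (GeodesicTransport.transportSolution A f)) := by
  obtain ⟨u, hu, huniq⟩ := GeodesicTransport.existsUnique_isTransportSolution hnontrapping hconvex
    hA hf
  refine ⟨⟨u, hu, huniq⟩, fun h => ?_⟩
  have hsol : GeodesicTransport.IsTransportSolution A f
      (GeodesicTransport.transportSolution A f) := Classical.epsilon_spec ⟨u, hu⟩
  refine hsol.isSmooth hnontrapping hconvex hA hf fun p hp => ?_
  rcases le_total 0 ((GeodesicTransport.componentsAt p.1.1 p.1.2) 0) with h0 | h0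
  · exact congrFun h ⟨p, GeodesicTransport.mem_inwardBoundary_iff.2 ⟨hp, h0⟩⟩
  · exact hsol.eq_zero p (GeodesicTransport.mem_outwardBoundary_iff.2 ⟨hp, h0⟩)
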